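/- Let $\varepsilon\in\{1,-1\}$ ($\varepsilon=1$: focusing case, $\varepsilon=-1$: defocusing case), let $\mu\in(-\varepsilon\pi^2,+\infty)$, and let $\phi_\mu$ be the nonlinear ground state, i.e. the positive solution on $(0,1)$ of $$\phi_\mu''+\varepsilon\phi_\mu^3=\varepsilon\mu\,\phi_\mu,\qquad \phi_\mu(0)=\phi_\mu(1)=0 .$$ Let $T>0$ and let $u\in\dot H^1_0((0,T),\mathbb R):=\{u\in H^1_0((0,T),\mathbb R)\,;\ \int_0^T u(t)\,dt=0\}$. Then there exists a unique (classical) solution $$\psi\in C^0([0,T],H^3\cap H^1_0((0,1),\mathbb C))\cap C^1([0,T],H^1_0((0,1),\mathbb C))$$ of $$\begin{cases} i\,\partial_t\psi=-\partial_x^2\psi-\varepsilon|\psi|^2\psi+i\,u(t)\,\partial_x[x\psi], & x\in(0,1),\ t\in(0,T),\\ \psi(t,0)=\psi(t,1)=0, & t\in(0,T),\\ \psi(0,x)=\phi_\mu(x), & x\in(0,1).\end{cases}$$ Moreover $\psi(T)\in H^3_{(0)}(0,1):=\{\varphi\in H^3((0,1),\mathbb C)\,;\ \varphi=\varphi''=0\text{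 at }x=0,1\}$, and $$\|\psi(t)\|_{L^2(0,1)}=\|\phi_\mu\|_{L^2(0,1)}\,e^{\frac12\int_0^t u(s)\,ds}\qquad\text{for all } t\in[0,T].$$ -/

import Mathlib

open MeasureTheory Set
open scoped ContDiff

noncomputable section

/-- The Lebesgue space `L²((a,b), 𝕜)`. -/
abbrev L2 (𝕜 : Type) [RCLike 𝕜] (a b : ℝ) : Type :=
  Lp 𝕜 2 ((volume : Measure ℝ).restrict (Ioo a b))

/-- `g` is the weak derivative of order `k` of `f` on `(a,b)`:
`∫ θ⁽ᵏ⁾ f = (-1)ᵏ ∫ θ g` for every test function `θ ∈ C_c^∞((a,b))`. -/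
def IsWeakDeriv {𝕜 : Type} [RCLike 𝕜] (a b : ℝ) (k : ℕ) (f g : ℝ → 𝕜) : Prop :=
  ∀ θ : ℝ → ℝ, ContDiff ℝ ∞ θ → HasCompactSupport θ → tsupport θ ⊆ Ioo a b →
    ∫ x in Ioo a b, iteratedDeriv k θ x • f x = (-1) ^ k * ∫ x in Ioo a b, θ x • g x

/-- `f` has a representative that is continuous on `[a,b]` and vanishes at `a` and at `b`. -/
def VanishesAtEnds {𝕜 : Type} [RCLike 𝕜] {a b : ℝ} (f : L2 𝕜 a b) : Prop :=
  ∃ c : ℝ → 𝕜, ContinuousOn c (Icc a b) ∧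
    (∀ᵐ x ∂(volume : Measure ℝ).restrict (Ioo a b), f x = c x) ∧ c a = 0 ∧ c b = 0

lemma integrable_smul_L2 {𝕜 : Type} [RCLike 𝕜] {a b : ℝ} {θ : ℝ → ℝ}
    (hc : Continuous θ) (hs : HasCompactSupport θ) (f : L2 𝕜 a b) :
    Integrable (fun x => θ x • f x) ((volume : Measure ℝ).restrict (Ioo a b)) := by
  have hf : Integrable (f : ℝ → 𝕜) ((volume : Measure ℝ).restrict (Ioo a b)) :=
    (Lp.memLp f).integrable (by norm_num)
  obtain ⟨C, hC⟩ := hc.bounded_above_of_compact_support hs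
  exact hf.bdd_smul C hc.aestronglyMeasurable (Filter.Eventually.of_forall hC)

lemma integrable_iteratedDeriv_smul_L2 {𝕜 : Type} [RCLike 𝕜] {a b : ℝ} {θ : ℝ → ℝ}
    (hθ : ContDiff ℝ ∞ θ) (hs : HasCompactSupport θ) (k : ℕ) (f : L2 𝕜 a b) :
    Integrable (fun x => iteratedDeriv k θ x • f x)
      ((volume : Measure ℝ).restrict (Ioo a b)) := by
  refine integrable_smul_L2 (hθ.continuous_iteratedDeriv k (by exact_mod_cast le_top)) ?_ f
  induction k with
  | zero => simpa using hs
  | succ k ih => rw [iteratedDeriv_succ]; exact ih.deriv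

lemma IsWeakDeriv.add {𝕜 : Type} [RCLike 𝕜] {a b : ℝ} {k : ℕ} {f g f' g' : L2 𝕜 a b}
    (h : IsWeakDeriv a b k f g) (h' : IsWeakDeriv a b k f' g') :
    IsWeakDeriv a b k (f + f' : L2 𝕜 a b) (g + g' : L2 𝕜 a b) := by
  intro θ h1 h2 h3
  have e1 : ∫ x in Ioo a b, iteratedDeriv k θ x • (f + f' : L2 𝕜 a b) x
      = ∫ x in Ioo a b, (iteratedDeriv k θ x • f x + iteratedDeriv k θ x • f' x) := by
    apply integral_congr_ae
    filter_upwards [Lp.coeFn_add f f'] with x hx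
    rw [hx, Pi.add_apply, smul_add]
  have e2 : ∫ x in Ioo a b, θ x • (g + g' : L2 𝕜 a b) x
      = ∫ x in Ioo a b, (θ x • g x + θ x • g' x) := by
    apply integral_congr_ae
    filter_upwards [Lp.coeFn_add g g'] with x hx
    rw [hx, Pi.add_apply, smul_add]
  rw [e1, e2, integral_add (integrable_iteratedDeriv_smul_L2 h1 h2 k f)
    (integrable_iteratedDeriv_smul_L2 h1 h2 k f'),
    integral_add (integrable_smul_L2 h1.continuous h2 g)
    (integrable_smul_L2 h1.continuous h2 g'), h θ h1 h2 h3, h' θ h1 h2 h3, mul_add]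

lemma IsWeakDeriv.const_smul {𝕜 : Type} [RCLike 𝕜] {a b : ℝ} {k : ℕ} {f g : L2 𝕜 a b}
    (z : 𝕜) (h : IsWeakDeriv a b k f g) :
    IsWeakDeriv a b k (z • f : L2 𝕜 a b) (z • g : L2 𝕜 a b) := by
  intro θ h1 h2 h3
  have e1 : ∫ x in Ioo a b, iteratedDeriv k θ x • (z • f : L2 𝕜 a b) x
      = ∫ x in Ioo a b, z • (iteratedDeriv k θ x • f x) := by
    apply integral_congr_ae
    filter_upwards [Lp.coeFn_smul z f] with x hx
    rw [hx, Pi.smul_apply, smul_comm]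
  have e2 : ∫ x in Ioo a b, θ x • (z • g : L2 𝕜 a b) x
      = ∫ x in Ioo a b, z • (θ x • g x) := by
    apply integral_congr_ae
    filter_upwards [Lp.coeFn_smul z g] with x hx
    rw [hx, Pi.smul_apply, smul_comm]
  rw [e1, e2, integral_smul, integral_smul, h θ h1 h2 h3, mul_smul_comm]

lemma IsWeakDeriv.zero {𝕜 : Type} [RCLike 𝕜] {a b : ℝ} {k : ℕ} :
    IsWeakDeriv a b k (0 : L2 𝕜 a b) (0 : L2 𝕜 a b) := by
  have h := IsWeakDeriv.const_smul (a := a) (b := b) (k := 0) (0 : 𝕜) (f := 0) (g := 0)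
    (fun θ _ _ _ => by simp)
  intro θ _ _ _
  have e : ∀ η : ℝ → ℝ, ∫ x in Ioo a b, η x • (0 : L2 𝕜 a b) x = 0 := by
    intro η
    apply integral_eq_zero_of_ae
    filter_upwards [Lp.coeFn_zero 𝕜 2 ((volume : Measure ℝ).restrict (Ioo a b))] with x hx
    rw [hx]; simp
  rw [e, e, mul_zero]

/-- The Sobolev space `Hᵏ((a,b), 𝕜)`. An element is the family `(f, f', …, f⁽ᵏ⁾)` of the weak
derivatives in `L²` of a function `f`, and the norm inherited from the `ℓ²`-product is
`(∑ j ≤ k, ‖f⁽ʲ⁾‖²_{L²})^{1/2}`. -/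
def Sobolev (𝕜 : Type) [RCLike 𝕜] (a b : ℝ) (k : ℕ) :
    Submodule 𝕜 (PiLp 2 fun _ : Fin (k + 1) => L2 𝕜 a b) where
  carrier := {F | ∀ j : Fin (k + 1), IsWeakDeriv a b j (F 0) (F j)}
  add_mem' hF hG j := (hF j).add (hG j)
  zero_mem' _ := IsWeakDeriv.zero
  smul_mem' z _ hF j := (hF j).const_smul z

/-- For `k ≥ 1`, the space `Hᵏ ∩ H¹₀((a,b), 𝕜)`, with the norm of `Hᵏ`;
in particular `H¹₀((a,b), 𝕜)` for `k = 1`. -/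
def SobolevZero (𝕜 : Type) [RCLike 𝕜] (a b : ℝ) (k : ℕ) :
    Submodule 𝕜 (PiLp 2 fun _ : Fin (k + 1) => L2 𝕜 a b) where
  carrier := {F | F ∈ Sobolev 𝕜 a b k ∧ VanishesAtEnds (F 0)}
  add_mem' := by
    rintro F G ⟨hF, c, hc, hFc, hca, hcb⟩ ⟨hG, d, hd, hGd, hda, hdb⟩
    refine ⟨add_mem hF hG, fun x => c x + d x, hc.add hd, ?_, by simp [hca, hda],
      by simp [hcb, hdb]⟩
    filter_upwards [Lp.coeFn_add (F 0) (G 0), hFc, hGd] with x hx h1 h2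
    rw [PiLp.add_apply, hx, Pi.add_apply, h1, h2]
  zero_mem' := by
    refine ⟨zero_mem _, 0, continuousOn_const, ?_, rfl, rfl⟩
    exact Lp.coeFn_zero 𝕜 2 ((volume : Measure ℝ).restrict (Ioo a b))
  smul_mem' := by
    rintro z F ⟨hF, c, hc, hFc, hca, hcb⟩
    refine ⟨Submodule.smul_mem _ z hF, fun x => z * c x, continuousOn_const.mul hc, ?_,
      by simp [hca], by simp [hcb]⟩
    filter_upwards [Lp.coeFn_smul z (F 0), hFc] with x hx h1
    rw [PiLp.smul_apply, hx, Pi.smul_apply, h1, smul_eq_mul]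

/-- The weak derivative of order `j` of an element of `Hᵏ ∩ H¹₀`, as an element of `L²`;
`wderiv F 0` is the function itself. -/
def wderiv {𝕜 : Type} [RCLike 𝕜] {a b : ℝ} {k : ℕ} (F : SobolevZero 𝕜 a b k)
    (j : Fin (k + 1)) : L2 𝕜 a b :=
  F.1 j

/-- The inclusion of `H³ ∩ H¹₀(0,1)` into `H¹₀(0,1)`. -/
def toH10 (F : SobolevZero ℂ 0 1 3) : SobolevZero ℂ 0 1 1 :=
  ⟨WithLp.toLp 2 ![wderiv F 0, wderiv F 1], by
    refine ⟨fun j => ?_, F.2.2⟩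
    fin_cases j
    · exact F.2.1 0
    · exact F.2.1 1⟩

/-- Membership in `H³₍₀₎(0,1) = {f ∈ H³(0,1) ; f = f'' = 0 at x = 0, 1}`
(of a function that is already in `H³ ∩ H¹₀`). -/
def MemH3Paren (F : SobolevZero ℂ 0 1 3) : Prop :=
  VanishesAtEnds (wderiv F 0) ∧ VanishesAtEnds (wderiv F 2)

/-- `u` is (the continuous representative of) an element of
`{u ∈ H¹₀((0,T), ℝ) ; ∫₀ᵀ u = 0}`. -/
structure MemHDot10 (T : ℝ) (u : ℝ → ℝ) : Prop where
  continuousOn : ContinuousOn u (Icc 0 T)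
  mem : ∃ U : SobolevZero ℝ 0 T 1,
    ∀ᵐ t ∂(volume : Measure ℝ).restrict (Ioo 0 T), wderiv U 0 t = u t
  integral_eq_zero : ∫ t in (0 : ℝ)..T, u t = 0

/-- `φ` is a positive solution of `φ'' + ε φ³ = ε μ φ` on `(0,1)`, `φ(0) = φ(1) = 0`
(`ε = 1`: focusing, `ε = -1`: defocusing). -/
structure IsGroundState (ε μ : ℝ) (φ : ℝ → ℝ) : Prop where
  continuousOn : ContinuousOn φ (Icc 0 1)
  contDiffOn : ContDiffOn ℝ 2 φ (Ioo 0 1)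
  pos : ∀ x ∈ Ioo (0 : ℝ) 1, 0 < φ x
  ode : ∀ x ∈ Ioo (0 : ℝ) 1, deriv (deriv φ) x + ε * φ x ^ 3 = ε * μ * φ x
  left : φ 0 = 0
  right : φ 1 = 0

/-- `ψ ∈ C⁰([0,T], H³ ∩ H¹₀) ∩ C¹([0,T], H¹₀)` solves
`i ∂ₜψ = -∂ₓ²ψ - ε |ψ|² ψ + i u(t) ∂ₓ[xψ]` on `(0,T) × (0,1)` with `ψ(t,0) = ψ(t,1) = 0` and
`ψ(0,·) = φ`. The boundary condition is part of the space in which `ψ(t)` lives, `∂ₓ[xψ]` is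
written `ψ + x ∂ₓψ`, and only the restriction of `ψ` to `[0,T]` is relevant. All terms of the
equation have continuous representatives in `x`, so that equality for almost every `x` is
equality of these at every `x`. -/
structure IsClassicalSolution (ε T : ℝ) (u φ : ℝ → ℝ) (ψ : ℝ → SobolevZero ℂ 0 1 3) :
    Prop where
  continuousOn : ContinuousOn ψ (Icc 0 T)
  contDiffOn : ContDiffOn ℝ 1 (fun t => toH10 (ψ t)) (Icc 0 T)
  equation : ∀ t ∈ Ioo 0 T, ∀ᵐ x ∂(volume : Measure ℝ).restrict (Ioo (0 : ℝ) 1),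
    Complex.I * wderiv (deriv (fun s => toH10 (ψ s)) t) 0 x =
      - wderiv (ψ t) 2 x - (ε : ℂ) * (‖wderiv (ψ t) 0 x‖ ^ 2 : ℝ) * wderiv (ψ t) 0 x
        + Complex.I * (u t : ℂ) * (wderiv (ψ t) 0 x + (x : ℂ) * wderiv (ψ t) 1 x)
  initial : ∀ᵐ x ∂(volume : Measure ℝ).restrict (Ioo (0 : ℝ) 1), wderiv (ψ 0) 0 x = (φ x : ℂ)

end

/-! The term `i u ∂ₓ(xψ)` is an unbounded perturbation, and a gauge factor removes it. With `U(t) =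
∫₀ᵗ u` and `ψ = exp(i u x²/4 + U/2) ξ`, the equation becomes `∂ₜξ = i ξ'' - i V x² ξ + i ε g |ξ|²
ξ`, where `V = (u' - u²)/4` lies in `L²(0,T)` and `g = exp U`. The proof solves this equation
globally in `H³₍₀₎` and then undoes the gauge.

Write `ξ = ∑ aₙ k⁻³ sin(kπx)` with `k = n + 1` and `a ∈ ℓ²`, which encodes `ξ ∈ H³₍₀₎`. The cubic
term preserves this space. Multiplication by `x²` does not: the second derivative of `x²ξ` equals
`4ξ'(1)` at `x = 1`, which adds `(-1)ⁿ` times a scalar to the coefficients (`coef_sq_mul`).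
Integration in time repairs this. The exponentials `exp(-iωₙs)`, `ωₙ = π²k²`, are orthogonal on a
common period, so by Bessel's inequality the sequence `∫₀ᵗ exp(iωₙs) h(s) ds` is in `ℓ²` whenever `h
∈ L²` (`norm_hidden_le`). The Duhamel operator is therefore controlled by `L²` norms in time
(`norm_duhamel_sq_le`), and a Volterra fixed point with the integrable weight `1 + V²` yields mild
solutions for every globally Lipschitz nonlinearity (`exists_mild`).

For the cubic nonlinearity a cutoff is inserted, and a priori bounds show that it is never active
(`exists_mild_cubic`). Mass is conserved because the potential terms are real. The derivative of
`‖ξ'‖²` consists of a virial term, bounded by mass and `‖ξ'‖²`, and of `ε g/2` times the derivative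
of `∫|ξ|⁴`. An integration by parts in time, the one-dimensional bound of `∫|ξ|⁴` and Gronwall's
inequality bound the `H¹` norm for either sign of `ε` (`exists_kin_bound`). The estimate
`norm_cubic_le` is linear in the `H³` norm with a factor that depends only on the `H¹` norm, so a
second use of Gronwall's inequality bounds the `H³` norm (`exists_norm_bound`).

When the gauge is undone, `u'` cancels against the one in `V`, so that `∂ₜψ` involves only
continuous functions of time; this gives the `C¹` regularity in `H¹₀`. The squared modulus of the
gauge factor is `g(t)`, which together with mass conservation gives the norm identity, and `u(T) =
0` makes the factor constant in `x` at time `T`, so that `ψ(T)` inherits the boundary conditions of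
`ξ(T)`. Uniqueness is an `L²` energy estimate for the difference of two solutions
(`re_integral_diff_le`). The ground state is an admissible initial datum because its equation forces
`φ'' = 0` at the ends (`exists_coeff`). -/

noncomputable section

open Filter Topology
open scoped BoundedContinuousFunction

/-! ### Calculus of primitives of integrable functions -/

section Primitive

variable {𝕜 : Type} [RCLike 𝕜] {a b : ℝ}

/-- `f` is a primitive on `[a,b]` of the integrable function `f'`. -/
structure IsPrimitive (a b : ℝ) (f f' : ℝ → 𝕜) : Prop where
  integrable : IntervalIntegrable f' volume a b
  eq : ∀ x ∈ Icc a b, f x = f a + ∫ t in a..x, f' t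

/-- Comparison of increments. It reduces a `𝕜`-valued primitive to the primitive of the norm of its
integrand, and handles the composition with a Lipschitz function. -/
theorem AbsolutelyContinuousOnInterval.of_dist_le {X Y : Type*} [PseudoMetricSpace X]
    [PseudoMetricSpace Y] {f : ℝ → X} {g : ℝ → Y} {K : ℝ} (hK : 0 ≤ K)
    (hg : AbsolutelyContinuousOnInterval g a b)
    (h : ∀ x ∈ uIcc a b, ∀ y ∈ uIcc a b, dist (f x) (f y) ≤ K * dist (g x) (g y)) :
    AbsolutelyContinuousOnInterval f a b := by
  rw [absolutelyContinuousOnInterval_iff] at hg ⊢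
  intro ε hε
  obtain ⟨δ, hδ, H⟩ := hg (ε / (K + 1)) (by positivity)
  refine ⟨δ, hδ, fun E hE hE' => ?_⟩
  have h1 := H E hE hE'
  have h2 : ∑ i ∈ Finset.range E.1, dist (f (E.2 i).1) (f (E.2 i).2) ≤
      K * ∑ i ∈ Finset.range E.1, dist (g (E.2 i).1) (g (E.2 i).2) := by
    rw [Finset.mul_sum]
    refine Finset.sum_le_sum fun i hi => ?_
    have := hE.1 i hi
    exact h _ this.1 _ this.2
  have h3 : 0 ≤ ∑ i ∈ Finset.range E.1, dist (g (E.2 i).1) (g (E.2 i).2) :=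
    Finset.sum_nonneg fun _ _ => dist_nonneg
  rw [lt_div_iff₀ (by positivity)] at h1
  nlinarith

theorem IntervalIntegrable.absolutelyContinuousOnInterval_primitive {f : ℝ → 𝕜}
    (h : IntervalIntegrable f volume a b) :
    AbsolutelyContinuousOnInterval (fun x => ∫ t in a..x, f t) a b := by
  refine AbsolutelyContinuousOnInterval.of_dist_le zero_le_one
    (h.norm.absolutelyContinuousOnInterval_intervalIntegral (c := a) (by simp)) ?_
  intro x hx y hy
  have hax : IntervalIntegrable f volume a x :=
    h.mono_set (uIcc_subset_uIcc (by simp) hx)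
  have hay : IntervalIntegrable f volume a y :=
    h.mono_set (uIcc_subset_uIcc (by simp) hy)
  rw [one_mul, dist_eq_norm, dist_eq_norm, intervalIntegral.integral_interval_sub_left hax hay,
    intervalIntegral.integral_interval_sub_left hax.norm hay.norm]
  exact intervalIntegral.norm_integral_le_abs_integral_norm

namespace IsPrimitive

variable {f f' g g' : ℝ → 𝕜}

/-- The difference between `f` and the integral of `f'` is absolutely continuous with zero
derivative almost everywhere, hence constant. Product and chain rules for primitives are deduced
from this criterion. -/
theorem of_ac (hf : AbsolutelyContinuousOnInterval f a b) (hab : a ≤ b)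
    (hi : IntervalIntegrable f' volume a b)
    (hd : ∀ᵐ x, x ∈ uIcc a b → HasDerivAt f (f' x) x) : IsPrimitive a b f f' := by
  refine ⟨hi, ?_⟩
  have g_ac := hf.sub hi.absolutelyContinuousOnInterval_primitive
  have hz : ∀ᵐ x, x ∈ uIcc a b →
      HasDerivAt (f - fun x => ∫ t in a..x, f' t) 0 x := by
    filter_upwards [hd, hi.ae_hasDerivAt_integral] with x h1 h2 h3
    have := (h1 h3).sub (h2 h3 a (by simp))
    rwa [sub_self] at this
  obtain ⟨C, hC⟩ := g_ac.const_of_ae_hasDerivAt_zero hz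
  intro x hx
  have h1 := hC x (by rwa [uIcc_of_le hab])
  have h2 := hC a (by simp)
  simp only [Pi.sub_apply, intervalIntegral.integral_same, sub_zero] at h1 h2
  rw [h2, ← h1]; ring

theorem ac (h : IsPrimitive a b f f') (hab : a ≤ b) : AbsolutelyContinuousOnInterval f a b := by
  refine AbsolutelyContinuousOnInterval.of_dist_le zero_le_one
    h.integrable.absolutelyContinuousOnInterval_primitive ?_
  intro x hx y hy
  rw [uIcc_of_le hab] at hx hy
  rw [h.eq x hx, h.eq y hy, one_mul, dist_add_left]

theorem continuousOn (h : IsPrimitive a b f f') (hab : a ≤ b) : ContinuousOn f (Icc a b) := by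
  have := (h.ac hab).continuousOn
  rwa [uIcc_of_le hab] at this

theorem ae_hasDerivAt (h : IsPrimitive a b f f') (hab : a ≤ b) :
    ∀ᵐ x, x ∈ Ioo a b → HasDerivAt f (f' x) x := by
  filter_upwards [h.integrable.ae_hasDerivAt_integral] with x hx hx'
  have h1 := (hx (by rw [uIcc_of_le hab]; exact Ioo_subset_Icc_self hx') a (by simp)).const_add (f a)
  refine h1.congr_of_eventuallyEq ?_
  filter_upwards [isOpen_Ioo.mem_nhds hx'] with y hy
  exact h.eq y (Ioo_subset_Icc_self hy)

theorem _root_.ae_uIcc_of_Ioo {p : ℝ → Prop} (hab : a ≤ b) (h : ∀ᵐ x, x ∈ Ioo a b → p x) :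
    ∀ᵐ x, x ∈ uIcc a b → p x := by
  have h1 : ∀ᵐ x : ℝ, x ≠ a := Measure.ae_ne volume a
  have h2 : ∀ᵐ x : ℝ, x ≠ b := Measure.ae_ne volume b
  filter_upwards [h, h1, h2] with x hx ha hb hx'
  rw [uIcc_of_le hab] at hx'
  exact hx ⟨lt_of_le_of_ne hx'.1 (Ne.symm ha), lt_of_le_of_ne hx'.2 hb⟩

theorem mul (hab : a ≤ b) (hf : IsPrimitive a b f f') (hg : IsPrimitive a b g g') :
    IsPrimitive a b (fun x => f x * g x) (fun x => f' x * g x + f x * g' x) := by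
  refine of_ac ((hf.ac hab).smul (hg.ac hab)) hab ?_ ?_
  · have h1 := hf.continuousOn hab
    have h2 := hg.continuousOn hab
    rw [← uIcc_of_le hab] at h1 h2
    exact (hf.integrable.mul_continuousOn h2).add (hg.integrable.continuousOn_mul h1)
  · apply ae_uIcc_of_Ioo hab
    filter_upwards [hf.ae_hasDerivAt hab, hg.ae_hasDerivAt hab] with x h1 h2 hx
    exact (h1 hx).mul (h2 hx)

theorem add (hab : a ≤ b) (hf : IsPrimitive a b f f') (hg : IsPrimitive a b g g') :
    IsPrimitive a b (fun x => f x + g x) (fun x => f' x + g' x) := by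
  refine of_ac ((hf.ac hab).add (hg.ac hab)) hab (hf.integrable.add hg.integrable) ?_
  apply ae_uIcc_of_Ioo hab
  filter_upwards [hf.ae_hasDerivAt hab, hg.ae_hasDerivAt hab] with x h1 h2 hx
  exact (h1 hx).add (h2 hx)

theorem const (c : 𝕜) : IsPrimitive a b (fun _ => c) (fun _ => 0) :=
  ⟨by simp, by simp⟩

theorem const_mul (hab : a ≤ b) (c : 𝕜) (hf : IsPrimitive a b f f') :
    IsPrimitive a b (fun x => c * f x) (fun x => c * f' x) := by
  simpa using (const (a := a) (b := b) c).mul hab hf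

theorem congr_left (hf : IsPrimitive a b f f') (h : ∀ x ∈ Icc a b, g x = f x) :
    IsPrimitive a b g f' := by
  refine ⟨hf.integrable, fun x hx => ?_⟩
  rw [h x hx, h a ⟨le_rfl, hx.1.trans hx.2⟩]
  exact hf.eq x hx

theorem congr_right (hf : IsPrimitive a b f f') (hab : a ≤ b)
    (h : ∀ x ∈ Ioo a b, f' x = g' x) : IsPrimitive a b f g' := by
  have h' : ∀ᵐ x, x ∈ uIcc a b → f' x = g' x :=
    ae_uIcc_of_Ioo hab (Eventually.of_forall h)
  rw [uIcc_of_le hab] at h'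
  refine ⟨hf.integrable.congr_ae ?_, fun x hx => ?_⟩
  · rw [EventuallyEq, ae_restrict_iff' measurableSet_uIoc]
    filter_upwards [h'] with x hx hx'
    rw [uIoc_of_le hab] at hx'
    exact hx (Ioc_subset_Icc_self hx')
  · rw [hf.eq x hx]
    congr 1
    apply intervalIntegral.integral_congr_ae
    filter_upwards [h'] with y hy hy'
    rw [uIoc_of_le hx.1] at hy'
    exact hy ⟨hy'.1.le, hy'.2.trans hx.2⟩

theorem congr (hf : IsPrimitive a b f f') (hab : a ≤ b) (h : ∀ x ∈ Icc a b, g x = f x)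
    (h' : ∀ x ∈ Ioo a b, f' x = g' x) : IsPrimitive a b g g' :=
  (hf.congr_left h).congr_right hab h'

theorem sub (hab : a ≤ b) (hf : IsPrimitive a b f f') (hg : IsPrimitive a b g g') :
    IsPrimitive a b (fun x => f x - g x) (fun x => f' x - g' x) :=
  (hf.add hab (hg.const_mul hab (-1))).congr hab (fun _ _ => by ring) (fun _ _ => by ring)

theorem mono {c : ℝ} (hf : IsPrimitive a b f f') (hac : a ≤ c) (hcb : c ≤ b) :
    IsPrimitive a c f f' := by
  refine ⟨hf.integrable.mono_set ?_, fun x hx => hf.eq x ⟨hx.1, hx.2.trans hcb⟩⟩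
  rw [uIcc_of_le hac, uIcc_of_le (hac.trans hcb)]
  exact Icc_subset_Icc_right hcb

theorem integral_eq_sub (hf : IsPrimitive a b f f') (hab : a ≤ b) :
    ∫ x in a..b, f' x = f b - f a := by
  rw [hf.eq b ⟨hab, le_rfl⟩]; ring

/-- Integration by parts. -/
theorem integral_mul_eq_sub (hab : a ≤ b) (hf : IsPrimitive a b f f')
    (hg : IsPrimitive a b g g') :
    ∫ x in a..b, f' x * g x = f b * g b - f a * g a - ∫ x in a..b, f x * g' x := by
  have h1 := hf.continuousOn hab
  have h2 := hg.continuousOn hab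
  rw [← uIcc_of_le hab] at h1 h2
  have h := (hf.mul hab hg).integral_eq_sub hab
  rw [intervalIntegral.integral_add (hf.integrable.mul_continuousOn h2)
    (hg.integrable.continuousOn_mul h1)] at h
  rw [← h]; ring

theorem of_hasDerivAt (hab : a ≤ b) (hc : ContinuousOn f (Icc a b))
    (h : ∀ x ∈ Ioo a b, HasDerivAt f (f' x) x) (hi : IntervalIntegrable f' volume a b) :
    IsPrimitive a b f f' := by
  refine ⟨hi, fun x hx => ?_⟩
  rw [intervalIntegral.integral_eq_sub_of_hasDerivAt_of_le hx.1
    (hc.mono (Icc_subset_Icc_right hx.2)) (fun y hy => h y ⟨hy.1, hy.2.trans_le hx.2⟩)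
    (hi.mono_set (by rw [uIcc_of_le hx.1, uIcc_of_le hab]; exact Icc_subset_Icc_right hx.2))]
  ring

theorem of_continuous (hab : a ≤ b) (h : ∀ x, HasDerivAt f (f' x) x) (hc : Continuous f') :
    IsPrimitive a b f f' :=
  of_hasDerivAt hab (fun x _ => (h x).continuousAt.continuousWithinAt) (fun x _ => h x)
    (hc.intervalIntegrable _ _)

theorem id (hab : a ≤ b) : IsPrimitive a b (fun x => (x : 𝕜)) (fun _ => 1) :=
  of_continuous hab (fun x => by
    simpa using (RCLike.ofRealCLM (K := 𝕜)).hasDerivAt (x := x)) continuous_const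

theorem star (hf : IsPrimitive a b f f') :
    IsPrimitive a b (fun x => starRingEnd 𝕜 (f x)) (fun x => starRingEnd 𝕜 (f' x)) := by
  refine ⟨?_, fun x hx => ?_⟩
  · exact ⟨(RCLike.conjCLE (K := 𝕜)).toContinuousLinearMap.integrable_comp hf.integrable.1,
      (RCLike.conjCLE (K := 𝕜)).toContinuousLinearMap.integrable_comp hf.integrable.2⟩
  · rw [hf.eq x hx, map_add, intervalIntegral.integral_of_le hx.1,
      intervalIntegral.integral_of_le hx.1, integral_conj]

theorem ofReal {f f' : ℝ → ℝ} (hf : IsPrimitive a b f f') :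
    IsPrimitive a b (fun x => (f x : ℂ)) (fun x => (f' x : ℂ)) := by
  refine ⟨⟨hf.integrable.1.ofReal, hf.integrable.2.ofReal⟩, fun x hx => ?_⟩
  rw [intervalIntegral.integral_ofReal, hf.eq x hx, Complex.ofReal_add]

theorem re {f f' : ℝ → ℂ} (hf : IsPrimitive a b f f') :
    IsPrimitive a b (fun x => (f x).re) (fun x => (f' x).re) := by
  refine ⟨⟨hf.integrable.1.re, hf.integrable.2.re⟩, fun x hx => ?_⟩
  have hi : IntervalIntegrable f' volume a x := hf.integrable.mono_set (by
    rw [uIcc_of_le hx.1, uIcc_of_le (hx.1.trans hx.2)]; exact Icc_subset_Icc_right hx.2)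
  rw [hf.eq x hx, Complex.add_re]
  congr 1
  exact (Complex.reCLM.intervalIntegral_comp_comm hi).symm

/-- The values of `f` stay in a ball of some radius `R`, on which the exponential is Lipschitz with
constant `exp R`. -/
theorem cexp {f f' : ℝ → ℂ} (hab : a ≤ b) (hf : IsPrimitive a b f f') :
    IsPrimitive a b (fun x => Complex.exp (f x)) (fun x => f' x * Complex.exp (f x)) := by
  have hc := hf.continuousOn hab
  obtain ⟨R, hR⟩ := isCompact_Icc.exists_bound_of_continuousOn hc
  refine of_ac ?_ hab ?_ ?_
  · refine AbsolutelyContinuousOnInterval.of_dist_le (Real.exp_pos R).le (hf.ac hab) ?_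
    intro x hx y hy
    rw [uIcc_of_le hab] at hx hy
    rw [dist_eq_norm, dist_eq_norm]
    refine (convex_closedBall (0 : ℂ) R).norm_image_sub_le_of_norm_hasDerivWithin_le
      (f := Complex.exp) (f' := Complex.exp)
      (fun z _ => (Complex.hasDerivAt_exp z).hasDerivWithinAt) (fun z hz => ?_)
      (by simpa using hR y hy) (by simpa using hR x hx)
    rw [Complex.norm_exp]
    have : ‖z‖ ≤ R := by simpa using hz
    exact Real.exp_le_exp.2 ((Complex.re_le_norm z).trans this)
  · refine hf.integrable.mul_continuousOn ?_
    rw [uIcc_of_le hab]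
    exact Complex.continuous_exp.comp_continuousOn hc
  · apply ae_uIcc_of_Ioo hab
    filter_upwards [hf.ae_hasDerivAt hab] with x h1 hx
    rw [mul_comm]
    exact (h1 hx).cexp

end IsPrimitive

end Primitive

/-! ### Gronwall's inequality and Volterra equations with an integrable weight -/

section Volterra

/-- The convolution of an integrable weight with a steep exponential is uniformly small. -/
theorem exists_exp_weight_small {w : ℝ → ℝ} {T : ℝ} (hT : 0 ≤ T)
    (hw : IntervalIntegrable w volume 0 T) {δ : ℝ} (hδ : 0 < δ) :
    ∃ l : ℝ, 0 < l ∧ ∀ t ∈ Icc 0 T, ∫ s in (0 : ℝ)..t, |w s| * Real.exp (-l * (t - s)) ≤ δ := by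
  -- `v` is bounded and `δ/2`-close to `w` in `L¹`. The kernel is at most `1`, so the error costs
  -- `δ/2`; the kernel has integral at most `1/l`, so `v` costs `‖v‖/l`, and `l` is chosen to make
  -- this at most `δ/2`.
  obtain ⟨v, hv1, hv2⟩ := hw.1.exists_boundedContinuous_integral_sub_le (half_pos hδ)
  have hwv : IntervalIntegrable (fun s => w s - v s) volume 0 T :=
    hw.sub (v.continuous.intervalIntegrable _ _)
  refine ⟨2 * (‖v‖ + 1) / δ, by positivity, fun t ht => ?_⟩
  set l := 2 * (‖v‖ + 1) / δ with hl
  have hl0 : 0 < l := by positivity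
  have hsub : uIcc 0 t ⊆ uIcc 0 T := by
    rw [uIcc_of_le ht.1, uIcc_of_le hT]; exact Icc_subset_Icc_right ht.2
  have hce : Continuous fun s => Real.exp (-l * (t - s)) := by fun_prop
  have hcE : ContinuousOn (fun s => Real.exp (-l * (t - s))) (uIcc 0 t) := hce.continuousOn
  have i1 : IntervalIntegrable (fun s => |w s| * Real.exp (-l * (t - s))) volume 0 t :=
    ((hw.mono_set hsub).abs).mul_continuousOn hcE
  have i2 : IntervalIntegrable (fun s => |w s - v s|) volume 0 t := (hwv.mono_set hsub).abs
  have i3 : IntervalIntegrable (fun s => ‖v‖ * Real.exp (-l * (t - s))) volume 0 t :=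
    (continuous_const.mul hce).intervalIntegrable _ _
  calc ∫ s in (0 : ℝ)..t, |w s| * Real.exp (-l * (t - s))
      ≤ ∫ s in (0 : ℝ)..t, (|w s - v s| + ‖v‖ * Real.exp (-l * (t - s))) := by
        refine intervalIntegral.integral_mono_on ht.1 i1 (i2.add i3) fun s hs => ?_
        have e1 : Real.exp (-l * (t - s)) ≤ 1 := by
          rw [Real.exp_le_one_iff]
          have : 0 ≤ l * (t - s) := mul_nonneg hl0.le (by linarith [hs.2])
          linarith
        have e0 := (Real.exp_pos (-l * (t - s))).le
        have h1 : |w s| ≤ |w s - v s| + ‖v‖ := by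
          have := abs_add_le (w s - v s) (v s)
          have h2 := v.norm_coe_le_norm s
          rw [Real.norm_eq_abs] at h2
          rw [sub_add_cancel] at this
          linarith
        nlinarith [abs_nonneg (w s - v s)]
    _ = (∫ s in (0 : ℝ)..t, |w s - v s|) + ‖v‖ * ∫ s in (0 : ℝ)..t, Real.exp (-l * (t - s)) := by
        rw [intervalIntegral.integral_add i2 i3, intervalIntegral.integral_const_mul]
    _ ≤ δ / 2 + δ / 2 := by
        gcongr
        · calc ∫ s in (0 : ℝ)..t, |w s - v s| ≤ ∫ s in (0 : ℝ)..T, |w s - v s| :=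
              intervalIntegral.integral_mono_interval le_rfl ht.1 ht.2
                (Eventually.of_forall fun _ => abs_nonneg _) hwv.abs
            _ ≤ δ / 2 := by
              rw [intervalIntegral.integral_of_le hT]
              exact hv1
        · have hd : ∀ s ∈ uIcc 0 t, HasDerivAt (fun s => Real.exp (-l * (t - s)) / l)
              (Real.exp (-l * (t - s))) s := by
            intro s _
            have h1 : HasDerivAt (fun s => -l * (t - s)) l s := by
              have := ((hasDerivAt_id s).const_sub t).const_mul (-l)
              simpa using this
            have := h1.exp.div_const l
            rwa [mul_div_cancel_right₀ _ hl0.ne'] at this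
          rw [intervalIntegral.integral_eq_sub_of_hasDerivAt hd (hce.intervalIntegrable _ _)]
          have h0 := (Real.exp_pos (-l * (t - 0))).le
          have h3 : Real.exp (-l * (t - t)) / l - Real.exp (-l * (t - 0)) / l ≤ 1 / l := by
            rw [sub_self, mul_zero, Real.exp_zero]
            have := div_nonneg h0 hl0.le
            linarith
          calc _ ≤ ‖v‖ * (1 / l) := by gcongr
            _ ≤ δ / 2 := by
              rw [hl]
              have : 0 ≤ ‖v‖ := norm_nonneg v
              rw [one_div_div, mul_div_assoc', div_le_div_iff₀ (by positivity) (by positivity)]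
              nlinarith
    _ = δ := by ring

/-- Gronwall's inequality with an integrable weight. -/
theorem exists_gronwall_const {w : ℝ → ℝ} {T : ℝ} (hT : 0 ≤ T)
    (hw : IntervalIntegrable w volume 0 T) :
    ∃ K : ℝ, 0 ≤ K ∧ ∀ (t₁ A : ℝ) (y : ℝ → ℝ), t₁ ∈ Icc 0 T → 0 ≤ A →
      ContinuousOn y (Icc 0 t₁) → (∀ t ∈ Icc 0 t₁, 0 ≤ y t) →
      (∀ t ∈ Icc 0 t₁, y t ≤ A + ∫ s in (0 : ℝ)..t, |w s| * y s) →
      ∀ t ∈ Icc 0 t₁, y t ≤ K * A := by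
  -- At the maximum `Y` of `exp(-lt) y(t)` the integral contributes at most `Y/2`, which is absorbed
  -- to give `Y ≤ 2A`. The constant depends only on `w` and `T`, not on `t₁` or `y`.
  obtain ⟨l, hl, H⟩ := exists_exp_weight_small hT hw (δ := 1 / 2) (by norm_num)
  refine ⟨2 * Real.exp (l * T), by positivity, fun t₁ A y ht₁ hA hy hy0 hyi => ?_⟩
  have hcz : ContinuousOn (fun t => Real.exp (-l * t) * y t) (Icc 0 t₁) :=
    (by fun_prop : Continuous fun t => Real.exp (-l * t)).continuousOn.mul hy
  obtain ⟨m, hm, hmax⟩ := isCompact_Icc.exists_isMaxOn ⟨0, ⟨le_rfl, ht₁.1⟩⟩ hcz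
  set Y := Real.exp (-l * m) * y m with hY
  have hY0 : 0 ≤ Y := mul_nonneg (Real.exp_pos _).le (hy0 m hm)
  have key : Y ≤ A + 1 / 2 * Y := by
    have hmT : m ∈ Icc 0 T := ⟨hm.1, hm.2.trans ht₁.2⟩
    have hsub : uIcc 0 m ⊆ uIcc 0 T := by
      rw [uIcc_of_le hm.1, uIcc_of_le hT]; exact Icc_subset_Icc_right hmT.2
    have hcE : Continuous fun s => Real.exp (-l * (m - s)) := by fun_prop
    have i1 : IntervalIntegrable (fun s => |w s| * y s) volume 0 m :=
      (hw.mono_set hsub).abs.mul_continuousOn (by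
        rw [uIcc_of_le hm.1]; exact hy.mono (Icc_subset_Icc_right hm.2))
    have i2 : IntervalIntegrable (fun s => |w s| * Real.exp (-l * (m - s))) volume 0 m :=
      (hw.mono_set hsub).abs.mul_continuousOn hcE.continuousOn
    have h1 : Real.exp (-l * m) * ∫ s in (0 : ℝ)..m, |w s| * y s ≤ 1 / 2 * Y := by
      rw [← intervalIntegral.integral_const_mul]
      calc _ ≤ ∫ s in (0 : ℝ)..m, (|w s| * Real.exp (-l * (m - s))) * Y := by
            refine intervalIntegral.integral_mono_on hm.1 (i1.const_mul _) (i2.mul_const _)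
              fun s hs => ?_
            have h2 : Real.exp (-l * s) * y s ≤ Y := hmax ⟨hs.1, hs.2.trans hm.2⟩
            have h3 : Real.exp (-l * m) = Real.exp (-l * (m - s)) * Real.exp (-l * s) := by
              rw [← Real.exp_add]; ring_nf
            rw [h3]
            calc _ = (|w s| * Real.exp (-l * (m - s))) * (Real.exp (-l * s) * y s) := by ring
              _ ≤ _ := by gcongr
        _ = (∫ s in (0 : ℝ)..m, |w s| * Real.exp (-l * (m - s))) * Y :=
            intervalIntegral.integral_mul_const _ _
        _ ≤ 1 / 2 * Y := by gcongr; exact H m hmT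
    have h2 := hyi m hm
    have h3 : Real.exp (-l * m) ≤ 1 := by
      rw [Real.exp_le_one_iff]; nlinarith [hm.1]
    calc Y ≤ Real.exp (-l * m) * (A + ∫ s in (0 : ℝ)..m, |w s| * y s) := by
          rw [hY]; gcongr
      _ = Real.exp (-l * m) * A + Real.exp (-l * m) * ∫ s in (0 : ℝ)..m, |w s| * y s := by ring
      _ ≤ 1 * A + 1 / 2 * Y := by gcongr
      _ = _ := by ring
  have hY2 : Y ≤ 2 * A := by linarith
  intro t ht
  have h1 : Real.exp (-l * t) * y t ≤ Y := hmax ht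
  have h2 : y t = Real.exp (l * t) * (Real.exp (-l * t) * y t) := by
    rw [← mul_assoc, ← Real.exp_add]; simp
  rw [h2]
  calc _ ≤ Real.exp (l * T) * (2 * A) := by
        have : t ≤ T := ht.2.trans ht₁.2
        have h3 := hy0 t ht
        exact mul_le_mul (Real.exp_le_exp.2 (by gcongr)) (h1.trans hY2)
          (mul_nonneg (Real.exp_pos _).le h3) (Real.exp_pos _).le
    _ = _ := by ring

/-- Solvability of Volterra equations with an integrable weight. -/
theorem exists_volterra_fixedPoint {X : Type*} [NormedAddCommGroup X] [NormedSpace ℝ X]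
    [CompleteSpace X] {w : ℝ → ℝ} {T : ℝ} (hT : 0 ≤ T) (hw : IntervalIntegrable w volume 0 T)
    (Φ : (ℝ → X) → ℝ → X) (hc : ∀ d, Continuous d → ContinuousOn (Φ d) (Icc 0 T))
    (hΦ : ∀ d d', Continuous d → Continuous d' → ∀ t ∈ Icc 0 T,
      ‖Φ d t - Φ d' t‖ ^ 2 ≤ ∫ s in (0 : ℝ)..t, |w s| * ‖d s - d' s‖ ^ 2) :
    ∃ d, Continuous d ∧ ∀ t ∈ Icc 0 T, Φ d t = d t := by
  -- The hypothesis compares squares, so `1/4` here means contraction factor `1/2`; the unknown is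
  -- rescaled by `exp(ls/2)`, whose square is the kernel weight.
  obtain ⟨l, hl, H⟩ := exists_exp_weight_small hT hw (δ := 1 / 4) (by norm_num)
  let ext : C(Icc (0 : ℝ) T, X) → ℝ → X := fun z s => Real.exp (l / 2 * s) • IccExtend hT z s
  have hext : ∀ z, Continuous (ext z) := fun z =>
    (by fun_prop : Continuous fun s : ℝ => Real.exp (l / 2 * s)).smul z.continuous.Icc_extend'
  let Ψ : C(Icc (0 : ℝ) T, X) → C(Icc (0 : ℝ) T, X) := fun z =>
    ⟨fun t => Real.exp (-(l / 2) * t) • Φ (ext z) t, by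
      have h1 := continuousOn_iff_continuous_domRestrict.1 (hc _ (hext z))
      exact (by fun_prop : Continuous fun s : Icc (0 : ℝ) T =>
        Real.exp (-(l / 2) * s)).smul h1⟩
  have hcon : ContractingWith (1 / 2) Ψ := by
    refine ⟨by rw [← NNReal.coe_lt_coe]; norm_num, LipschitzWith.of_dist_le_mul fun z z' => ?_⟩
    rw [ContinuousMap.dist_le (by positivity)]
    intro t
    have hsub : uIcc 0 (t : ℝ) ⊆ uIcc 0 T := by
      rw [uIcc_of_le t.2.1, uIcc_of_le hT]; exact Icc_subset_Icc_right t.2.2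
    have hcE : Continuous fun s => Real.exp (-l * (t - s)) := by fun_prop
    have i1 : IntervalIntegrable (fun s => |w s| * ‖ext z s - ext z' s‖ ^ 2) volume 0 t :=
      (hw.mono_set hsub).abs.mul_continuousOn
        (((hext z).sub (hext z')).norm.pow 2).continuousOn
    have i2 : IntervalIntegrable (fun s => |w s| * Real.exp (-l * (t - s))) volume 0 t :=
      (hw.mono_set hsub).abs.mul_continuousOn hcE.continuousOn
    have h1 := hΦ _ _ (hext z) (hext z') t t.2
    have h2 : dist (Ψ z t) (Ψ z' t) ^ 2 ≤ (1 / 2 * dist z z') ^ 2 := by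
      have e1 : Ψ z t - Ψ z' t = Real.exp (-(l / 2) * t) • (Φ (ext z) t - Φ (ext z') t) := by
        rw [smul_sub]; rfl
      rw [dist_eq_norm, e1, norm_smul, mul_pow, Real.norm_of_nonneg (Real.exp_pos _).le,
        ← Real.exp_nat_mul]
      calc _ ≤ Real.exp (((2 : ℕ) : ℝ) * (-(l / 2) * t)) *
            ∫ s in (0 : ℝ)..t, |w s| * ‖ext z s - ext z' s‖ ^ 2 := by gcongr
        _ ≤ ∫ s in (0 : ℝ)..t, (|w s| * Real.exp (-l * (t - s))) * dist z z' ^ 2 := by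
            rw [← intervalIntegral.integral_const_mul]
            refine intervalIntegral.integral_mono_on t.2.1 (i1.const_mul _) (i2.mul_const _)
              fun s hs => ?_
            have hs' : s ∈ Icc 0 T := ⟨hs.1, hs.2.trans t.2.2⟩
            have e2 : ext z s - ext z' s = Real.exp (l / 2 * s) • (z ⟨s, hs'⟩ - z' ⟨s, hs'⟩) := by
              simp only [ext, IccExtend_of_mem _ _ hs', smul_sub]
            have e3 : ‖z ⟨s, hs'⟩ - z' ⟨s, hs'⟩‖ ≤ dist z z' := by
              rw [← dist_eq_norm]; exact ContinuousMap.dist_apply_le_dist _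
            have e4 : Real.exp (-l * (t - s)) =
                Real.exp (((2 : ℕ) : ℝ) * (-(l / 2) * t)) * Real.exp (l / 2 * s) ^ 2 := by
              rw [← Real.exp_nat_mul, ← Real.exp_add]; push_cast; ring_nf
            rw [e2, norm_smul, Real.norm_of_nonneg (Real.exp_pos _).le, e4, mul_pow]
            calc _ = (|w s| * (Real.exp (((2 : ℕ) : ℝ) * (-(l / 2) * t)) *
                Real.exp (l / 2 * s) ^ 2)) * ‖z ⟨s, hs'⟩ - z' ⟨s, hs'⟩‖ ^ 2 := by ring
              _ ≤ _ := by gcongr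
        _ = (∫ s in (0 : ℝ)..t, |w s| * Real.exp (-l * (t - s))) * dist z z' ^ 2 :=
            intervalIntegral.integral_mul_const _ _
        _ ≤ 1 / 4 * dist z z' ^ 2 := by gcongr; exact H t t.2
        _ = _ := by ring
    have h3 := (sq_le_sq₀ dist_nonneg (by positivity)).1 h2
    simpa using h3
  have hfix := hcon.fixedPoint_isFixedPt
  set z := hcon.fixedPoint Ψ
  refine ⟨ext z, hext z, fun t ht => ?_⟩
  have h1 : Ψ z ⟨t, ht⟩ = z ⟨t, ht⟩ := by rw [hfix.eq]
  have h2 : Real.exp (-(l / 2) * t) • Φ (ext z) t = z ⟨t, ht⟩ := h1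
  have h4 : ext z t = Real.exp (l / 2 * t) • z ⟨t, ht⟩ := by
    simp only [ext, IccExtend_of_mem _ _ ht]
  rw [h4, ← h2, smul_smul, ← Real.exp_add]
  simp

end Volterra

/-! ### The sequence space, diagonal operators and the Schrödinger group -/

/-- Square summable sequences, the coefficients of sine series. -/
abbrev Coeff : Type := lp (fun _ : ℕ => ℂ) 2

namespace Coeff

theorem memℓp_iff {f : ℕ → ℂ} : Memℓp f 2 ↔ Summable fun n => ‖f n‖ ^ 2 := by
  rw [memℓp_gen_iff (by norm_num)]
  simp

theorem hasSum_norm_sq (a : Coeff) : HasSum (fun n => ‖a n‖ ^ 2) (‖a‖ ^ 2) := by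
  have := lp.hasSum_norm (p := 2) (by norm_num) a
  simpa using this

theorem summable_norm_sq (a : Coeff) : Summable fun n => ‖a n‖ ^ 2 := (hasSum_norm_sq a).summable

theorem norm_apply_le (a : Coeff) (n : ℕ) : ‖a n‖ ≤ ‖a‖ := lp.norm_apply_le_norm (by norm_num) a n

theorem mul_summable (a b : Coeff) :
    (Summable fun n => ‖a n‖ * ‖b n‖) ∧ ∑' n, ‖a n‖ * ‖b n‖ ≤ ‖a‖ * ‖b‖ :=
  lp.tsum_mul_le_mul_norm (by simpa using Real.HolderConjugate.two_two) a b

/-- The basis vectors. -/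
def e (n : ℕ) : Coeff := lp.single 2 n 1

theorem hasSum_e (a : Coeff) : HasSum (fun n => a n • e n) a := by
  have := lp.hasSum_single (p := 2) (by norm_num) a
  refine this.congr_fun fun n => ?_
  rw [e, ← lp.single_smul, smul_eq_mul, mul_one]

/-- Identities between bounded operators need to be checked only for a single mode, where they are
explicit trigonometric computations. -/
theorem ext_clm {F : Type*} [NormedAddCommGroup F] [NormedSpace ℂ F] {f g : Coeff →L[ℂ] F}
    (h : ∀ n, f (e n) = g (e n)) : f = g := by
  ext a
  have h1 := (hasSum_e a).mapL f
  have h2 := (hasSum_e a).mapL g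
  simp only [map_smul, h] at h1 h2
  exact h1.unique h2

/-- The element of `ℓ²` with the given square summable coefficients. -/
def ofSq (f : ℕ → ℂ) (h : Summable fun n => ‖f n‖ ^ 2) : Coeff := ⟨f, memℓp_iff.2 h⟩

@[simp] theorem ofSq_apply (f : ℕ → ℂ) (h : Summable fun n => ‖f n‖ ^ 2) (n : ℕ) :
    ofSq f h n = f n := rfl

theorem add_apply (a b : Coeff) (n : ℕ) : (a + b) n = a n + b n := rfl

theorem smul_apply (c : ℂ) (a : Coeff) (n : ℕ) : (c • a) n = c * a n := rfl

theorem norm_mul_sq_le {m : ℕ → ℂ} {C : ℝ} (h : ∀ n, ‖m n‖ ≤ C) (a : Coeff) (n : ℕ) :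
    ‖m n * a n‖ ^ 2 ≤ C ^ 2 * ‖a n‖ ^ 2 := by
  rw [norm_mul, mul_pow]; gcongr; exact h n

theorem norm_le_of_apply_le {C : ℝ} (hC : 0 ≤ C) (b a : Coeff)
    (h : ∀ n, ‖b n‖ ^ 2 ≤ C ^ 2 * ‖a n‖ ^ 2) : ‖b‖ ≤ C * ‖a‖ := by
  have h1 : ‖b‖ ^ 2 ≤ (C * ‖a‖) ^ 2 := by
    rw [mul_pow]
    exact hasSum_le h (hasSum_norm_sq b) ((hasSum_norm_sq a).mul_left _)
  exact (sq_le_sq₀ (norm_nonneg _) (mul_nonneg hC (norm_nonneg _))).1 h1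

/-- The diagonal operator with bounded coefficients `m`. -/
def diag (m : ℕ → ℂ) (C : ℝ) (h : ∀ n, ‖m n‖ ≤ C) : Coeff →L[ℂ] Coeff :=
  LinearMap.mkContinuous
    { toFun := fun a => ofSq (fun n => m n * a n)
        (Summable.of_nonneg_of_le (fun _ => by positivity) (norm_mul_sq_le h a)
          ((summable_norm_sq a).mul_left (C ^ 2)))
      map_add' := fun a b => lp.ext <| funext fun n => by
        rw [ofSq_apply, add_apply, add_apply, ofSq_apply, ofSq_apply, mul_add]
      map_smul' := fun c a => lp.ext <| funext fun n => by
        rw [RingHom.id_apply, ofSq_apply, smul_apply, smul_apply, ofSq_apply, mul_left_comm] } C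
    (fun a => norm_le_of_apply_le ((norm_nonneg _).trans (h 0)) _ a (norm_mul_sq_le h a))

@[simp] theorem diag_apply {m : ℕ → ℂ} {C : ℝ} (h : ∀ n, ‖m n‖ ≤ C) (a : Coeff) (n : ℕ) :
    diag m C h a n = m n * a n := rfl

theorem norm_diag_le {m : ℕ → ℂ} {C : ℝ} (h : ∀ n, ‖m n‖ ≤ C) (a : Coeff) :
    ‖diag m C h a‖ ≤ C * ‖a‖ :=
  ((diag m C h).le_of_opNorm_le (LinearMap.mkContinuous_norm_le _
    ((norm_nonneg _).trans (h 0)) _) a)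

theorem norm_series_term_le {F : Type*} [NormedAddCommGroup F] [NormedSpace ℂ F] (c : Coeff)
    (f : ℕ → F) (h : ∀ n, ‖f n‖ ≤ 1) (a : Coeff) (n : ℕ) :
    ‖(c n * a n) • f n‖ ≤ ‖c n‖ * ‖a n‖ := by
  rw [norm_smul, norm_mul]
  exact mul_le_of_le_one_right (by positivity) (h n)

theorem summable_series {F : Type*} [NormedAddCommGroup F] [NormedSpace ℂ F] [CompleteSpace F]
    (c : Coeff) (f : ℕ → F) (h : ∀ n, ‖f n‖ ≤ 1) (a : Coeff) :
    Summable fun n => (c n * a n) • f n :=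
  Summable.of_norm_bounded (mul_summable c a).1 (norm_series_term_le c f h a)

/-- The operator `a ↦ ∑ cₙ aₙ fₙ` for a square summable `c` and bounded vectors `fₙ`. -/
def series {F : Type*} [NormedAddCommGroup F] [NormedSpace ℂ F] [CompleteSpace F]
    (c : Coeff) (f : ℕ → F) (h : ∀ n, ‖f n‖ ≤ 1) : Coeff →L[ℂ] F :=
  LinearMap.mkContinuous
    { toFun := fun a => ∑' n, (c n * a n) • f n
      map_add' := fun a b => by
        rw [← (summable_series c f h a).tsum_add (summable_series c f h b)]
        exact tsum_congr fun n => by rw [add_apply, mul_add, add_smul]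
      map_smul' := fun z a => by
        rw [RingHom.id_apply, ← (summable_series c f h a).tsum_const_smul]
        exact tsum_congr fun n => by rw [smul_apply, smul_smul, mul_left_comm] } ‖c‖
    (fun a => (tsum_of_norm_bounded (mul_summable c a).1.hasSum
      (norm_series_term_le c f h a)).trans
      (mul_summable c a).2)

theorem hasSum_series {F : Type*} [NormedAddCommGroup F] [NormedSpace ℂ F] [CompleteSpace F]
    (c : Coeff) (f : ℕ → F) (h : ∀ n, ‖f n‖ ≤ 1) (a : Coeff) :
    HasSum (fun n => (c n * a n) • f n) (series c f h a) :=
  (summable_series c f h a).hasSum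

theorem norm_series_le {F : Type*} [NormedAddCommGroup F] [NormedSpace ℂ F] [CompleteSpace F]
    (c : Coeff) (f : ℕ → F) (h : ∀ n, ‖f n‖ ≤ 1) (a : Coeff) :
    ‖series c f h a‖ ≤ ‖c‖ * ‖a‖ :=
  (series c f h).le_of_opNorm_le (LinearMap.mkContinuous_norm_le _ (norm_nonneg _) _) a

@[simp] theorem series_e {F : Type*} [NormedAddCommGroup F] [NormedSpace ℂ F] [CompleteSpace F]
    (c : Coeff) (f : ℕ → F) (h : ∀ n, ‖f n‖ ≤ 1) (n : ℕ) : series c f h (e n) = c n • f n := by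
  refine (hasSum_series c f h (e n)).unique ?_
  have h1 := hasSum_single (f := fun m => (c m * (e n) m) • f m) n fun m hm => by
    simp [e, hm]
  simpa [e] using h1

/-- The complex conjugate sequence. -/
def conj (a : Coeff) : Coeff := ofSq (fun n => starRingEnd ℂ (a n)) <| by
  simpa using summable_norm_sq a

@[simp] theorem conj_apply (a : Coeff) (n : ℕ) : conj a n = starRingEnd ℂ (a n) := rfl

@[simp] theorem norm_conj (a : Coeff) : ‖conj a‖ = ‖a‖ := by
  rw [← sq_eq_sq₀ (norm_nonneg _) (norm_nonneg _)]
  refine (hasSum_norm_sq _).unique ?_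
  simpa using hasSum_norm_sq a

theorem conj_sub (a b : Coeff) : conj (a - b) = conj a - conj b := by
  ext n; simp

theorem continuous_conj : Continuous conj :=
  (LipschitzWith.of_dist_le_mul (K := 1) fun a b => by
    rw [dist_eq_norm, dist_eq_norm, ← conj_sub, norm_conj]; simp).continuous

/-- The `n`-th frequency. -/
def freq (n : ℕ) : ℝ := n + 1

theorem freq_pos (n : ℕ) : 0 < freq n := by unfold freq; positivity

theorem one_le_freq (n : ℕ) : 1 ≤ freq n := by unfold freq; simp

theorem freq_ne (n : ℕ) : (freq n : ℂ) ≠ 0 := by exact_mod_cast (freq_pos n).ne'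

/-- The sequence `1 / k`. -/
def invFreq : Coeff := ofSq (fun n => ((freq n)⁻¹ : ℝ)) <| by
  have := (Real.summable_one_div_nat_pow (p := 2)).2 (by norm_num)
  have := (summable_nat_add_iff 1).2 this
  refine this.congr fun n => ?_
  rw [Complex.norm_real, Real.norm_eq_abs, sq_abs, freq]
  push_cast
  rw [inv_pow, one_div]

@[simp] theorem invFreq_apply (n : ℕ) : invFreq n = ((freq n)⁻¹ : ℝ) := rfl

theorem norm_inv_freq_le (n : ℕ) : ‖(((freq n)⁻¹ : ℝ) : ℂ)‖ ≤ 1 := by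
  rw [Complex.norm_real, Real.norm_of_nonneg (inv_nonneg.2 (freq_pos n).le)]
  exact inv_le_one_of_one_le₀ (one_le_freq n)

/-- Division by the frequency. -/
def invD : Coeff →L[ℂ] Coeff := diag (fun n => ((freq n)⁻¹ : ℝ)) 1 norm_inv_freq_le

@[simp] theorem invD_apply (a : Coeff) (n : ℕ) : invD a n = ((freq n)⁻¹ : ℝ) * a n := rfl

theorem norm_invD_le (a : Coeff) : ‖invD a‖ ≤ ‖a‖ := by
  have h : ‖invD a‖ ≤ 1 * ‖a‖ := norm_diag_le norm_inv_freq_le a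
  rwa [one_mul] at h

@[simp] theorem invD_conj (a : Coeff) : invD (conj a) = conj (invD a) := by
  ext n; simp

/-- Interpolation of `H²` between `H¹` and `H³`, by Cauchy–Schwarz. It makes the estimate of the
cubic term linear in the highest norm. -/
theorem norm_invD_sq_le (a : Coeff) : ‖invD a‖ ^ 2 ≤ ‖a‖ * ‖invD (invD a)‖ := by
  have e : ∀ n, ‖invD a n‖ ^ 2 = ‖a n‖ * ‖invD (invD a) n‖ := fun n => by
    rw [invD_apply, invD_apply, invD_apply, norm_mul, norm_mul, norm_mul]
    ring
  calc ‖invD a‖ ^ 2 = ∑' n, ‖invD a n‖ ^ 2 := (hasSum_norm_sq (invD a)).tsum_eq.symm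
    _ = ∑' n, ‖a n‖ * ‖invD (invD a) n‖ := tsum_congr e
    _ ≤ _ := (mul_summable a (invD (invD a))).2

theorem invD_e (n : ℕ) : invD (e n) = (((freq n)⁻¹ : ℝ) : ℂ) • e n := by
  ext m
  by_cases h : m = n
  · subst h; simp [e]
  · simp [e, lp.single_apply, h]

/-- The Schrödinger group. -/
def omega (n : ℕ) : ℝ := (Real.pi * freq n) ^ 2

def group (t : ℝ) : Coeff →L[ℂ] Coeff :=
  diag (fun n => Complex.exp (Complex.I * (omega n * t : ℝ))) 1 fun n => by
    rw [mul_comm, Complex.norm_exp_ofReal_mul_I]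

@[simp] theorem group_apply (t : ℝ) (a : Coeff) (n : ℕ) :
    group t a n = Complex.exp (Complex.I * (omega n * t : ℝ)) * a n := rfl

@[simp] theorem norm_group (t : ℝ) (a : Coeff) : ‖group t a‖ = ‖a‖ := by
  rw [← sq_eq_sq₀ (norm_nonneg _) (norm_nonneg _)]
  refine (hasSum_norm_sq _).unique ?_
  refine (hasSum_norm_sq a).congr_fun fun n => ?_
  rw [group_apply, norm_mul, mul_comm Complex.I, Complex.norm_exp_ofReal_mul_I, one_mul]

theorem group_group_neg (t : ℝ) (a : Coeff) : group t (group (-t) a) = a := by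
  ext n
  rw [group_apply, group_apply, ← mul_assoc, ← Complex.exp_add]
  simp

/-- Strong continuity, by dominated convergence in the sum of squares: each mode is continuous in
time and the differences are dominated by `2‖aₙ‖`. Since the frequencies are unbounded, this is not
continuity in operator norm. -/
theorem continuous_group_apply (a : Coeff) : Continuous fun t => group t a := by
  rw [continuous_iff_continuousAt]
  intro t₀
  rw [ContinuousAt, tendsto_iff_norm_sub_tendsto_zero]
  have h1 : Tendsto (fun t => ∑' n, ‖(group t a - group t₀ a) n‖ ^ 2) (𝓝 t₀) (𝓝 (∑' _ : ℕ, 0)) := by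
    refine tendsto_tsum_of_dominated_convergence (bound := fun n => (2 * ‖a n‖) ^ 2) ?_ ?_ ?_
    · simpa [mul_pow] using (summable_norm_sq a).mul_left (2 ^ 2)
    · intro n
      have : Continuous fun t => ‖(group t a - group t₀ a) n‖ ^ 2 := by
        simp only [lp.coeFn_sub, Pi.sub_apply, group_apply]
        fun_prop
      simpa using this.tendsto t₀
    · refine Eventually.of_forall fun t n => ?_
      rw [Real.norm_of_nonneg (by positivity)]
      gcongr
      simp only [lp.coeFn_sub, Pi.sub_apply, group_apply]
      refine (norm_sub_le _ _).trans (le_of_eq ?_)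
      rw [norm_mul, norm_mul, mul_comm Complex.I, mul_comm Complex.I,
        Complex.norm_exp_ofReal_mul_I, Complex.norm_exp_ofReal_mul_I]
      ring
  simp only [tsum_zero] at h1
  have h2 : (fun t => ‖group t a - group t₀ a‖) =
      fun t => √(∑' n, ‖(group t a - group t₀ a) n‖ ^ 2) := by
    funext t
    rw [(hasSum_norm_sq _).tsum_eq, Real.sqrt_sq (norm_nonneg _)]
  rw [h2]
  simpa using h1.sqrt

theorem continuous_group : Continuous fun p : ℝ × Coeff => group p.1 p.2 := by
  rw [continuous_iff_continuousAt]
  rintro ⟨t₀, a₀⟩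
  rw [ContinuousAt, tendsto_iff_norm_sub_tendsto_zero]
  have h1 : Tendsto (fun p : ℝ × Coeff => ‖p.2 - a₀‖ + ‖group p.1 a₀ - group t₀ a₀‖)
      (𝓝 (t₀, a₀)) (𝓝 0) := by
    have hc : Continuous fun p : ℝ × Coeff => ‖p.2 - a₀‖ + ‖group p.1 a₀ - group t₀ a₀‖ :=
      (continuous_snd.sub continuous_const).norm.add
        (((continuous_group_apply a₀).comp continuous_fst).sub continuous_const).norm
    simpa using hc.tendsto (t₀, a₀)
  refine squeeze_zero (fun _ => norm_nonneg _) (fun p => ?_) h1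
  calc ‖group p.1 p.2 - group t₀ a₀‖
      = ‖group p.1 (p.2 - a₀) + (group p.1 a₀ - group t₀ a₀)‖ := by rw [map_sub]; congr 1; abel
    _ ≤ _ := (norm_add_le _ _).trans (by rw [norm_group])

end Coeff

/-! ### Functionals and multiplication on `L²(a,b)` -/

section L2

variable {𝕜 : Type} [RCLike 𝕜] {a b : ℝ}

theorem L2.integrable (f : L2 𝕜 a b) : Integrable f (volume.restrict (Ioo a b)) :=
  (Lp.memLp f).integrable (by norm_num)

theorem L2.intervalIntegrable (hab : a ≤ b) (f : L2 𝕜 a b) : IntervalIntegrable f volume a b := by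
  rw [intervalIntegrable_iff_integrableOn_Ioo_of_le hab]
  exact L2.integrable f

theorem integral_Ioo_eq (hab : a ≤ b) {F : Type*} [NormedAddCommGroup F] [NormedSpace ℝ F]
    (f : ℝ → F) : ∫ x in Ioo a b, f x = ∫ x in a..b, f x := by
  rw [intervalIntegral.integral_of_le hab, integral_Ioc_eq_integral_Ioo]

theorem intervalIntegral_congr_ae_Ioo (hab : a ≤ b) {F : Type*} [NormedAddCommGroup F]
    [NormedSpace ℝ F] {f g : ℝ → F} (h : ∀ᵐ x ∂(volume : Measure ℝ).restrict (Ioo a b), f x = g x) :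
    ∫ x in a..b, f x = ∫ x in a..b, g x := by
  rw [← integral_Ioo_eq hab, ← integral_Ioo_eq hab]
  exact integral_congr_ae h

/-- The primitive of an `L²` function as a linear functional. -/
def L2.integralTo (x : ℝ) : L2 𝕜 a b →L[𝕜] 𝕜 :=
  innerSL 𝕜 (indicatorConstLp 2 (measurableSet_Ioo (a := a) (b := x))
    (measure_ne_top _ _) (1 : 𝕜))

theorem L2.integralTo_apply {x : ℝ} (hx : x ∈ Icc a b) (f : L2 𝕜 a b) :
    L2.integralTo x f = ∫ t in a..x, f t := by
  rw [L2.integralTo, innerSL_apply_apply, L2.inner_indicatorConstLp_one,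
    Measure.restrict_restrict measurableSet_Ioo, ← integral_Ioo_eq hx.1,
    inter_eq_left.2 (Ioo_subset_Ioo_right hx.2)]

theorem L2.norm_sq_eq (f : L2 𝕜 a b) : ‖f‖ ^ 2 = ∫ x in Ioo a b, ‖f x‖ ^ 2 := by
  have h := L2.inner_def (𝕜 := 𝕜) f f
  have h2 : inner 𝕜 f f = ((∫ x in Ioo a b, ‖f x‖ ^ 2 : ℝ) : 𝕜) := by
    rw [h, ← integral_ofReal]
    refine integral_congr_ae (Eventually.of_forall fun x => ?_)
    simp only [inner_self_eq_norm_sq_to_K]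
    push_cast; rfl
  rw [inner_self_eq_norm_sq_to_K] at h2
  exact_mod_cast h2

theorem L2.memLp_mul (g : ℝ →ᵇ ℂ) (f : L2 ℂ a b) :
    MemLp (fun x => g x * f x) 2 (volume.restrict (Ioo a b)) := by
  refine (Lp.memLp f).of_le_mul (c := ‖g‖)
    (g.continuous.aestronglyMeasurable.mul (Lp.aestronglyMeasurable f))
    (Eventually.of_forall fun x => ?_)
  rw [norm_mul]
  gcongr
  exact g.norm_coe_le_norm x

/-- Multiplication of `L²` functions by bounded continuous functions. -/
def L2.mul : (ℝ →ᵇ ℂ) →L[ℂ] L2 ℂ a b →L[ℂ] L2 ℂ a b :=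
  LinearMap.mkContinuous₂
    (LinearMap.mk₂ ℂ (fun g f => (L2.memLp_mul g f).toLp _)
      (fun g g' f => by
        rw [← MemLp.toLp_add]
        exact MemLp.toLp_congr _ _ (Eventually.of_forall fun x => by simp [add_mul]))
      (fun c g f => by
        rw [← MemLp.toLp_const_smul]
        exact MemLp.toLp_congr _ _ (Eventually.of_forall fun x => by simp [mul_assoc]))
      (fun g f f' => by
        rw [← MemLp.toLp_add]
        refine MemLp.toLp_congr _ _ ?_
        filter_upwards [Lp.coeFn_add f f'] with x hx
        rw [hx, Pi.add_apply, Pi.add_apply, mul_add])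
      (fun c g f => by
        rw [← MemLp.toLp_const_smul]
        refine MemLp.toLp_congr _ _ ?_
        filter_upwards [Lp.coeFn_smul c f] with x hx
        rw [hx, Pi.smul_apply, Pi.smul_apply, smul_eq_mul, smul_eq_mul, mul_left_comm])) 1
    (fun g f => by
      rw [one_mul]
      refine Lp.norm_le_mul_norm_of_ae_le_mul ?_
      filter_upwards [(L2.memLp_mul g f).coeFn_toLp] with x hx
      rw [LinearMap.mk₂_apply, hx, norm_mul]
      gcongr
      exact g.norm_coe_le_norm x)

theorem L2.coeFn_mul (g : ℝ →ᵇ ℂ) (f : L2 ℂ a b) :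
    ∀ᵐ x ∂(volume : Measure ℝ).restrict (Ioo a b), L2.mul g f x = g x * f x :=
  (L2.memLp_mul g f).coeFn_toLp

theorem L2.norm_mul_le (g : ℝ →ᵇ ℂ) (f : L2 ℂ a b) : ‖L2.mul g f‖ ≤ ‖g‖ * ‖f‖ := by
  refine Lp.norm_le_mul_norm_of_ae_le_mul ?_
  filter_upwards [L2.coeFn_mul g f] with x hx
  rw [hx, norm_mul]
  gcongr
  exact g.norm_coe_le_norm x

/-- Bounded continuous functions as elements of `L²`. -/
def L2.ofBCF : (ℝ →ᵇ ℂ) →L[ℂ] L2 ℂ a b :=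
  BoundedContinuousFunction.toLp 2 (volume.restrict (Ioo a b)) ℂ

theorem L2.coeFn_ofBCF (g : ℝ →ᵇ ℂ) :
    ∀ᵐ x ∂(volume : Measure ℝ).restrict (Ioo a b), (L2.ofBCF g : L2 ℂ a b) x = g x :=
  BoundedContinuousFunction.coeFn_toLp (p := 2) (𝕜 := ℂ) _ g

end L2

/-! ### Sine and cosine series, and the derivatives of a function given by its coefficients -/

namespace Coeff

theorem norm_cos_le (r : ℝ) : ‖((Real.cos r : ℝ) : ℂ)‖ ≤ 1 := by
  rw [Complex.norm_real]; exact Real.abs_cos_le_one _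

theorem norm_sin_le (r : ℝ) : ‖((Real.sin r : ℝ) : ℂ)‖ ≤ 1 := by
  rw [Complex.norm_real]; exact Real.abs_sin_le_one _

def sinB (n : ℕ) : ℝ →ᵇ ℂ := BoundedContinuousFunction.ofNormedAddCommGroup
  (fun x => ((Real.sin (Real.pi * freq n * x) : ℝ) : ℂ)) (by fun_prop) 1 fun _ => norm_sin_le _

def cosB (n : ℕ) : ℝ →ᵇ ℂ := BoundedContinuousFunction.ofNormedAddCommGroup
  (fun x => ((Real.cos (Real.pi * freq n * x) : ℝ) : ℂ)) (by fun_prop) 1 fun _ => norm_cos_le _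

theorem sinB_apply (n : ℕ) (x : ℝ) : sinB n x = ((Real.sin (Real.pi * freq n * x) : ℝ) : ℂ) := rfl

theorem cosB_apply (n : ℕ) (x : ℝ) : cosB n x = ((Real.cos (Real.pi * freq n * x) : ℝ) : ℂ) := rfl

theorem norm_sinB_le (n : ℕ) : ‖sinB n‖ ≤ 1 :=
  (BoundedContinuousFunction.norm_le zero_le_one).2 fun _ => norm_sin_le _

theorem norm_cosB_le (n : ℕ) : ‖cosB n‖ ≤ 1 :=
  (BoundedContinuousFunction.norm_le zero_le_one).2 fun _ => norm_cos_le _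

/-- `∑ (aₙ / k) sin (kπx)`. -/
def sinSeries : Coeff →L[ℂ] ℝ →ᵇ ℂ := series invFreq sinB norm_sinB_le

/-- `∑ (aₙ / k) cos (kπx)`. -/
def cosSeries : Coeff →L[ℂ] ℝ →ᵇ ℂ := series invFreq cosB norm_cosB_le

theorem hasSum_sinSeries (a : Coeff) (x : ℝ) :
    HasSum (fun n => invD a n * sinB n x) (sinSeries a x) :=
  (hasSum_series invFreq sinB norm_sinB_le a).mapL (BoundedContinuousFunction.evalCLM ℂ x)

theorem hasSum_cosSeries (a : Coeff) (x : ℝ) :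
    HasSum (fun n => invD a n * cosB n x) (cosSeries a x) :=
  (hasSum_series invFreq cosB norm_cosB_le a).mapL (BoundedContinuousFunction.evalCLM ℂ x)

theorem hasDerivAt_sinB (n : ℕ) (x : ℝ) :
    HasDerivAt (sinB n) (((Real.pi * freq n : ℝ) : ℂ) * cosB n x) x := by
  have h : HasDerivAt (fun y : ℝ => Real.pi * freq n * y) (Real.pi * freq n) x := by
    simpa using (hasDerivAt_id x).const_mul (Real.pi * freq n)
  have := h.sin.ofReal_comp
  rw [mul_comm (Real.cos _)] at this
  rw [cosB_apply, ← Complex.ofReal_mul]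
  exact this

theorem hasDerivAt_cosB (n : ℕ) (x : ℝ) :
    HasDerivAt (cosB n) (-((Real.pi * freq n : ℝ) : ℂ) * sinB n x) x := by
  have h : HasDerivAt (fun y : ℝ => Real.pi * freq n * y) (Real.pi * freq n) x := by
    simpa using (hasDerivAt_id x).const_mul (Real.pi * freq n)
  have := h.cos.ofReal_comp
  rw [mul_comm (-Real.sin _), mul_neg, ← neg_mul] at this
  rw [sinB_apply, ← Complex.ofReal_neg, ← Complex.ofReal_mul]
  exact this

theorem invFreq_mul_freq (n : ℕ) : (((freq n)⁻¹ : ℝ) : ℂ) * (freq n : ℂ) = 1 := by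
  rw [Complex.ofReal_inv, inv_mul_cancel₀ (freq_ne n)]

theorem summable_invD (a : Coeff) : Summable fun n => ‖invD a n‖ := by
  refine (mul_summable invFreq a).1.congr fun n => ?_
  rw [invD_apply, norm_mul, invFreq_apply]

/-- Termwise differentiation. The derivative costs one power of the frequency, and what remains, `aₙ
/ k`, is summable as a product of two square summable sequences. Both trigonometric cases are
instances, with `σ = π` and `σ = -π`. -/
theorem hasDerivAt_series {s c : ℕ → ℝ →ᵇ ℂ} {σ : ℂ} (hσ : ‖σ‖ = Real.pi)
    (hsc : ∀ n x, HasDerivAt (s n) (σ * freq n * c n x) x)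
    (hs1 : ∀ n, ‖s n‖ ≤ 1) (hc1 : ∀ n, ‖c n‖ ≤ 1) (a : Coeff) (x : ℝ) :
    HasDerivAt (fun x => ∑' n, invD (invD a) n * s n x) (σ * ∑' n, invD a n * c n x) x := by
  rw [← tsum_mul_left]
  have key : ∀ n, invD (invD a) n * (σ * freq n) = σ * invD a n := fun n => by
    rw [invD_apply (invD a)]
    linear_combination σ * invD a n * invFreq_mul_freq n
  refine hasDerivAt_tsum (g := fun n y => invD (invD a) n * s n y)
    (g' := fun n y => σ * (invD a n * c n y)) (u := fun n => Real.pi * ‖invD a n‖) (y₀ := x)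
    ((summable_invD a).mul_left _) (fun n y => ?_) (fun n y => ?_) ?_ x
  · have h := (hsc n y).const_mul (invD (invD a) n)
    have e : invD (invD a) n * (σ * freq n * c n y) = σ * (invD a n * c n y) := by
      linear_combination c n y * key n
    rwa [e] at h
  · rw [norm_mul, norm_mul, hσ, ← mul_assoc]
    refine mul_le_of_le_one_right (by positivity) ?_
    exact ((c n).norm_coe_le_norm y).trans (hc1 n)
  · refine Summable.of_norm_bounded (summable_invD (invD a)) fun n => ?_
    rw [norm_mul]
    exact mul_le_of_le_one_right (norm_nonneg _) (((s n).norm_coe_le_norm x).trans (hs1 n))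

theorem hasDerivAt_sinSeries (a : Coeff) (x : ℝ) :
    HasDerivAt (sinSeries (invD a)) ((Real.pi : ℂ) * cosSeries a x) x := by
  have h := hasDerivAt_series (s := sinB) (c := cosB) (σ := (Real.pi : ℂ))
    (by rw [Complex.norm_real, Real.norm_of_nonneg Real.pi_pos.le])
    (fun n y => by simpa using hasDerivAt_sinB n y) norm_sinB_le norm_cosB_le a x
  rw [(hasSum_cosSeries a x).tsum_eq] at h
  exact h.congr_of_eventuallyEq
    (Eventually.of_forall fun y => (hasSum_sinSeries (invD a) y).tsum_eq.symm)

theorem hasDerivAt_cosSeries (a : Coeff) (x : ℝ) :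
    HasDerivAt (cosSeries (invD a)) (-(Real.pi : ℂ) * sinSeries a x) x := by
  have h := hasDerivAt_series (s := cosB) (c := sinB) (σ := -(Real.pi : ℂ))
    (by rw [norm_neg, Complex.norm_real, Real.norm_of_nonneg Real.pi_pos.le])
    (fun n y => by simpa using hasDerivAt_cosB n y) norm_cosB_le norm_sinB_le a x
  rw [(hasSum_sinSeries a x).tsum_eq] at h
  exact h.congr_of_eventuallyEq
    (Eventually.of_forall fun y => (hasSum_cosSeries (invD a) y).tsum_eq.symm)

/-- The function `∑ (aₙ / k³) sin (kπx)`. -/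
def J0 : Coeff →L[ℂ] ℝ →ᵇ ℂ := sinSeries ∘L invD ∘L invD

/-- The derivative of `J0`. -/
def J1 : Coeff →L[ℂ] ℝ →ᵇ ℂ := (Real.pi : ℂ) • cosSeries ∘L invD

/-- The second derivative of `J0`. -/
def J2 : Coeff →L[ℂ] ℝ →ᵇ ℂ := (-(Real.pi : ℂ) ^ 2) • sinSeries

theorem J0_apply (a : Coeff) : J0 a = sinSeries (invD (invD a)) := rfl

theorem J1_apply (a : Coeff) : J1 a = (Real.pi : ℂ) • cosSeries (invD a) := rfl

theorem J2_apply (a : Coeff) : J2 a = (-(Real.pi : ℂ) ^ 2) • sinSeries a := rfl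

theorem J2_eval (a : Coeff) (x : ℝ) : J2 a x = -(Real.pi : ℂ) ^ 2 * sinSeries a x := rfl

theorem hasDerivAt_J0 (a : Coeff) (x : ℝ) : HasDerivAt (J0 a) (J1 a x) x :=
  hasDerivAt_sinSeries (invD a) x

theorem hasDerivAt_J1 (a : Coeff) (x : ℝ) : HasDerivAt (J1 a) (J2 a x) x := by
  have := (hasDerivAt_cosSeries a x).const_mul (Real.pi : ℂ)
  have e : J2 a x = (Real.pi : ℂ) * (-(Real.pi : ℂ) * sinSeries a x) := by
    rw [J2_eval]; ring
  rw [e]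
  exact this

theorem sin_freq_mul_pi (n : ℕ) : Real.sin (Real.pi * freq n) = 0 := by
  rw [mul_comm]
  have := Real.sin_nat_mul_pi (n + 1)
  push_cast at this
  exact this

theorem cos_freq_mul_pi (n : ℕ) : Real.cos (Real.pi * freq n) = -(-1) ^ n := by
  rw [mul_comm]
  have := Real.cos_nat_mul_pi (n + 1)
  push_cast at this
  rw [freq, this, pow_succ]; ring

theorem sinB_zero (n : ℕ) : sinB n 0 = 0 := by simp [sinB_apply]

theorem sinB_one (n : ℕ) : sinB n 1 = 0 := by simp [sinB_apply, sin_freq_mul_pi]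

theorem cosB_zero (n : ℕ) : cosB n 0 = 1 := by simp [cosB_apply]

theorem cosB_one (n : ℕ) : cosB n 1 = -(-1) ^ n := by
  rw [cosB_apply, mul_one, cos_freq_mul_pi]; simp

theorem sinSeries_zero (a : Coeff) : sinSeries a 0 = 0 :=
  (hasSum_sinSeries a 0).unique (by simp [sinB_zero])

theorem sinSeries_one (a : Coeff) : sinSeries a 1 = 0 :=
  (hasSum_sinSeries a 1).unique (by simp [sinB_one])

theorem J0_zero (a : Coeff) : J0 a 0 = 0 := sinSeries_zero _

theorem J0_one (a : Coeff) : J0 a 1 = 0 := sinSeries_one _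

theorem J2_zero (a : Coeff) : J2 a 0 = 0 := by
  rw [J2_eval, sinSeries_zero, mul_zero]

theorem J2_one (a : Coeff) : J2 a 1 = 0 := by
  rw [J2_eval, sinSeries_one, mul_zero]

/-- The normalized cosines in `L²(0,1)`. -/
def cosL (n : ℕ) : L2 ℂ 0 1 := (√2 : ℂ) • L2.ofBCF (cosB n)

theorem integral_cos_int (q : ℤ) (hq : q ≠ 0) :
    ∫ x in (0 : ℝ)..1, Real.cos (Real.pi * q * x) = 0 := by
  have hq' : Real.pi * (q : ℝ) ≠ 0 := mul_ne_zero Real.pi_ne_zero (by exact_mod_cast hq)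
  rw [intervalIntegral.integral_comp_mul_left (fun x => Real.cos x) hq', integral_cos]
  simp [mul_comm Real.pi, Real.sin_int_mul_pi]

theorem integral_cos_mul_cos (m n : ℕ) :
    ∫ x in (0 : ℝ)..1, Real.cos (Real.pi * freq m * x) * Real.cos (Real.pi * freq n * x) =
      if m = n then 1 / 2 else 0 := by
  -- Frequencies are shifted by one, so their sum is `m + n + 2`, which never vanishes; only the
  -- difference can.
  have e : ∀ x : ℝ, Real.cos (Real.pi * freq m * x) * Real.cos (Real.pi * freq n * x) =
      1 / 2 * Real.cos (Real.pi * ((m - n : ℤ) : ℝ) * x) +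
        1 / 2 * Real.cos (Real.pi * ((m + n + 2 : ℤ) : ℝ) * x) := fun x => by
    have e1 : Real.pi * ((m - n : ℤ) : ℝ) * x =
      Real.pi * freq m * x - Real.pi * freq n * x := by push_cast [freq]; ring
    have e2 : Real.pi * ((m + n + 2 : ℤ) : ℝ) * x =
      Real.pi * freq m * x + Real.pi * freq n * x := by push_cast [freq]; ring
    rw [e1, e2, Real.cos_sub, Real.cos_add]; ring
  simp_rw [e]
  rw [intervalIntegral.integral_add (Continuous.intervalIntegrable (by fun_prop) _ _)
    (Continuous.intervalIntegrable (by fun_prop) _ _), intervalIntegral.integral_const_mul,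
    intervalIntegral.integral_const_mul, integral_cos_int (m + n + 2) (by positivity)]
  by_cases h : m = n
  · subst h; simp
  · rw [integral_cos_int _ (by omega)]; simp [h]

theorem orthonormal_cosL : Orthonormal ℂ cosL := by
  rw [orthonormal_iff_ite]
  intro m n
  have h2 : (√2 : ℂ) * √2 = 2 := by
    rw [← Complex.ofReal_mul, Real.mul_self_sqrt (by norm_num)]; norm_num
  have e : inner ℂ (L2.ofBCF (cosB m) : L2 ℂ 0 1) (L2.ofBCF (cosB n)) =
      ((if m = n then 1 / 2 else 0 : ℝ) : ℂ) := by
    rw [L2.ofBCF, BoundedContinuousFunction.inner_toLp, integral_Ioo_eq zero_le_one,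
      ← integral_cos_mul_cos, ← intervalIntegral.integral_ofReal]
    refine intervalIntegral.integral_congr fun x _ => ?_
    simp only [cosB_apply, Complex.conj_ofReal]
    push_cast; ring
  rw [cosL, cosL, inner_smul_left, inner_smul_right, e, Complex.conj_ofReal, ← mul_assoc, h2]
  split_ifs <;> norm_num

/-- The cosine series with square summable coefficients. -/
def cosIso : Coeff →ₗᵢ[ℂ] L2 ℂ 0 1 := orthonormal_cosL.orthogonalFamily.linearIsometry

theorem cosIso_e (n : ℕ) : cosIso (e n) = cosL n := by
  rw [e, cosIso, OrthogonalFamily.linearIsometry_apply_single]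
  simp

/-- The third derivative of `J0`. -/
def J3 : Coeff →L[ℂ] L2 ℂ 0 1 :=
  (-(Real.pi : ℂ) ^ 3 / (√2 : ℂ)) • cosIso.toContinuousLinearMap

theorem sqrt_two_ne : (√2 : ℂ) ≠ 0 := by
  rw [Ne, Complex.ofReal_eq_zero]; positivity

theorem J3_e (n : ℕ) : J3 (e n) = (-(Real.pi : ℂ) ^ 3) • L2.ofBCF (cosB n) := by
  rw [J3, _root_.smul_apply]
  change (_ : ℂ) • cosIso (e n) = _
  rw [cosIso_e, cosL, smul_smul, div_mul_cancel₀ _ sqrt_two_ne]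

theorem norm_J3_le (a : Coeff) : ‖J3 a‖ ≤ Real.pi ^ 3 * ‖a‖ := by
  have h1 : ‖J3 a‖ = ‖(-(Real.pi : ℂ) ^ 3 / (√2 : ℂ))‖ * ‖a‖ := by
    rw [J3, _root_.smul_apply, norm_smul]
    congr 1
    exact cosIso.norm_map a
  rw [h1]
  gcongr
  rw [norm_div, norm_neg, norm_pow, Complex.norm_real, Complex.norm_real,
    Real.norm_of_nonneg Real.pi_pos.le, Real.norm_of_nonneg (Real.sqrt_nonneg _)]
  exact div_le_self (by positivity) (Real.one_le_sqrt.2 (by norm_num))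

/-- `J1` with values in `L²`. -/
theorem ofBCF_J1 (a : Coeff) :
    (L2.ofBCF (J1 a) : L2 ℂ 0 1) = ((Real.pi : ℂ) / (√2 : ℂ)) • cosIso (invD (invD a)) := by
  have : L2.ofBCF ∘L J1 =
      ((Real.pi : ℂ) / (√2 : ℂ)) • cosIso.toContinuousLinearMap ∘L invD ∘L invD := by
    refine ext_clm fun n => ?_
    change L2.ofBCF ((Real.pi : ℂ) • cosSeries (invD (e n))) =
      ((Real.pi : ℂ) / (√2 : ℂ)) • cosIso (invD (invD (e n)))
    simp only [invD_e, map_smul, cosIso_e]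
    rw [cosSeries, series_e, map_smul, cosL, invFreq_apply, smul_smul, smul_smul, smul_smul, smul_smul,
      smul_smul]
    congr 1
    field_simp [sqrt_two_ne]
  exact DFunLike.congr_fun this a

/-- Parseval for the cosine series of `ξ'`. The right-hand side is what `kin` denotes below. -/
theorem norm_ofBCF_J1_sq (a : Coeff) :
    ‖(L2.ofBCF (J1 a) : L2 ℂ 0 1)‖ ^ 2 = Real.pi ^ 2 / 2 * ‖invD (invD a)‖ ^ 2 := by
  rw [ofBCF_J1, norm_smul, LinearIsometry.norm_map, norm_div, Complex.norm_real, Complex.norm_real,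
    Real.norm_of_nonneg Real.pi_pos.le, Real.norm_of_nonneg (Real.sqrt_nonneg _), mul_pow, div_pow,
    Real.sq_sqrt (by norm_num)]

theorem isPrimitive_J0 (a : Coeff) : IsPrimitive 0 1 (J0 a) (J1 a) :=
  IsPrimitive.of_continuous zero_le_one (hasDerivAt_J0 a) (J1 a).continuous

theorem isPrimitive_J1 (a : Coeff) : IsPrimitive 0 1 (J1 a) (J2 a) :=
  IsPrimitive.of_continuous zero_le_one (hasDerivAt_J1 a) (J2 a).continuous

/-- The third derivative is only in `L²`, so the series cannot be differentiated pointwise. Both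
sides of the integrated identity at a fixed `x` are bounded functionals of `a`, and they agree on
single modes. -/
theorem isPrimitive_J2 (a : Coeff) : IsPrimitive 0 1 (J2 a) (J3 a) := by
  refine ⟨L2.intervalIntegrable zero_le_one _, fun x hx => ?_⟩
  rw [← L2.integralTo_apply hx]
  have : BoundedContinuousFunction.evalCLM ℂ x ∘L J2 =
      BoundedContinuousFunction.evalCLM ℂ 0 ∘L J2 + L2.integralTo x ∘L J3 := by
    refine ext_clm fun n => ?_
    change J2 (e n) x = J2 (e n) 0 + L2.integralTo x (J3 (e n))
    have h1 : IsPrimitive 0 1 (sinB n) (fun y => ((Real.pi * freq n : ℝ) : ℂ) * cosB n y) :=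
      IsPrimitive.of_continuous zero_le_one (hasDerivAt_sinB n)
        (continuous_const.mul (cosB n).continuous)
    have h2 := h1.eq x hx
    have h3 : ∫ t in (0 : ℝ)..x, (L2.ofBCF (cosB n) : L2 ℂ 0 1) t = ∫ t in (0 : ℝ)..x, cosB n t := by
      refine intervalIntegral_congr_ae_Ioo hx.1 ?_
      exact ae_mono (Measure.restrict_mono (Ioo_subset_Ioo_right hx.2) le_rfl)
        (L2.coeFn_ofBCF (cosB n))
    rw [intervalIntegral.integral_const_mul, sinB_zero, zero_add] at h2
    rw [J2_zero, zero_add, J3_e, map_smul, L2.integralTo_apply hx, h3, J2_eval, sinSeries,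
      series_e]
    change -(Real.pi : ℂ) ^ 2 * (invFreq n * sinB n x) = _
    rw [h2, invFreq_apply, smul_eq_mul]
    push_cast
    have := invFreq_mul_freq n
    push_cast at this
    linear_combination (-(Real.pi : ℂ) ^ 3 * ∫ t in (0 : ℝ)..x, cosB n t) * this
  exact DFunLike.congr_fun this a

theorem conj_series {s : ℕ → ℝ →ᵇ ℂ} (hs : ∀ n x, starRingEnd ℂ (s n x) = s n x) {a : Coeff}
    {x : ℝ} {z w : ℂ} (h : HasSum (fun n => a n * s n x) z)
    (h' : HasSum (fun n => conj a n * s n x) w) : w = starRingEnd ℂ z := by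
  have h1 : HasSum (fun n => starRingEnd ℂ (a n * s n x)) (starRingEnd ℂ z) :=
    h.map (starRingEnd ℂ) Complex.continuous_conj
  refine h'.unique (h1.congr_fun fun n => ?_)
  simp [hs]

theorem sinSeries_conj (a : Coeff) (x : ℝ) :
    sinSeries (conj a) x = starRingEnd ℂ (sinSeries a x) := by
  refine conj_series (s := sinB) (a := invD a) (fun n x => ?_) (hasSum_sinSeries a x) ?_
  · rw [sinB_apply, Complex.conj_ofReal]
  · rw [← invD_conj]; exact hasSum_sinSeries _ x

theorem J0_conj (a : Coeff) (x : ℝ) : J0 (conj a) x = starRingEnd ℂ (J0 a x) := by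
  rw [J0_apply, J0_apply, invD_conj, invD_conj, sinSeries_conj]

theorem norm_sinSeries_le (a : Coeff) : ‖sinSeries a‖ ≤ ‖invFreq‖ * ‖a‖ :=
  norm_series_le _ _ _ _

theorem norm_cosSeries_le (a : Coeff) : ‖cosSeries a‖ ≤ ‖invFreq‖ * ‖a‖ :=
  norm_series_le _ _ _ _

theorem norm_J0_le (a : Coeff) : ‖J0 a‖ ≤ ‖invFreq‖ * ‖invD (invD a)‖ := norm_sinSeries_le _

theorem norm_J1_le (a : Coeff) : ‖J1 a‖ ≤ Real.pi * ‖invFreq‖ * ‖invD a‖ := by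
  rw [J1_apply, norm_smul, Complex.norm_real, Real.norm_of_nonneg Real.pi_pos.le, mul_assoc]
  gcongr
  exact norm_cosSeries_le _

theorem norm_J2_le (a : Coeff) : ‖J2 a‖ ≤ Real.pi ^ 2 * ‖invFreq‖ * ‖a‖ := by
  rw [J2_apply, norm_smul, norm_neg, norm_pow, Complex.norm_real,
    Real.norm_of_nonneg Real.pi_pos.le, mul_assoc]
  gcongr
  exact norm_sinSeries_le _

end Coeff

/-! ### Sine coefficients of a function and convergence of its sine series -/

namespace Coeff

/-- The sine coefficients, weighted with the cube of the frequency. -/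
def coef (f : ℝ → ℂ) (n : ℕ) : ℂ := 2 * (freq n : ℂ) ^ 3 * ∫ x in (0 : ℝ)..1, f x * sinB n x

theorem isPrimitive_sinB (n : ℕ) :
    IsPrimitive 0 1 (sinB n) (fun y => ((Real.pi * freq n : ℝ) : ℂ) * cosB n y) :=
  IsPrimitive.of_continuous zero_le_one (hasDerivAt_sinB n)
    (continuous_const.mul (cosB n).continuous)

theorem isPrimitive_cosB (n : ℕ) :
    IsPrimitive 0 1 (cosB n) (fun y => -((Real.pi * freq n : ℝ) : ℂ) * sinB n y) :=
  IsPrimitive.of_continuous zero_le_one (hasDerivAt_cosB n)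
    (continuous_const.mul (sinB n).continuous)

/-- Three integrations by parts. The boundary terms with `f` vanish by hypothesis and those with
`f₁` because the sine vanishes. Those with `f₂` remain, and the sign at `1` comes from `cos(π(n+1))
= -(-1)ⁿ`. -/
theorem coef_eq {f f₁ f₂ f₃ : ℝ → ℂ} (h0 : IsPrimitive 0 1 f f₁) (h1 : IsPrimitive 0 1 f₁ f₂)
    (h2 : IsPrimitive 0 1 f₂ f₃) (hl : f 0 = 0) (hr : f 1 = 0) (n : ℕ) :
    coef f n = -(2 / (Real.pi : ℂ) ^ 3) *
      (f₂ 0 + (-1) ^ n * f₂ 1 + ∫ x in (0 : ℝ)..1, f₃ x * cosB n x) := by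
  have e0 := h0.integral_mul_eq_sub zero_le_one (isPrimitive_cosB n)
  have e1 := h1.integral_mul_eq_sub zero_le_one (isPrimitive_sinB n)
  have e2 := h2.integral_mul_eq_sub zero_le_one (isPrimitive_cosB n)
  simp only [mul_left_comm _ (-((Real.pi * freq n : ℝ) : ℂ)),
    mul_left_comm _ ((Real.pi * freq n : ℝ) : ℂ), intervalIntegral.integral_const_mul, hl, hr,
    sinB_zero, sinB_one, cosB_zero, cosB_one] at e0 e1 e2
  have hp : (Real.pi : ℂ) ≠ 0 := by exact_mod_cast Real.pi_ne_zero
  rw [coef, e2]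
  push_cast at e0 e1 e2 ⊢
  have key : (Real.pi : ℂ) * freq n * (∫ x in (0 : ℝ)..1, f₂ x * sinB n x) =
      -(Real.pi * freq n) ^ 3 * ∫ x in (0 : ℝ)..1, f x * sinB n x := by
    linear_combination (Real.pi * freq n : ℂ) * e1 - (Real.pi * freq n : ℂ) ^ 2 * e0
  calc _ = -(2 / (Real.pi : ℂ) ^ 3) *
        (-(Real.pi * freq n) ^ 3 * ∫ x in (0 : ℝ)..1, f x * sinB n x) := by field_simp
    _ = _ := by rw [← key]; ring

/-- A continuous function on `[0,1]` that vanishes at the ends and has an absolutely convergent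
sine series is the sum of that series. -/
theorem hasSum_sine {f : ℝ → ℂ} (hf : ContinuousOn f (Icc 0 1)) (hl : f 0 = 0) (hr : f 1 = 0)
    (hs : Summable fun n => ‖coef f n / (freq n : ℂ) ^ 3‖) {x : ℝ} (hx : x ∈ Icc (0 : ℝ) 1) :
    HasSum (fun n => coef f n / (freq n : ℂ) ^ 3 * sinB n x) (f x) := by
  -- The constant extension vanishes on `(-∞, 0]` because `f 0 = 0`. Hence `fc y - fc (-y)` below is
  -- the odd extension of `f` on `[-1,1]`, and `f 1 = 0` lets it descend to the circle of length
  -- `2`.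
  let fc : ℝ → ℂ := IccExtend zero_le_one ((Icc (0 : ℝ) 1).domRestrict f)
  have hfc : Continuous fc := (continuousOn_iff_continuous_domRestrict.1 hf).Icc_extend'
  have hfc1 : ∀ y ∈ Icc (0 : ℝ) 1, fc y = f y := fun y hy => by
    simp only [fc, IccExtend_of_mem _ _ hy]; rfl
  have hfc2 : ∀ y ≤ 0, fc y = 0 := fun y hy => by
    simp only [fc, IccExtend_of_le_left zero_le_one _ hy]; exact hl
  let F : ℝ → ℂ := fun y => fc y - fc (-y)
  have hF : Continuous F := hfc.sub (hfc.comp continuous_neg)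
  have hF1 : ∀ y ∈ Icc (0 : ℝ) 1, F y = f y := fun y hy => by
    simp only [F, hfc1 y hy, hfc2 (-y) (by linarith [hy.1]), sub_zero]
  have hF2 : ∀ y, F (-y) = - F y := fun y => by simp only [F, neg_neg]; ring
  have hFe : F (-1) = F (-1 + 2) := by
    rw [hF2, show (-1 : ℝ) + 2 = 1 by norm_num, hF1 1 ⟨zero_le_one, le_rfl⟩, hr, neg_zero]
  have : Fact (0 < (2 : ℝ)) := ⟨two_pos⟩
  let g : C(AddCircle (2 : ℝ), ℂ) :=
    ⟨AddCircle.liftIco 2 (-1) F, AddCircle.liftIco_continuous hFe hF.continuousOn⟩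
  have hg : ∀ y ∈ Ico (-1 : ℝ) (-1 + 2), g (y : AddCircle (2 : ℝ)) = F y := fun y hy =>
    AddCircle.liftIco_coe_apply (f := F) hy
  have hc : ∀ n : ℤ, fourierCoeff g n =
      -Complex.I * ∫ y in (0 : ℝ)..1, f y * ((Real.sin (Real.pi * n * y) : ℝ) : ℂ) := by
    intro n
    have h1 : fourierCoeff g n = (1 / 2 : ℝ) • ∫ y in (-1 : ℝ)..1,
        Complex.exp (-(Real.pi * n * y : ℝ) * Complex.I) * F y := by
      have := fourierCoeff_eq_intervalIntegral g n (-1)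
      rw [this, show (-1 : ℝ) + 2 = 1 by norm_num]
      congr 1
      refine intervalIntegral.integral_congr_Ioo_of_le (by norm_num) fun y hy => ?_
      have e1 : g (y : AddCircle (2 : ℝ)) = F y :=
        hg y ⟨hy.1.le, by linarith [hy.2]⟩
      simp only [e1, smul_eq_mul]
      rw [fourier_coe_apply]
      congr 2
      push_cast
      ring
    have hcont : Continuous fun y : ℝ =>
        Complex.exp (-(Real.pi * n * y : ℝ) * Complex.I) * F y := by fun_prop
    have hcont' : Continuous fun y : ℝ =>
        Complex.exp (-(Real.pi * n * -y : ℝ) * Complex.I) * F (-y) := hcont.comp continuous_neg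
    rw [h1, ← intervalIntegral.integral_add_adjacent_intervals (b := 0)
      (hcont.intervalIntegrable _ _) (hcont.intervalIntegrable _ _)]
    -- The integral over `[-1,0]` is reflected onto `[0,1]`; since the extension is odd, the two
    -- exponentials combine into a sine.
    have h2 := intervalIntegral.integral_comp_neg (a := (0 : ℝ)) (b := 1) (fun y : ℝ =>
        Complex.exp (-(Real.pi * n * y : ℝ) * Complex.I) * F y)
    rw [neg_zero] at h2
    rw [← h2, ← intervalIntegral.integral_add (hcont'.intervalIntegrable _ _)
      (hcont.intervalIntegrable _ _), ← intervalIntegral.integral_smul,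
      ← intervalIntegral.integral_const_mul]
    refine intervalIntegral.integral_congr fun y hy => ?_
    rw [uIcc_of_le zero_le_one] at hy
    simp only [hF2, hF1 y hy]
    have e1 : (-((Real.pi * n * -y : ℝ) : ℂ) * Complex.I) =
      ((Real.pi * n * y : ℝ) : ℂ) * Complex.I := by push_cast; ring
    rw [e1, Complex.real_smul, Complex.ofReal_sin]
    have e2 := Complex.two_sin (((Real.pi * n * y : ℝ) : ℂ))
    push_cast at e2 ⊢
    linear_combination (Complex.I * f y / 2) * e2 +
      (Complex.exp (-(Real.pi * n * y) * Complex.I) - Complex.exp (Real.pi * n * y * Complex.I)) *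
        f y / 2 * Complex.I_mul_I
  have hpos : ∀ n : ℕ, fourierCoeff g ((n + 1 : ℕ) : ℤ) =
      -Complex.I / 2 * (coef f n / (freq n : ℂ) ^ 3) := by
    intro n
    rw [hc, coef, mul_assoc, mul_div_assoc', mul_comm (2 : ℂ), mul_assoc, mul_comm _ (2 : ℂ)]
    have e1 : ∀ y : ℝ, Real.pi * (((n + 1 : ℕ) : ℤ) : ℝ) * y = Real.pi * freq n * y := fun y => by
      rw [freq]; push_cast; ring
    simp only [e1, sinB_apply]
    field_simp [freq_ne n]
  have hneg : ∀ n : ℕ, fourierCoeff g (-(n : ℤ)) = - fourierCoeff g n := by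
    intro n
    rw [hc, hc, ← mul_neg, ← intervalIntegral.integral_neg]
    congr 2
    funext y
    push_cast
    rw [mul_neg, neg_mul, Complex.sin_neg, mul_neg]
  have hzero : fourierCoeff g 0 = 0 := by rw [hc]; simp
  have hsN : Summable fun n : ℕ => fourierCoeff g n := by
    rw [← summable_nat_add_iff 1]
    simp only [hpos]
    exact (Summable.of_norm hs).mul_left _
  have hsZ : Summable (fourierCoeff g) := by
    refine Summable.of_nat_of_neg hsN ?_
    simp only [hneg]
    exact hsN.neg
  have h1 := has_pointwise_sum_fourier_series_of_summable hsZ (x : AddCircle (2 : ℝ))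
  -- The circle is parametrized by `[-1,1)`, which omits this endpoint; there both sides vanish.
  by_cases hx1 : x = 1
  · subst hx1
    simp [sinB_one, hr]
  have e1 : g (x : AddCircle (2 : ℝ)) = f x := by
    rw [← hF1 x hx]
    have hx2 := lt_of_le_of_ne hx.2 hx1
    exact hg x ⟨by linarith [hx.1], by linarith⟩
  rw [e1] at h1
  -- The terms of index `n` and `-n` pair up to a sine, and the term of index zero vanishes.
  have h2 := h1.nat_add_neg
  rw [hzero, zero_smul, add_zero, ← hasSum_nat_add_iff' 1] at h2
  simp only [Finset.range_one, Finset.sum_singleton, Nat.cast_zero, neg_zero, hzero, zero_smul,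
    add_zero, sub_zero] at h2
  refine h2.congr_fun fun n => ?_
  rw [hneg, hpos, fourier_coe_apply, fourier_coe_apply, sinB_apply, Complex.ofReal_sin]
  have e3 := Complex.two_sin (((Real.pi * freq n * x : ℝ) : ℂ))
  have e4 : (2 * Real.pi * Complex.I * ((n + 1 : ℕ) : ℤ) * x / (2 : ℝ) : ℂ) =
      ((Real.pi * freq n * x : ℝ) : ℂ) * Complex.I := by rw [freq]; push_cast; ring
  have e5 : (2 * Real.pi * Complex.I * ((-((n + 1 : ℕ) : ℤ) : ℤ) : ℂ) * x / (2 : ℝ) : ℂ) =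
      -((Real.pi * freq n * x : ℝ) : ℂ) * Complex.I := by rw [freq]; push_cast; ring
  rw [e4, e5, smul_eq_mul, smul_eq_mul]
  linear_combination (coef f n / (freq n : ℂ) ^ 3 / 2) * e3

end Coeff

/-! ### The cubic term and multiplication by `x²` on the coefficients -/

theorem IsPrimitive.congr_ae {f f' g' : ℝ → ℂ} {a b : ℝ} (hf : IsPrimitive a b f f')
    (hi : IntervalIntegrable g' volume a b)
    (h : ∀ᵐ x ∂(volume : Measure ℝ).restrict (Ioo a b), f' x = g' x) : IsPrimitive a b f g' := by
  rw [ae_restrict_iff' measurableSet_Ioo] at h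
  refine ⟨hi, fun x hx => ?_⟩
  rw [hf.eq x hx]
  congr 1
  refine intervalIntegral_congr_ae_Ioo hx.1 ?_
  rw [ae_restrict_iff' measurableSet_Ioo]
  filter_upwards [h] with y hy hy' using hy ⟨hy'.1, hy'.2.trans_le hx.2⟩

namespace Coeff

/-- The adjoint of the cosine series. -/
def cosAdj : L2 ℂ 0 1 →L[ℂ] Coeff := ContinuousLinearMap.adjoint cosIso.toContinuousLinearMap

theorem cosAdj_apply (f : L2 ℂ 0 1) (n : ℕ) :
    cosAdj f n = (√2 : ℂ) * ∫ x in (0 : ℝ)..1, f x * cosB n x := by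
  have h1 : inner ℂ (e n) (cosAdj f) = inner ℂ (cosL n) f := by
    rw [cosAdj, ContinuousLinearMap.adjoint_inner_right]
    change inner ℂ (cosIso (e n)) f = _
    rw [cosIso_e]
  have h2 : inner ℂ (e n) (cosAdj f) = cosAdj f n := by
    rw [e, lp.inner_single_left]; simp
  rw [← h2, h1, cosL, inner_smul_left, Complex.conj_ofReal, L2.inner_def,
    integral_Ioo_eq zero_le_one]
  congr 1
  refine intervalIntegral_congr_ae_Ioo zero_le_one ?_
  filter_upwards [L2.coeFn_ofBCF (cosB n)] with x hx
  rw [hx, RCLike.inner_apply, cosB_apply, Complex.conj_ofReal]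

theorem norm_cosAdj_le (f : L2 ℂ 0 1) : ‖cosAdj f‖ ≤ ‖f‖ := by
  have h : ‖cosAdj‖ ≤ 1 := by
    rw [cosAdj, LinearIsometryEquiv.norm_map]
    exact cosIso.norm_toContinuousLinearMap_le
  simpa using cosAdj.le_of_opNorm_le h f

/-- The sequence with the sine coefficients of a function whose third derivative is given and
whose second derivative vanishes at the ends. -/
def ofThird : L2 ℂ 0 1 →L[ℂ] Coeff := (-(√2 : ℂ) / (Real.pi : ℂ) ^ 3) • cosAdj

theorem ofThird_apply (f : L2 ℂ 0 1) (n : ℕ) :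
    ofThird f n = -(2 / (Real.pi : ℂ) ^ 3) * ∫ x in (0 : ℝ)..1, f x * cosB n x := by
  have h2 : (√2 : ℂ) * √2 = 2 := by
    rw [← Complex.ofReal_mul, Real.mul_self_sqrt (by norm_num)]; norm_num
  have h1 : ofThird f n = (-(√2 : ℂ) / (Real.pi : ℂ) ^ 3) * cosAdj f n := rfl
  rw [h1, cosAdj_apply]
  linear_combination (-(∫ x in (0 : ℝ)..1, f x * cosB n x) / (Real.pi : ℂ) ^ 3) * h2

theorem norm_ofThird_le (f : L2 ℂ 0 1) : ‖ofThird f‖ ≤ ‖f‖ := by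
  have h1 : ofThird f = (-(√2 : ℂ) / (Real.pi : ℂ) ^ 3) • cosAdj f := rfl
  rw [h1, norm_smul]
  refine (mul_le_of_le_one_left (norm_nonneg _) ?_).trans (norm_cosAdj_le f)
  rw [norm_div, norm_neg, norm_pow, Complex.norm_real, Complex.norm_real,
    Real.norm_of_nonneg Real.pi_pos.le, Real.norm_of_nonneg (Real.sqrt_nonneg _)]
  have h3 : √2 ≤ 2 := by rw [Real.sqrt_le_left (by norm_num)]; norm_num
  have h4 : (1 : ℝ) ≤ Real.pi := by linarith [Real.pi_gt_three]
  have h5 : (3 : ℝ) ≤ Real.pi ^ 3 := by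
    calc (3 : ℝ) ≤ Real.pi := Real.pi_gt_three.le
      _ ≤ Real.pi ^ 3 := le_self_pow₀ h4 (by norm_num)
  rw [div_le_one (by positivity)]
  linarith

/-- Separates the part that is square summable by Bessel's inequality for `f₃` from the boundary
part at `1`, which does not decay in `n`. -/
theorem coef_eq_ofThird {f f₁ f₂ : ℝ → ℂ} {f₃ : L2 ℂ 0 1} (h0 : IsPrimitive 0 1 f f₁)
    (h1 : IsPrimitive 0 1 f₁ f₂) (h2 : IsPrimitive 0 1 f₂ f₃) (hl : f 0 = 0) (hr : f 1 = 0)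
    (hl2 : f₂ 0 = 0) (n : ℕ) :
    coef f n = ofThird f₃ n + (-1) ^ n * (-(2 / (Real.pi : ℂ) ^ 3) * f₂ 1) := by
  rw [coef_eq h0 h1 h2 hl hr, ofThird_apply, hl2]
  ring

/-- The third derivative of a product of three functions. -/
def tripleThird (a b c : Coeff) : L2 ℂ 0 1 :=
  (L2.mul (J0 b * J0 c) (J3 a) + L2.mul (J0 a * J0 c) (J3 b) + L2.mul (J0 a * J0 b) (J3 c)) +
  (3 : ℂ) • (L2.mul (J2 a * J0 c) (L2.ofBCF (J1 b)) + L2.mul (J2 a * J0 b) (L2.ofBCF (J1 c)) +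
    L2.mul (J2 b * J0 a) (L2.ofBCF (J1 c)) + L2.mul (J2 b * J0 c) (L2.ofBCF (J1 a)) +
    L2.mul (J2 c * J0 a) (L2.ofBCF (J1 b)) + L2.mul (J2 c * J0 b) (L2.ofBCF (J1 a))) +
  (6 : ℂ) • L2.mul (J1 a * J1 b) (L2.ofBCF (J1 c))

theorem coeFn_tripleThird (a b c : Coeff) :
    ∀ᵐ x ∂(volume : Measure ℝ).restrict (Ioo 0 1), tripleThird a b c x =
      (J0 b x * J0 c x * J3 a x + J0 a x * J0 c x * J3 b x + J0 a x * J0 b x * J3 c x) +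
      3 * (J2 a x * J0 c x * J1 b x + J2 a x * J0 b x * J1 c x + J2 b x * J0 a x * J1 c x +
        J2 b x * J0 c x * J1 a x + J2 c x * J0 a x * J1 b x + J2 c x * J0 b x * J1 a x) +
      6 * (J1 a x * J1 b x * J1 c x) := by
  have hm : ∀ (p : ℝ →ᵇ ℂ) (d : Coeff), ∀ᵐ x ∂(volume : Measure ℝ).restrict (Ioo 0 1),
      (L2.mul p (L2.ofBCF (J1 d)) : L2 ℂ 0 1) x = p x * J1 d x := fun p d => by
    filter_upwards [L2.coeFn_mul p (L2.ofBCF (J1 d)), L2.coeFn_ofBCF (J1 d)] with x h1 h2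
    rw [h1, h2]
  rw [tripleThird]
  filter_upwards [Lp.coeFn_add (L2.mul (J0 b * J0 c) (J3 a) + L2.mul (J0 a * J0 c) (J3 b) +
      L2.mul (J0 a * J0 b) (J3 c) + (3 : ℂ) • (L2.mul (J2 a * J0 c) (L2.ofBCF (J1 b)) +
        L2.mul (J2 a * J0 b) (L2.ofBCF (J1 c)) + L2.mul (J2 b * J0 a) (L2.ofBCF (J1 c)) +
        L2.mul (J2 b * J0 c) (L2.ofBCF (J1 a)) + L2.mul (J2 c * J0 a) (L2.ofBCF (J1 b)) +
        L2.mul (J2 c * J0 b) (L2.ofBCF (J1 a))) : L2 ℂ 0 1)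
      ((6 : ℂ) • L2.mul (J1 a * J1 b) (L2.ofBCF (J1 c))),
    Lp.coeFn_add (L2.mul (J0 b * J0 c) (J3 a) + L2.mul (J0 a * J0 c) (J3 b) +
      L2.mul (J0 a * J0 b) (J3 c)) ((3 : ℂ) • (L2.mul (J2 a * J0 c) (L2.ofBCF (J1 b)) +
        L2.mul (J2 a * J0 b) (L2.ofBCF (J1 c)) + L2.mul (J2 b * J0 a) (L2.ofBCF (J1 c)) +
        L2.mul (J2 b * J0 c) (L2.ofBCF (J1 a)) + L2.mul (J2 c * J0 a) (L2.ofBCF (J1 b)) +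
        L2.mul (J2 c * J0 b) (L2.ofBCF (J1 a))) : L2 ℂ 0 1),
    Lp.coeFn_add (L2.mul (J0 b * J0 c) (J3 a) + L2.mul (J0 a * J0 c) (J3 b))
      (L2.mul (J0 a * J0 b) (J3 c)),
    Lp.coeFn_add (L2.mul (J0 b * J0 c) (J3 a)) (L2.mul (J0 a * J0 c) (J3 b)),
    Lp.coeFn_smul (6 : ℂ) (L2.mul (J1 a * J1 b) (L2.ofBCF (J1 c)) : L2 ℂ 0 1),
    Lp.coeFn_smul (3 : ℂ) (L2.mul (J2 a * J0 c) (L2.ofBCF (J1 b)) +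
        L2.mul (J2 a * J0 b) (L2.ofBCF (J1 c)) + L2.mul (J2 b * J0 a) (L2.ofBCF (J1 c)) +
        L2.mul (J2 b * J0 c) (L2.ofBCF (J1 a)) + L2.mul (J2 c * J0 a) (L2.ofBCF (J1 b)) +
        L2.mul (J2 c * J0 b) (L2.ofBCF (J1 a)) : L2 ℂ 0 1),
    Lp.coeFn_add (L2.mul (J2 a * J0 c) (L2.ofBCF (J1 b)) +
        L2.mul (J2 a * J0 b) (L2.ofBCF (J1 c)) + L2.mul (J2 b * J0 a) (L2.ofBCF (J1 c)) +
        L2.mul (J2 b * J0 c) (L2.ofBCF (J1 a)) + L2.mul (J2 c * J0 a) (L2.ofBCF (J1 b)) : L2 ℂ 0 1)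
        (L2.mul (J2 c * J0 b) (L2.ofBCF (J1 a))),
    Lp.coeFn_add (L2.mul (J2 a * J0 c) (L2.ofBCF (J1 b)) +
        L2.mul (J2 a * J0 b) (L2.ofBCF (J1 c)) + L2.mul (J2 b * J0 a) (L2.ofBCF (J1 c)) +
        L2.mul (J2 b * J0 c) (L2.ofBCF (J1 a)) : L2 ℂ 0 1)
        (L2.mul (J2 c * J0 a) (L2.ofBCF (J1 b))),
    Lp.coeFn_add (L2.mul (J2 a * J0 c) (L2.ofBCF (J1 b)) +
        L2.mul (J2 a * J0 b) (L2.ofBCF (J1 c)) + L2.mul (J2 b * J0 a) (L2.ofBCF (J1 c)) : L2 ℂ 0 1)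
        (L2.mul (J2 b * J0 c) (L2.ofBCF (J1 a))),
    Lp.coeFn_add (L2.mul (J2 a * J0 c) (L2.ofBCF (J1 b)) +
        L2.mul (J2 a * J0 b) (L2.ofBCF (J1 c)) : L2 ℂ 0 1) (L2.mul (J2 b * J0 a) (L2.ofBCF (J1 c))),
    Lp.coeFn_add (L2.mul (J2 a * J0 c) (L2.ofBCF (J1 b)) : L2 ℂ 0 1)
        (L2.mul (J2 a * J0 b) (L2.ofBCF (J1 c))),
    L2.coeFn_mul (J0 b * J0 c) (J3 a), L2.coeFn_mul (J0 a * J0 c) (J3 b),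
    L2.coeFn_mul (J0 a * J0 b) (J3 c), hm (J2 a * J0 c) b, hm (J2 a * J0 b) c, hm (J2 b * J0 a) c,
    hm (J2 b * J0 c) a, hm (J2 c * J0 a) b, hm (J2 c * J0 b) a, hm (J1 a * J1 b) c]
    with x h1 h2 h3 h4 h5 h6 h7 h8 h9 h10 h11 g1 g2 g3 g4 g5 g6 g7 g8 g9 g10
  rw [h1, Pi.add_apply, h2, Pi.add_apply, h3, Pi.add_apply, h4, Pi.add_apply, h5, Pi.smul_apply, h6,
    Pi.smul_apply, h7, Pi.add_apply, h8, Pi.add_apply, h9, Pi.add_apply, h10, Pi.add_apply, h11,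
    Pi.add_apply, g1, g2, g3, g4, g5, g6, g7, g8, g9, g10]
  simp only [BoundedContinuousFunction.mul_apply, smul_eq_mul]

/-- The coefficients of the product of three functions. -/
def triple (a b c : Coeff) : Coeff := ofThird (tripleThird a b c)

/-- Every term of the second derivative of the product keeps an undifferentiated factor. It
therefore vanishes at both ends and there is no boundary part. -/
theorem coef_triple (a b c : Coeff) (n : ℕ) :
    coef (fun x => J0 a x * J0 b x * J0 c x) n = triple a b c n := by
  have z := zero_le_one (α := ℝ)
  have ha0 := isPrimitive_J0 a
  have ha1 := isPrimitive_J1 a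
  have ha2 := isPrimitive_J2 a
  have hb0 := isPrimitive_J0 b
  have hb1 := isPrimitive_J1 b
  have hb2 := isPrimitive_J2 b
  have hc0 := isPrimitive_J0 c
  have hc1 := isPrimitive_J1 c
  have hc2 := isPrimitive_J2 c
  have h0 : IsPrimitive 0 1 (fun x => J0 a x * J0 b x * J0 c x)
      (fun x => J1 a x * J0 b x * J0 c x + J0 a x * J1 b x * J0 c x + J0 a x * J0 b x * J1 c x) :=
    ((ha0.mul z hb0).mul z hc0).congr_right z fun x _ => by ring
  have h1 : IsPrimitive 0 1
      (fun x => J1 a x * J0 b x * J0 c x + J0 a x * J1 b x * J0 c x + J0 a x * J0 b x * J1 c x)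
      (fun x => J2 a x * J0 b x * J0 c x + J0 a x * J2 b x * J0 c x + J0 a x * J0 b x * J2 c x +
        2 * (J1 a x * J1 b x * J0 c x + J1 a x * J0 b x * J1 c x + J0 a x * J1 b x * J1 c x)) :=
    ((((ha1.mul z hb0).mul z hc0).add z ((ha0.mul z hb1).mul z hc0)).add z
      ((ha0.mul z hb0).mul z hc1)).congr_right z fun x _ => by ring
  have h2 : IsPrimitive 0 1
      (fun x => J2 a x * J0 b x * J0 c x + J0 a x * J2 b x * J0 c x + J0 a x * J0 b x * J2 c x +
        2 * (J1 a x * J1 b x * J0 c x + J1 a x * J0 b x * J1 c x + J0 a x * J1 b x * J1 c x))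
      (tripleThird a b c) := by
    refine (((((ha2.mul z hb0).mul z hc0).add z ((ha0.mul z hb2).mul z hc0)).add z
      ((ha0.mul z hb0).mul z hc2)).add z (((((ha1.mul z hb1).mul z hc0).add z
        ((ha1.mul z hb0).mul z hc1)).add z ((ha0.mul z hb1).mul z hc1)).const_mul z 2)).congr_ae
      (L2.intervalIntegrable z _) ?_
    filter_upwards [coeFn_tripleThird a b c] with x hx
    rw [hx]; ring
  rw [coef_eq_ofThird h0 h1 h2 (by simp [J0_zero]) (by simp [J0_one]) (by simp [J0_zero]),
    triple]
  simp [J0_one]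

theorem norm_mul₂_le {a b : ℝ} (p q : ℝ →ᵇ ℂ) (f : L2 ℂ a b) :
    ‖L2.mul (p * q) f‖ ≤ ‖p‖ * ‖q‖ * ‖f‖ :=
  (L2.norm_mul_le _ _).trans (by gcongr; exact norm_mul_le p q)

theorem norm_triple_le_sum (a b c : Coeff) : ‖triple a b c‖ ≤
    (‖J0 b‖ * ‖J0 c‖ * ‖J3 a‖ + ‖J0 a‖ * ‖J0 c‖ * ‖J3 b‖ + ‖J0 a‖ * ‖J0 b‖ * ‖J3 c‖) +
    3 * (‖J2 a‖ * ‖J0 c‖ * ‖(L2.ofBCF (J1 b) : L2 ℂ 0 1)‖ +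
      ‖J2 a‖ * ‖J0 b‖ * ‖(L2.ofBCF (J1 c) : L2 ℂ 0 1)‖ +
      ‖J2 b‖ * ‖J0 a‖ * ‖(L2.ofBCF (J1 c) : L2 ℂ 0 1)‖ +
      ‖J2 b‖ * ‖J0 c‖ * ‖(L2.ofBCF (J1 a) : L2 ℂ 0 1)‖ +
      ‖J2 c‖ * ‖J0 a‖ * ‖(L2.ofBCF (J1 b) : L2 ℂ 0 1)‖ +
      ‖J2 c‖ * ‖J0 b‖ * ‖(L2.ofBCF (J1 a) : L2 ℂ 0 1)‖) +
    6 * (‖J1 a‖ * ‖J1 b‖ * ‖(L2.ofBCF (J1 c) : L2 ℂ 0 1)‖) := by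
  refine (norm_ofThird_le _).trans ?_
  rw [tripleThird]
  refine (norm_add₃_le).trans ?_
  rw [norm_smul, norm_smul]
  have e3 : ‖(3 : ℂ)‖ = 3 := by norm_num
  have e6 : ‖(6 : ℂ)‖ = 6 := by norm_num
  rw [e3, e6]
  gcongr
  · exact norm_add₃_le.trans (by gcongr <;> exact norm_mul₂_le _ _ _)
  · refine (norm_add_le _ _).trans (add_le_add ?_ (norm_mul₂_le _ _ _))
    refine (norm_add_le _ _).trans (add_le_add ?_ (norm_mul₂_le _ _ _))
    refine (norm_add_le _ _).trans (add_le_add ?_ (norm_mul₂_le _ _ _))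
    exact norm_add₃_le.trans (by gcongr <;> exact norm_mul₂_le _ _ _)
  · exact norm_mul₂_le _ _ _

/-- A common bound for the norms of the operators `Jᵢ`. -/
def opBound : ℝ := Real.pi ^ 3 * (1 + ‖invFreq‖)

theorem opBound_nonneg : 0 ≤ opBound := by
  have := Real.pi_pos; unfold opBound; positivity

theorem le_opBound {i r : ℝ} (j : ℕ) (hj : j ≤ 3) (hi : i ≤ 1 + ‖invFreq‖) (hr : 0 ≤ r)
    {y : ℝ} (h : y ≤ Real.pi ^ j * i * r) : y ≤ opBound * r := by
  refine h.trans ?_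
  have h4 : (1 : ℝ) ≤ Real.pi := by linarith [Real.pi_gt_three]
  have h5 : (0 : ℝ) ≤ Real.pi ^ j := by positivity
  unfold opBound
  refine mul_le_mul_of_nonneg_right ?_ hr
  calc Real.pi ^ j * i ≤ Real.pi ^ j * (1 + ‖invFreq‖) := by gcongr
    _ ≤ _ := by gcongr

theorem norm_J0_le' (a : Coeff) : ‖J0 a‖ ≤ opBound * ‖invD (invD a)‖ :=
  le_opBound 0 (by norm_num) (le_add_of_nonneg_left zero_le_one) (norm_nonneg _)
    (by simpa using norm_J0_le a)

theorem norm_J1_le' (a : Coeff) : ‖J1 a‖ ≤ opBound * ‖invD a‖ :=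
  le_opBound 1 (by norm_num) (le_add_of_nonneg_left zero_le_one) (norm_nonneg _)
    (by simpa using norm_J1_le a)

theorem norm_J2_le' (a : Coeff) : ‖J2 a‖ ≤ opBound * ‖a‖ :=
  le_opBound 2 (by norm_num) (le_add_of_nonneg_left zero_le_one) (norm_nonneg _) (norm_J2_le a)

theorem norm_J3_le' (a : Coeff) : ‖J3 a‖ ≤ opBound * ‖a‖ :=
  le_opBound 3 le_rfl (i := 1) (by linarith [norm_nonneg invFreq]) (norm_nonneg _)
    (by simpa using norm_J3_le a)

theorem norm_ofBCF_J1_le (a : Coeff) :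
    ‖(L2.ofBCF (J1 a) : L2 ℂ 0 1)‖ ≤ opBound * ‖invD (invD a)‖ := by
  refine le_opBound 1 (by norm_num) (i := 1) (by linarith [norm_nonneg invFreq])
    (norm_nonneg _) ?_
  rw [pow_one, mul_one, ← sq_le_sq₀ (norm_nonneg _)
    (mul_nonneg Real.pi_pos.le (norm_nonneg _)), norm_ofBCF_J1_sq, mul_pow]
  gcongr
  linarith [sq_nonneg Real.pi]

theorem norm_invD_invD_le (a : Coeff) : ‖invD (invD a)‖ ≤ ‖a‖ :=
  (norm_invD_le _).trans (norm_invD_le _)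

/-- The number `27 = 3 + 3·6 + 6` counts the terms of the third derivative of a product of three
factors. -/
theorem norm_triple_le (a b c : Coeff) :
    ‖triple a b c‖ ≤ 27 * opBound ^ 3 * (‖a‖ * ‖b‖ * ‖c‖) := by
  have hM := opBound_nonneg
  have k0 : ∀ d : Coeff, ‖J0 d‖ ≤ opBound * ‖d‖ := fun d =>
    (norm_J0_le' d).trans (by gcongr; exact norm_invD_invD_le d)
  have k1 : ∀ d : Coeff, ‖J1 d‖ ≤ opBound * ‖d‖ := fun d =>
    (norm_J1_le' d).trans (by gcongr; exact norm_invD_le d)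
  have kk : ∀ d : Coeff, ‖(L2.ofBCF (J1 d) : L2 ℂ 0 1)‖ ≤ opBound * ‖d‖ := fun d =>
    (norm_ofBCF_J1_le d).trans (by gcongr; exact norm_invD_invD_le d)
  have a0 := k0 a
  have b0 := k0 b
  have c0 := k0 c
  have a1 := k1 a
  have b1 := k1 b
  have ak := kk a
  have bk := kk b
  have ck := kk c
  have a2 := norm_J2_le' a
  have b2 := norm_J2_le' b
  have c2 := norm_J2_le' c
  have a3 := norm_J3_le' a
  have b3 := norm_J3_le' b
  have c3 := norm_J3_le' c
  refine (norm_triple_le_sum a b c).trans ?_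
  calc _ ≤ ((opBound * ‖b‖) * (opBound * ‖c‖) * (opBound * ‖a‖) +
        (opBound * ‖a‖) * (opBound * ‖c‖) * (opBound * ‖b‖) +
        (opBound * ‖a‖) * (opBound * ‖b‖) * (opBound * ‖c‖)) +
      3 * ((opBound * ‖a‖) * (opBound * ‖c‖) * (opBound * ‖b‖) +
        (opBound * ‖a‖) * (opBound * ‖b‖) * (opBound * ‖c‖) +
        (opBound * ‖b‖) * (opBound * ‖a‖) * (opBound * ‖c‖) +
        (opBound * ‖b‖) * (opBound * ‖c‖) * (opBound * ‖a‖) +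
        (opBound * ‖c‖) * (opBound * ‖a‖) * (opBound * ‖b‖) +
        (opBound * ‖c‖) * (opBound * ‖b‖) * (opBound * ‖a‖)) +
      6 * ((opBound * ‖a‖) * (opBound * ‖b‖) * (opBound * ‖c‖)) := by gcongr
    _ = _ := by ring

/-- The cubic nonlinearity in terms of the coefficients. -/
def cubic (a : Coeff) : Coeff := triple a a (conj a)

theorem coef_cubic (a : Coeff) (n : ℕ) :
    coef (fun x => J0 a x * J0 a x * starRingEnd ℂ (J0 a x)) n = cubic a n := by
  rw [cubic, ← coef_triple]
  simp only [J0_conj]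

/-- In every term of the third derivative two factors can be measured in `H¹`. The only term that is
not immediate is the product of three first derivatives: two of them are bounded uniformly and
interpolated by `norm_invD_sq_le`, the third is taken in `L²`. The linear dependence on `‖a‖` is
what carries the bound from `H¹` to `H³`. -/
theorem norm_cubic_le (a : Coeff) :
    ‖cubic a‖ ≤ 27 * opBound ^ 3 * ‖invD (invD a)‖ ^ 2 * ‖a‖ := by
  have hM := opBound_nonneg
  set q := ‖invD (invD a)‖ with hq
  have hq' : ‖invD (invD (conj a))‖ = q := by rw [invD_conj, invD_conj, norm_conj]
  have hq1 : ‖invD (conj a)‖ = ‖invD a‖ := by rw [invD_conj, norm_conj]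
  have k0 := norm_J0_le' a
  have k0' := norm_J0_le' (conj a)
  have k1 := norm_J1_le' a
  have k2 := norm_J2_le' a
  have k2' := norm_J2_le' (conj a)
  have k3 := norm_J3_le' a
  have k3' := norm_J3_le' (conj a)
  have kk := norm_ofBCF_J1_le a
  have kk' := norm_ofBCF_J1_le (conj a)
  rw [hq'] at k0' kk'
  rw [norm_conj] at k2' k3'
  have h1 : ‖J1 a‖ * ‖J1 a‖ ≤ opBound ^ 2 * (‖a‖ * q) := by
    calc ‖J1 a‖ * ‖J1 a‖ ≤ (opBound * ‖invD a‖) * (opBound * ‖invD a‖) := by gcongr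
      _ = opBound ^ 2 * ‖invD a‖ ^ 2 := by ring
      _ ≤ _ := by gcongr; exact norm_invD_sq_le a
  refine (norm_triple_le_sum a a (conj a)).trans ?_
  calc _ ≤ ((opBound * q) * (opBound * q) * (opBound * ‖a‖) +
        (opBound * q) * (opBound * q) * (opBound * ‖a‖) +
        (opBound * q) * (opBound * q) * (opBound * ‖a‖)) +
      3 * ((opBound * ‖a‖) * (opBound * q) * (opBound * q) +
        (opBound * ‖a‖) * (opBound * q) * (opBound * q) +
        (opBound * ‖a‖) * (opBound * q) * (opBound * q) +
        (opBound * ‖a‖) * (opBound * q) * (opBound * q) +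
        (opBound * ‖a‖) * (opBound * q) * (opBound * q) +
        (opBound * ‖a‖) * (opBound * q) * (opBound * q)) +
      6 * ((opBound ^ 2 * (‖a‖ * q)) * (opBound * q)) := by gcongr
    _ = _ := by ring

theorem triple_sub_left (a a' b c : Coeff) :
    triple (a - a') b c = triple a b c - triple a' b c := by
  rw [triple, triple, triple, ← map_sub]
  congr 1
  simp only [tripleThird, map_sub, sub_mul, mul_sub, _root_.sub_apply]
  module

theorem triple_sub_mid (a b b' c : Coeff) :
    triple a (b - b') c = triple a b c - triple a b' c := by
  rw [triple, triple, triple, ← map_sub]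
  congr 1
  simp only [tripleThird, map_sub, sub_mul, mul_sub, _root_.sub_apply]
  module

theorem triple_sub_right (a b c c' : Coeff) :
    triple a b (c - c') = triple a b c - triple a b c' := by
  rw [triple, triple, triple, ← map_sub]
  congr 1
  simp only [tripleThird, map_sub, sub_mul, mul_sub, _root_.sub_apply]
  module

/-- The three factors are exchanged one at a time; each exchange is a trilinear term containing the
difference. -/
theorem norm_cubic_sub_le {R : ℝ} {a b : Coeff} (ha : ‖a‖ ≤ R) (hb : ‖b‖ ≤ R) :
    ‖cubic a - cubic b‖ ≤ 81 * opBound ^ 3 * R ^ 2 * ‖a - b‖ := by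
  have hM := opBound_nonneg
  have hR : 0 ≤ R := (norm_nonneg _).trans ha
  have e : cubic a - cubic b = triple (a - b) a (conj a) + triple b (a - b) (conj a) +
      triple b b (conj (a - b)) := by
    rw [conj_sub, triple_sub_left, triple_sub_mid, triple_sub_right, cubic, cubic]
    abel
  rw [e]
  refine norm_add₃_le.trans ?_
  calc _ ≤ 27 * opBound ^ 3 * (‖a - b‖ * ‖a‖ * ‖conj a‖) +
        27 * opBound ^ 3 * (‖b‖ * ‖a - b‖ * ‖conj a‖) +
        27 * opBound ^ 3 * (‖b‖ * ‖b‖ * ‖conj (a - b)‖) := by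
        gcongr <;> exact norm_triple_le _ _ _
    _ ≤ 27 * opBound ^ 3 * (‖a - b‖ * R * R) + 27 * opBound ^ 3 * (R * ‖a - b‖ * R) +
        27 * opBound ^ 3 * (R * R * ‖a - b‖) := by
        rw [norm_conj, norm_conj]
        gcongr
    _ = _ := by ring

/-- The coordinate function, truncated outside of `[0,1]`. -/
def coordB : ℝ →ᵇ ℂ := BoundedContinuousFunction.ofNormedAddCommGroup
  (fun x => ((max 0 (min x 1) : ℝ) : ℂ)) (by fun_prop) 1 fun x => by
    rw [Complex.norm_real, Real.norm_of_nonneg (le_max_left _ _)]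
    exact max_le zero_le_one (min_le_right _ _)

theorem coordB_apply {x : ℝ} (hx : x ∈ Icc (0 : ℝ) 1) : coordB x = (x : ℂ) := by
  change ((max 0 (min x 1) : ℝ) : ℂ) = _
  rw [min_eq_left hx.2, max_eq_right hx.1]

/-- The bounded part of the multiplication by `x²`. -/
def sqMul : Coeff →L[ℂ] Coeff :=
  ofThird ∘L (L2.mul (coordB * coordB) ∘L J3 +
    (6 : ℂ) • (L2.mul coordB ∘L L2.ofBCF ∘L J2) + (6 : ℂ) • (L2.ofBCF ∘L J1))

/-- The boundary part of the multiplication by `x²`. -/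
def sqBdry : Coeff →L[ℂ] ℂ :=
  (-(8 / (Real.pi : ℂ) ^ 3)) • (BoundedContinuousFunction.evalCLM ℂ 1 ∘L J1)

/-- The second derivative `2ξ + 4xξ' + x²ξ''` vanishes at `0` and equals `4ξ'(1)` at `1`. The
resulting multiple of `(-1)ⁿ` is in general not square summable, so `x²ξ` leaves the space and its
boundary part has to be treated by `hidden`. -/
theorem coef_sq_mul (a : Coeff) (n : ℕ) :
    coef (fun x => (x : ℂ) ^ 2 * J0 a x) n = sqMul a n + (-1) ^ n * sqBdry a := by
  have z := zero_le_one (α := ℝ)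
  have hx : IsPrimitive 0 1 (fun x : ℝ => (x : ℂ)) (fun _ => 1) := IsPrimitive.id z
  have ha0 := isPrimitive_J0 a
  have ha1 := isPrimitive_J1 a
  have ha2 := isPrimitive_J2 a
  have hxx := hx.mul z hx
  have h0 : IsPrimitive 0 1 (fun x : ℝ => (x : ℂ) ^ 2 * J0 a x)
      (fun x : ℝ => 2 * (x * J0 a x) + x * x * J1 a x) :=
    (hxx.mul z ha0).congr z (fun x _ => by ring) fun x _ => by ring
  have h1 : IsPrimitive 0 1 (fun x : ℝ => 2 * (x * J0 a x) + x * x * J1 a x)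
      (fun x : ℝ => 2 * J0 a x + 4 * (x * J1 a x) + x * x * J2 a x) :=
    (((hx.mul z ha0).const_mul z 2).add z (hxx.mul z ha1)).congr_right z fun x _ => by ring
  set g : L2 ℂ 0 1 := L2.mul (coordB * coordB) (J3 a) +
    (6 : ℂ) • L2.mul coordB (L2.ofBCF (J2 a)) + (6 : ℂ) • L2.ofBCF (J1 a) with hg
  have h2 : IsPrimitive 0 1 (fun x : ℝ => 2 * J0 a x + 4 * (x * J1 a x) + x * x * J2 a x) g := by
    refine (((ha0.const_mul z 2).add z ((hx.mul z ha1).const_mul z 4)).add z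
      (hxx.mul z ha2)).congr_ae (L2.intervalIntegrable z _) ?_
    filter_upwards [Lp.coeFn_add (L2.mul (coordB * coordB) (J3 a) +
        (6 : ℂ) • L2.mul coordB (L2.ofBCF (J2 a)) : L2 ℂ 0 1) ((6 : ℂ) • L2.ofBCF (J1 a)),
      Lp.coeFn_add (L2.mul (coordB * coordB) (J3 a))
        ((6 : ℂ) • L2.mul coordB (L2.ofBCF (J2 a)) : L2 ℂ 0 1),
      Lp.coeFn_smul (6 : ℂ) (L2.ofBCF (J1 a) : L2 ℂ 0 1),
      Lp.coeFn_smul (6 : ℂ) (L2.mul coordB (L2.ofBCF (J2 a)) : L2 ℂ 0 1),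
      L2.coeFn_mul (coordB * coordB) (J3 a), L2.coeFn_mul coordB (L2.ofBCF (J2 a) : L2 ℂ 0 1),
      L2.coeFn_ofBCF (J2 a), L2.coeFn_ofBCF (J1 a), ae_restrict_mem measurableSet_Ioo]
      with x h1 h2 h3 h4 h5 h6 h7 h8 hx
    rw [hg, h1, Pi.add_apply, h2, Pi.add_apply, h3, Pi.smul_apply, h4, Pi.smul_apply, h5, h6, h7,
      h8, BoundedContinuousFunction.mul_apply, coordB_apply (Ioo_subset_Icc_self hx), smul_eq_mul,
      smul_eq_mul]
    ring
  rw [coef_eq_ofThird h0 h1 h2 (by simp [J0_zero]) (by simp [J0_one]) (by simp [J0_zero])]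
  have e1 : sqMul a = ofThird g := rfl
  have e2 : sqBdry a = -(8 / (Real.pi : ℂ) ^ 3) * J1 a 1 := rfl
  rw [e1, e2, J0_one, J2_one]
  push_cast
  ring

end Coeff

/-! ### Square integrable functions of time -/

theorem sq_intervalIntegral_le {f : ℝ → ℝ} {t : ℝ} (ht : 0 ≤ t)
    (hf : IntervalIntegrable f volume 0 t)
    (hf2 : IntervalIntegrable (fun s => f s ^ 2) volume 0 t) :
    (∫ s in (0 : ℝ)..t, f s) ^ 2 ≤ t * ∫ s in (0 : ℝ)..t, f s ^ 2 := by
  rcases ht.eq_or_lt with rfl | ht'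
  · simp
  set A := ∫ s in (0 : ℝ)..t, f s with hA
  set B := ∫ s in (0 : ℝ)..t, f s ^ 2 with hB
  -- Cauchy–Schwarz as the nonnegativity of a variance: `A / t` is the mean of `f`.
  have h1 : 0 ≤ ∫ s in (0 : ℝ)..t, (f s - A / t) ^ 2 :=
    intervalIntegral.integral_nonneg ht fun s _ => sq_nonneg _
  have e : ∀ s, (f s - A / t) ^ 2 = f s ^ 2 - 2 * (A / t) * f s + (A / t) ^ 2 := fun s => by ring
  simp_rw [e] at h1
  rw [intervalIntegral.integral_add (hf2.sub (hf.const_mul _)) intervalIntegrable_const,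
    intervalIntegral.integral_sub hf2 (hf.const_mul _), intervalIntegral.integral_const_mul,
    intervalIntegral.integral_const, ← hA, ← hB, smul_eq_mul, sub_zero] at h1
  have h2 : t * (B - 2 * (A / t) * A + t * (A / t) ^ 2) = t * B - A ^ 2 := by
    field_simp; ring
  have h3 := mul_nonneg ht h1
  linarith

section MemLp

variable {X : Type*} [NormedAddCommGroup X] {T : ℝ}

theorem MeasureTheory.MemLp.intervalIntegrable_of_le {f : ℝ → X} (hT : 0 ≤ T)
    (hf : MemLp f 2 ((volume : Measure ℝ).restrict (Ioo 0 T))) {t : ℝ} (ht : t ∈ Icc 0 T) :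
    IntervalIntegrable f volume 0 t := by
  have h : IntervalIntegrable f volume 0 T := by
    rw [intervalIntegrable_iff_integrableOn_Ioo_of_le hT]
    exact hf.integrable (by norm_num)
  refine h.mono_set ?_
  rw [uIcc_of_le ht.1, uIcc_of_le hT]
  exact Icc_subset_Icc_right ht.2

theorem MeasureTheory.MemLp.intervalIntegrable_sq_of_le {f : ℝ → X} (hT : 0 ≤ T)
    (hf : MemLp f 2 ((volume : Measure ℝ).restrict (Ioo 0 T))) {t : ℝ} (ht : t ∈ Icc 0 T) :
    IntervalIntegrable (fun s => ‖f s‖ ^ 2) volume 0 t := by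
  have h : IntervalIntegrable (fun s => ‖f s‖ ^ 2) volume 0 T := by
    rw [intervalIntegrable_iff_integrableOn_Ioo_of_le hT]
    exact (memLp_two_iff_integrable_sq_norm hf.1).1 hf
  refine h.mono_set ?_
  rw [uIcc_of_le ht.1, uIcc_of_le hT]
  exact Icc_subset_Icc_right ht.2

theorem MeasureTheory.AEStronglyMeasurable.comp_continuous_prodMk {X Y : Type*}
    [NormedAddCommGroup X] [NormedAddCommGroup Y] {μ : Measure ℝ} {G : ℝ → X} {q : ℝ × X → Y}
    (hG : AEStronglyMeasurable G μ) (hq : Continuous q) :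
    AEStronglyMeasurable (fun s : ℝ => q (s, G s)) μ :=
  hq.comp_aestronglyMeasurable (continuous_id.aestronglyMeasurable.prodMk hG)

theorem Continuous.memLp_Ioo {f : ℝ → X} (hf : Continuous f) :
    MemLp f 2 ((volume : Measure ℝ).restrict (Ioo 0 T)) := by
  obtain ⟨C, hC⟩ := isCompact_Icc.exists_bound_of_continuousOn (s := Icc 0 T) hf.continuousOn
  refine MemLp.of_bound hf.aestronglyMeasurable C ?_
  filter_upwards [ae_restrict_mem measurableSet_Ioo] with x hx using hC x (Ioo_subset_Icc_self hx)

theorem MeasureTheory.MemLp.smul_continuous [NormedSpace ℂ X] {v : ℝ → ℂ} {f : ℝ → X}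
    (hv : MemLp v 2 ((volume : Measure ℝ).restrict (Ioo 0 T))) (hf : Continuous f) :
    MemLp (fun s => v s • f s) 2 ((volume : Measure ℝ).restrict (Ioo 0 T)) := by
  obtain ⟨C, hC⟩ := isCompact_Icc.exists_bound_of_continuousOn (s := Icc 0 T) hf.continuousOn
  refine hv.of_le_mul (c := C) (hv.1.smul hf.aestronglyMeasurable) ?_
  filter_upwards [ae_restrict_mem measurableSet_Ioo] with x hx
  rw [norm_smul, mul_comm]
  gcongr
  exact hC x (Ioo_subset_Icc_self hx)

end MemLp

/-! ### Gain of regularity by integration in time, and the Duhamel operator -/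

namespace Coeff

/-- A common period of the Schrödinger group. -/
def period (m : ℕ) : ℝ := 2 * (m + 1) / Real.pi

theorem period_pos (m : ℕ) : 0 < period m := by
  have := Real.pi_pos; unfold period; positivity

def expB (n : ℕ) : ℝ →ᵇ ℂ := BoundedContinuousFunction.ofNormedAddCommGroup
  (fun s => (-1) ^ n * Complex.exp (-(omega n * s : ℝ) * Complex.I)) (by fun_prop) 1 fun s => by
    rw [← Complex.ofReal_neg, norm_mul, Complex.norm_exp_ofReal_mul_I]; simp

theorem expB_apply (n : ℕ) (s : ℝ) :
    expB n s = (-1) ^ n * Complex.exp (-(omega n * s : ℝ) * Complex.I) := rfl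

theorem conj_expB (n : ℕ) (s : ℝ) :
    starRingEnd ℂ (expB n s) = (-1) ^ n * Complex.exp (Complex.I * (omega n * s : ℝ)) := by
  rw [expB_apply, map_mul, ← Complex.exp_conj, map_mul, map_neg, Complex.conj_ofReal,
    Complex.conj_I, map_pow, map_neg, map_one]
  congr 2
  ring

/-- All frequencies `π²k²` times the length `2(p+1)/π` are integer multiples of `2π`, so different
exponentials are orthogonal on that interval. The integer `p` serves to make the interval as long as
needed. -/
theorem integral_expB (p m n : ℕ) :
    ∫ s in (0 : ℝ)..period p, expB n s * starRingEnd ℂ (expB m s) =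
      if m = n then (period p : ℂ) else 0 := by
  have hpi := Real.pi_ne_zero
  by_cases h : m = n
  · subst h
    have : ∀ s, expB m s * starRingEnd ℂ (expB m s) = 1 := fun s => by
      rw [conj_expB, expB_apply, mul_mul_mul_comm, ← Complex.exp_add, ← mul_pow]
      rw [mul_comm Complex.I]; simp
    simp [this]
  · rw [if_neg h]
    have e1 : ∀ s : ℝ, expB n s * starRingEnd ℂ (expB m s) = (-1) ^ n * (-1) ^ m *
        Complex.exp (((omega m - omega n : ℝ) : ℂ) * Complex.I * s) := fun s => by
      rw [conj_expB, expB_apply, mul_mul_mul_comm, ← Complex.exp_add]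
      congr 2
      push_cast; ring
    have hne : (((omega m - omega n : ℝ) : ℂ) * Complex.I) ≠ 0 := by
      refine mul_ne_zero ?_ Complex.I_ne_zero
      rw [Ne, Complex.ofReal_eq_zero, sub_eq_zero]
      unfold omega
      intro h2
      have h3 := (sq_eq_sq₀ (mul_pos Real.pi_pos (freq_pos m)).le
        (mul_pos Real.pi_pos (freq_pos n)).le).1 h2
      have h4 := mul_left_cancel₀ hpi h3
      unfold freq at h4
      exact h (by exact_mod_cast add_right_cancel h4)
    simp_rw [e1]
    rw [intervalIntegral.integral_const_mul, integral_exp_mul_complex hne]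
    have e2 : ((omega m - omega n : ℝ) : ℂ) * Complex.I * (period p : ℂ) =
        (((((m + 1) ^ 2 - (n + 1) ^ 2) * (p + 1) : ℤ)) : ℂ) * (2 * Real.pi * Complex.I) := by
      have hpc : (Real.pi : ℂ) ≠ 0 := by exact_mod_cast hpi
      unfold omega period freq
      push_cast
      field_simp
    rw [e2, Complex.exp_int_mul_two_pi_mul_I]
    simp

/-- The normalized exponentials. -/
def expL (p n : ℕ) : L2 ℂ 0 (period p) := ((√(period p))⁻¹ : ℂ) • L2.ofBCF (expB n)

theorem orthonormal_expL (p : ℕ) : Orthonormal ℂ (expL p) := by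
  rw [orthonormal_iff_ite]
  intro m n
  have hp := period_pos p
  have e : inner ℂ (L2.ofBCF (expB m) : L2 ℂ 0 (period p)) (L2.ofBCF (expB n)) =
      if m = n then (period p : ℂ) else 0 := by
    rw [L2.ofBCF, BoundedContinuousFunction.inner_toLp, integral_Ioo_eq hp.le, integral_expB]
  rw [expL, expL, inner_smul_left, inner_smul_right, e, ← Complex.ofReal_inv, Complex.conj_ofReal,
    ← mul_assoc, ← Complex.ofReal_mul, ← mul_inv, Real.mul_self_sqrt hp.le]
  split_ifs
  · rw [← Complex.ofReal_mul, inv_mul_cancel₀ hp.ne', Complex.ofReal_one]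
  · simp

/-- The operator `h ↦ ((-1)ⁿ ∫ exp(iωₙs) h(s) ds)ₙ`, which is bounded from `L²` to `ℓ²`. -/
def hidden (p : ℕ) : L2 ℂ 0 (period p) →L[ℂ] Coeff :=
  (√(period p) : ℂ) • ContinuousLinearMap.adjoint
    (orthonormal_expL p).orthogonalFamily.linearIsometry.toContinuousLinearMap

/-- Bessel's inequality: the adjoint of an isometry is a contraction, and the factor undoes the
normalization of the exponentials. -/
theorem norm_hidden_le (p : ℕ) (f : L2 ℂ 0 (period p)) :
    ‖hidden p f‖ ≤ √(period p) * ‖f‖ := by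
  set S := (orthonormal_expL p).orthogonalFamily.linearIsometry.toContinuousLinearMap with hS
  have h : ‖ContinuousLinearMap.adjoint S‖ ≤ 1 := by
    rw [LinearIsometryEquiv.norm_map]
    exact LinearIsometry.norm_toContinuousLinearMap_le _
  have h1 : hidden p f = (√(period p) : ℂ) • ContinuousLinearMap.adjoint S f := rfl
  rw [h1, norm_smul, Complex.norm_real, Real.norm_of_nonneg (Real.sqrt_nonneg _)]
  gcongr
  simpa using (ContinuousLinearMap.adjoint S).le_of_opNorm_le h f

theorem hidden_apply (p : ℕ) (f : L2 ℂ 0 (period p)) (n : ℕ) :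
    hidden p f n = (-1) ^ n *
      ∫ s in (0 : ℝ)..period p, Complex.exp (Complex.I * (omega n * s : ℝ)) * f s := by
  set S := (orthonormal_expL p).orthogonalFamily.linearIsometry with hS
  have h0 : hidden p f n = (√(period p) : ℂ) *
    (ContinuousLinearMap.adjoint S.toContinuousLinearMap f) n := rfl
  have h1 : inner ℂ (e n) (ContinuousLinearMap.adjoint S.toContinuousLinearMap f) =
      inner ℂ (expL p n) f := by
    rw [ContinuousLinearMap.adjoint_inner_right]
    change inner ℂ (S (e n)) f = _
    rw [e, hS, OrthogonalFamily.linearIsometry_apply_single]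
    simp
  have h2 : inner ℂ (e n) (ContinuousLinearMap.adjoint S.toContinuousLinearMap f) =
      (ContinuousLinearMap.adjoint S.toContinuousLinearMap f) n := by
    rw [e, lp.inner_single_left]; simp
  have hp : (√(period p) : ℂ) ≠ 0 := by
    rw [Ne, Complex.ofReal_eq_zero]; exact (Real.sqrt_pos.2 (period_pos p)).ne'
  rw [h0, ← h2, h1, expL, inner_smul_left, ← Complex.ofReal_inv, Complex.conj_ofReal, L2.inner_def,
    integral_Ioo_eq (period_pos p).le, ← mul_assoc, Complex.ofReal_inv, mul_inv_cancel₀ hp, one_mul,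
    ← intervalIntegral.integral_const_mul]
  refine intervalIntegral_congr_ae_Ioo (period_pos p).le ?_
  filter_upwards [L2.coeFn_ofBCF (expB n)] with s hs
  rw [hs, RCLike.inner_apply, conj_expB]
  ring

open Classical in
/-- The restriction of a function to `(0,t)` as an element of `L²(0,L)`. -/
def cut (p : ℕ) (h : ℝ → ℂ) (t : ℝ) : L2 ℂ 0 (period p) :=
  -- The branch with value `0` only makes the definition total; it is not reached for `h` in
  -- `L²(0,T)` and `t ≤ T`.
  if H : MemLp ((Ioo 0 t).indicator h) 2 ((volume : Measure ℝ).restrict (Ioo 0 (period p)))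
  then H.toLp else 0

section cut

variable {T : ℝ} {p : ℕ} {h h' : ℝ → ℂ}

theorem memLp_cut (hh : MemLp h 2 ((volume : Measure ℝ).restrict (Ioo 0 T))) {t : ℝ}
    (ht : t ≤ T) :
    MemLp ((Ioo 0 t).indicator h) 2 ((volume : Measure ℝ).restrict (Ioo 0 (period p))) := by
  have h1 : MemLp h 2 ((volume : Measure ℝ).restrict (Ioo 0 t)) :=
    hh.mono_measure (Measure.restrict_mono (Ioo_subset_Ioo_right ht) le_rfl)
  exact ((memLp_indicator_iff_restrict measurableSet_Ioo).2 h1).restrict _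

theorem coeFn_cut (hh : MemLp h 2 ((volume : Measure ℝ).restrict (Ioo 0 T))) {t : ℝ}
    (ht : t ≤ T) : ∀ᵐ s ∂(volume : Measure ℝ).restrict (Ioo 0 (period p)),
      cut p h t s = (Ioo 0 t).indicator h s := by
  rw [cut, dif_pos (memLp_cut hh ht)]
  exact (memLp_cut hh ht).coeFn_toLp

theorem hidden_cut (hh : MemLp h 2 ((volume : Measure ℝ).restrict (Ioo 0 T)))
    (hTp : T ≤ period p) {t : ℝ} (ht : t ∈ Icc 0 T) (n : ℕ) :
    hidden p (cut p h t) n = (-1) ^ n *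
      ∫ s in (0 : ℝ)..t, Complex.exp (Complex.I * (omega n * s : ℝ)) * h s := by
  rw [hidden_apply]
  congr 1
  rw [← integral_Ioo_eq (period_pos p).le, ← integral_Ioo_eq ht.1]
  have e1 : ∫ s in Ioo 0 (period p), Complex.exp (Complex.I * (omega n * s : ℝ)) * cut p h t s =
      ∫ s in Ioo 0 (period p), (Ioo 0 t).indicator
        (fun s => Complex.exp (Complex.I * (omega n * s : ℝ)) * h s) s := by
    refine integral_congr_ae ?_
    filter_upwards [coeFn_cut hh ht.2] with s hs
    rw [hs]
    by_cases hs' : s ∈ Ioo 0 t <;> simp [hs']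
  rw [e1, integral_indicator measurableSet_Ioo, Measure.restrict_restrict measurableSet_Ioo,
    inter_eq_left.2 (Ioo_subset_Ioo_right (ht.2.trans hTp))]

/-- The squared distance between two truncations is an increment of the primitive of `‖h‖²`. Both
the continuity of `cut` in `t` and its norm follow from this. -/
theorem norm_cut_sub_sq (hh : MemLp h 2 ((volume : Measure ℝ).restrict (Ioo 0 T)))
    (hTp : T ≤ period p) {t t' : ℝ} (ht : t ∈ Icc 0 T) (ht' : t' ∈ Icc 0 T) (htt : t' ≤ t) :
    ‖cut p h t - cut p h t'‖ ^ 2 = ∫ s in t'..t, ‖h s‖ ^ 2 := by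
  rw [L2.norm_sq_eq]
  have e1 : ∫ s in Ioo 0 (period p), ‖(cut p h t - cut p h t' : L2 ℂ 0 (period p)) s‖ ^ 2 =
      ∫ s in Ioo 0 (period p), (Ico t' t).indicator (fun s => ‖h s‖ ^ 2) s := by
    refine integral_congr_ae ?_
    filter_upwards [coeFn_cut hh ht.2, coeFn_cut hh ht'.2, Lp.coeFn_sub (cut p h t) (cut p h t'),
      ae_restrict_mem measurableSet_Ioo] with s h1 h2 h3 h4
    rw [h3, Pi.sub_apply, h1, h2]
    by_cases hs : s < t'
    · have h5 : s ∈ Ioo 0 t := ⟨h4.1, hs.trans_le htt⟩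
      have h6 : s ∈ Ioo 0 t' := ⟨h4.1, hs⟩
      have h7 : s ∉ Ico t' t := fun h => absurd h.1 (not_le.2 hs)
      simp [h5, h6, h7]
    · have h6 : s ∉ Ioo 0 t' := fun h => hs h.2
      by_cases hs2 : s < t
      · have h5 : s ∈ Ioo 0 t := ⟨h4.1, hs2⟩
        have h7 : s ∈ Ico t' t := ⟨not_lt.1 hs, hs2⟩
        simp [h5, h6, h7]
      · have h5 : s ∉ Ioo 0 t := fun h => hs2 h.2
        have h7 : s ∉ Ico t' t := fun h => hs2 h.2
        simp [h5, h6, h7]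
  rw [e1, integral_indicator measurableSet_Ico, Measure.restrict_restrict measurableSet_Ico,
    intervalIntegral.integral_of_le htt, integral_Ioc_eq_integral_Ioo]
  refine setIntegral_congr_set ?_
  have h1 : (Ioo t' t : Set ℝ) ⊆ Ico t' t ∩ Ioo 0 (period p) := fun s hs =>
    ⟨⟨hs.1.le, hs.2⟩, ht'.1.trans_lt hs.1, hs.2.trans_le (ht.2.trans hTp)⟩
  have h2 : (Ico t' t ∩ Ioo 0 (period p) : Set ℝ) ⊆ Ico t' t := inter_subset_left
  have h3 : (Ico t' t ∩ Ioo 0 (period p) : Set ℝ) ≤ᵐ[volume] (Ioo t' t : Set ℝ) :=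
    (LE.le.eventuallyLE h2).trans (Ioo_ae_eq_Ico (μ := volume)).symm.le
  exact h3.antisymm (LE.le.eventuallyLE h1)

theorem cut_zero (hh : MemLp h 2 ((volume : Measure ℝ).restrict (Ioo 0 T))) (hT : 0 ≤ T) :
    cut p h 0 = 0 := by
  rw [← sub_eq_zero, sub_zero]
  refine Lp.ext ?_
  filter_upwards [coeFn_cut hh hT, Lp.coeFn_zero ℂ 2
    ((volume : Measure ℝ).restrict (Ioo 0 (period p)))] with s h1 h2
  rw [h1, h2]; simp

theorem norm_cut_sq (hh : MemLp h 2 ((volume : Measure ℝ).restrict (Ioo 0 T)))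
    (hTp : T ≤ period p) {t : ℝ} (ht : t ∈ Icc 0 T) :
    ‖cut p h t‖ ^ 2 = ∫ s in (0 : ℝ)..t, ‖h s‖ ^ 2 := by
  have h0 : (0 : ℝ) ∈ Icc 0 T := ⟨le_rfl, ht.1.trans ht.2⟩
  rw [← norm_cut_sub_sq hh hTp ht h0 ht.1, cut_zero hh h0.2, sub_zero]

theorem cut_sub (hh : MemLp h 2 ((volume : Measure ℝ).restrict (Ioo 0 T)))
    (hh' : MemLp h' 2 ((volume : Measure ℝ).restrict (Ioo 0 T))) {t : ℝ} (ht : t ≤ T) :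
    cut p h t - cut p h' t = cut p (fun s => h s - h' s) t := by
  refine Lp.ext ?_
  filter_upwards [coeFn_cut hh ht, coeFn_cut hh' ht, coeFn_cut (hh.sub hh') ht,
    Lp.coeFn_sub (cut p h t) (cut p h' t)] with s h1 h2 h3 h4
  have h5 : (fun s => h s - h' s) = h - h' := rfl
  rw [h4, Pi.sub_apply, h1, h2, h5, h3]
  by_cases hs : s ∈ Ioo 0 t <;> simp [hs]

theorem continuousOn_cut (hh : MemLp h 2 ((volume : Measure ℝ).restrict (Ioo 0 T)))
    (hTp : T ≤ period p) (hT : 0 ≤ T) : ContinuousOn (cut p h) (Icc 0 T) := by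
  have hi : IntervalIntegrable (fun s => ‖h s‖ ^ 2) volume 0 T :=
    hh.intervalIntegrable_sq_of_le hT ⟨hT, le_rfl⟩
  have hP : ContinuousOn (fun t => ∫ s in (0 : ℝ)..t, ‖h s‖ ^ 2) (Icc 0 T) := by
    have := intervalIntegral.continuousOn_primitive_interval (a := 0) (b := T) (μ := volume)
      (f := fun s => ‖h s‖ ^ 2) (by
        rw [uIcc_of_le hT, integrableOn_Icc_iff_integrableOn_Ioc]; exact hi.1)
    rwa [uIcc_of_le hT] at this
  have key : ∀ t ∈ Icc 0 T, ∀ t' ∈ Icc 0 T, ‖cut p h t - cut p h t'‖ ^ 2 =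
      |(∫ s in (0 : ℝ)..t, ‖h s‖ ^ 2) - ∫ s in (0 : ℝ)..t', ‖h s‖ ^ 2| := by
    have aux : ∀ t ∈ Icc 0 T, ∀ t' ∈ Icc 0 T, t' ≤ t → ‖cut p h t - cut p h t'‖ ^ 2 =
      |(∫ s in (0 : ℝ)..t, ‖h s‖ ^ 2) - ∫ s in (0 : ℝ)..t', ‖h s‖ ^ 2| := by
      intro t ht t' ht' htt
      rw [norm_cut_sub_sq hh hTp ht ht' htt, intervalIntegral.integral_interval_sub_left
        (hh.intervalIntegrable_sq_of_le hT ht) (hh.intervalIntegrable_sq_of_le hT ht'),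
        abs_of_nonneg (intervalIntegral.integral_nonneg htt fun _ _ => by positivity)]
    intro t ht t' ht'
    rcases le_total t' t with h1 | h1
    · exact aux t ht t' ht' h1
    · rw [norm_sub_rev, abs_sub_comm]; exact aux t' ht' t ht h1
  intro t ht
  rw [ContinuousWithinAt, tendsto_iff_norm_sub_tendsto_zero]
  have h1 : Tendsto (fun t' => √|(∫ s in (0 : ℝ)..t', ‖h s‖ ^ 2) - ∫ s in (0 : ℝ)..t, ‖h s‖ ^ 2|)
      (𝓝[Icc 0 T] t) (𝓝 0) := by
    have h2 : Tendsto (fun t' => ∫ s in (0 : ℝ)..t', ‖h s‖ ^ 2) (𝓝[Icc 0 T] t)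
      (𝓝 (∫ s in (0 : ℝ)..t, ‖h s‖ ^ 2)) := hP t ht
    have h3 := ((h2.sub_const (∫ s in (0 : ℝ)..t, ‖h s‖ ^ 2)).abs).sqrt
    rwa [sub_self, abs_zero, Real.sqrt_zero] at h3
  refine h1.congr' ?_
  filter_upwards [self_mem_nhdsWithin] with t' ht'
  rw [← key t' ht' t ht, Real.sqrt_sq (norm_nonneg _)]

end cut

/-- The Duhamel integral in the interaction picture. -/
def duhamel (p : ℕ) (G : ℝ → Coeff) (h : ℝ → ℂ) (t : ℝ) : Coeff :=
  (∫ s in (0 : ℝ)..t, group s (G s)) + hidden p (cut p h t)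

section duhamel

variable {T : ℝ} {p : ℕ} {G G' : ℝ → Coeff} {h h' : ℝ → ℂ}

theorem memLp_group (hG : MemLp G 2 ((volume : Measure ℝ).restrict (Ioo 0 T))) :
    MemLp (fun s => group s (G s)) 2 ((volume : Measure ℝ).restrict (Ioo 0 T)) := by
  exact hG.of_le (hG.1.comp_continuous_prodMk continuous_group) (Eventually.of_forall fun s => (norm_group s (G s)).le)

theorem continuousOn_duhamel (hT : 0 ≤ T) (hTp : T ≤ period p)
    (hG : MemLp G 2 ((volume : Measure ℝ).restrict (Ioo 0 T)))
    (hh : MemLp h 2 ((volume : Measure ℝ).restrict (Ioo 0 T))) :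
    ContinuousOn (duhamel p G h) (Icc 0 T) := by
  refine ContinuousOn.add ?_ ((hidden p).continuous.comp_continuousOn (continuousOn_cut hh hTp hT))
  have hi := (memLp_group hG).intervalIntegrable_of_le hT ⟨hT, le_rfl⟩
  have := intervalIntegral.continuousOn_primitive_interval (a := 0) (b := T) (μ := volume)
    (f := fun s => group s (G s)) (by
      rw [uIcc_of_le hT, integrableOn_Icc_iff_integrableOn_Ioc]; exact hi.1)
  rwa [uIcc_of_le hT] at this

theorem duhamel_sub (hT : 0 ≤ T)
    (hG : MemLp G 2 ((volume : Measure ℝ).restrict (Ioo 0 T)))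
    (hh : MemLp h 2 ((volume : Measure ℝ).restrict (Ioo 0 T)))
    (hG' : MemLp G' 2 ((volume : Measure ℝ).restrict (Ioo 0 T)))
    (hh' : MemLp h' 2 ((volume : Measure ℝ).restrict (Ioo 0 T))) {t : ℝ} (ht : t ∈ Icc 0 T) :
    duhamel p G h t - duhamel p G' h' t =
      duhamel p (fun s => G s - G' s) (fun s => h s - h' s) t := by
  simp only [duhamel, map_sub]
  rw [intervalIntegral.integral_sub ((memLp_group hG).intervalIntegrable_of_le hT ht)
    ((memLp_group hG').intervalIntegrable_of_le hT ht), ← cut_sub hh hh' ht.2, map_sub]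
  abel

/-- Identifies the operator form, needed for estimates in `ℓ²`, with the scalar integrals that
define mild solutions. -/
theorem duhamel_apply (hT : 0 ≤ T) (hTp : T ≤ period p)
    (hG : MemLp G 2 ((volume : Measure ℝ).restrict (Ioo 0 T)))
    (hh : MemLp h 2 ((volume : Measure ℝ).restrict (Ioo 0 T))) {t : ℝ} (ht : t ∈ Icc 0 T)
    (n : ℕ) : duhamel p G h t n = ∫ s in (0 : ℝ)..t,
      Complex.exp (Complex.I * (omega n * s : ℝ)) * (G s n + (-1) ^ n * h s) := by
  have hi := (memLp_group hG).intervalIntegrable_of_le hT ht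
  have e1 : (∫ s in (0 : ℝ)..t, group s (G s)) n = ∫ s in (0 : ℝ)..t, group s (G s) n :=
    ((lp.evalCLM ℂ (fun _ : ℕ => ℂ) 2 n).intervalIntegral_comp_comm hi).symm
  have hi1 : IntervalIntegrable (fun s => group s (G s) n) volume 0 t := by
    refine ⟨?_, ?_⟩
    · exact (lp.evalCLM ℂ (fun _ : ℕ => ℂ) 2 n).integrable_comp hi.1
    · exact (lp.evalCLM ℂ (fun _ : ℕ => ℂ) 2 n).integrable_comp hi.2
  have hi2 : IntervalIntegrable (fun s => Complex.exp (Complex.I * (omega n * s : ℝ)) * h s)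
      volume 0 t := (hh.intervalIntegrable_of_le hT ht).continuousOn_mul
        (by fun_prop)
  rw [duhamel, add_apply, e1, hidden_cut hh hTp ht, ← intervalIntegral.integral_const_mul,
    ← intervalIntegral.integral_add hi1 (hi2.const_mul _)]
  refine intervalIntegral.integral_congr fun s _ => ?_
  simp only [group_apply]
  ring

/-- Cauchy–Schwarz in time for the regular part, Bessel's inequality for the boundary part. Only
`L²` norms in time occur, which is all that is known about `V`. -/
theorem norm_duhamel_sq_le (hT : 0 ≤ T) (hTp : T ≤ period p)
    (hG : MemLp G 2 ((volume : Measure ℝ).restrict (Ioo 0 T)))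
    (hh : MemLp h 2 ((volume : Measure ℝ).restrict (Ioo 0 T))) {t : ℝ} (ht : t ∈ Icc 0 T) :
    ‖duhamel p G h t‖ ^ 2 ≤ 2 * T * (∫ s in (0 : ℝ)..t, ‖G s‖ ^ 2) +
      2 * period p * ∫ s in (0 : ℝ)..t, ‖h s‖ ^ 2 := by
  have h1 : ‖∫ s in (0 : ℝ)..t, group s (G s)‖ ^ 2 ≤ T * ∫ s in (0 : ℝ)..t, ‖G s‖ ^ 2 := by
    have h2 : ‖∫ s in (0 : ℝ)..t, group s (G s)‖ ≤ ∫ s in (0 : ℝ)..t, ‖G s‖ := by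
      refine (intervalIntegral.norm_integral_le_integral_norm ht.1).trans (le_of_eq ?_)
      simp only [norm_group]
    have hn : 0 ≤ ∫ s in (0 : ℝ)..t, ‖G s‖ ^ 2 :=
      intervalIntegral.integral_nonneg ht.1 fun _ _ => by positivity
    calc _ ≤ (∫ s in (0 : ℝ)..t, ‖G s‖) ^ 2 := by gcongr
      _ ≤ t * ∫ s in (0 : ℝ)..t, ‖G s‖ ^ 2 := sq_intervalIntegral_le ht.1
        (hG.intervalIntegrable_of_le hT ht).norm (hG.intervalIntegrable_sq_of_le hT ht)
      _ ≤ _ := by gcongr; exact ht.2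
  have h3 : ‖hidden p (cut p h t)‖ ^ 2 ≤ period p * ∫ s in (0 : ℝ)..t, ‖h s‖ ^ 2 := by
    calc _ ≤ (√(period p) * ‖cut p h t‖) ^ 2 := by gcongr; exact norm_hidden_le _ _
      _ = _ := by rw [mul_pow, Real.sq_sqrt (period_pos p).le, norm_cut_sq hh hTp ht]
  calc _ ≤ (‖∫ s in (0 : ℝ)..t, group s (G s)‖ + ‖hidden p (cut p h t)‖) ^ 2 := by
        gcongr; exact norm_add_le _ _
    _ ≤ 2 * (‖∫ s in (0 : ℝ)..t, group s (G s)‖ ^ 2 + ‖hidden p (cut p h t)‖ ^ 2) := add_sq_le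
    _ ≤ 2 * (T * (∫ s in (0 : ℝ)..t, ‖G s‖ ^ 2) + period p * ∫ s in (0 : ℝ)..t, ‖h s‖ ^ 2) := by
        gcongr
    _ = _ := by ring

/-- A pointwise bound by `(1 + |V|) y` becomes an integral of `y²` against a weight that is
integrable because `V` is square integrable. This is the form needed for the Volterra fixed point
and for Gronwall's inequality. -/
theorem norm_duhamel_sq_le_weight {V y : ℝ → ℝ} {K : ℝ} (hT : 0 ≤ T) (hTp : T ≤ period p)
    (hG : MemLp G 2 ((volume : Measure ℝ).restrict (Ioo 0 T)))
    (hh : MemLp h 2 ((volume : Measure ℝ).restrict (Ioo 0 T)))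
    (hV : MemLp V 2 ((volume : Measure ℝ).restrict (Ioo 0 T))) {t : ℝ} (ht : t ∈ Icc 0 T)
    (hy : ContinuousOn y (Icc 0 t))
    (hGy : ∀ s ∈ Icc 0 t, ‖G s‖ ≤ K * (1 + |V s|) * y s)
    (hhy : ∀ s ∈ Icc 0 t, ‖h s‖ ≤ K * (1 + |V s|) * y s) :
    ‖duhamel p G h t‖ ^ 2 ≤
      ∫ s in (0 : ℝ)..t, 4 * K ^ 2 * (T + period p) * (1 + V s ^ 2) * y s ^ 2 := by
  have hp := period_pos p
  have hVi := hV.intervalIntegrable_sq_of_le hT ht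
  simp only [Real.norm_eq_abs, sq_abs] at hVi
  have hw : IntervalIntegrable (fun s => 2 * K ^ 2 * ((1 + V s ^ 2) * y s ^ 2)) volume 0 t :=
    ((intervalIntegrable_const.add hVi).mul_continuousOn (by
      rw [uIcc_of_le ht.1]; exact hy.pow 2)).const_mul _
  have key : ∀ {Y : Type} [NormedAddCommGroup Y] (f : ℝ → Y),
      MemLp f 2 ((volume : Measure ℝ).restrict (Ioo 0 T)) →
      (∀ s ∈ Icc 0 t, ‖f s‖ ≤ K * (1 + |V s|) * y s) →
      ∫ s in (0 : ℝ)..t, ‖f s‖ ^ 2 ≤ ∫ s in (0 : ℝ)..t, 2 * K ^ 2 * ((1 + V s ^ 2) * y s ^ 2) := by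
    intro Y _ f hf hfy
    refine intervalIntegral.integral_mono_on ht.1 (hf.intervalIntegrable_sq_of_le hT ht) hw
      fun s hs => ?_
    calc ‖f s‖ ^ 2 ≤ (K * (1 + |V s|) * y s) ^ 2 := by gcongr; exact hfy s hs
      _ = K ^ 2 * (1 + |V s|) ^ 2 * y s ^ 2 := by ring
      _ ≤ K ^ 2 * (2 * (1 ^ 2 + |V s| ^ 2)) * y s ^ 2 := by gcongr; exact add_sq_le
      _ = _ := by rw [sq_abs]; ring
  refine (norm_duhamel_sq_le hT hTp hG hh ht).trans ?_
  calc _ ≤ 2 * T * (∫ s in (0 : ℝ)..t, 2 * K ^ 2 * ((1 + V s ^ 2) * y s ^ 2)) +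
        2 * period p * ∫ s in (0 : ℝ)..t, 2 * K ^ 2 * ((1 + V s ^ 2) * y s ^ 2) := by
        gcongr
        · exact key G hG hGy
        · exact key h hh hhy
    _ = _ := by
        rw [← add_mul, ← intervalIntegral.integral_const_mul]
        refine intervalIntegral.integral_congr fun s _ => ?_
        ring

end duhamel

end Coeff

/-! ### The gauge-transformed equation and its mild solutions -/

/-- A control `u` with `L²` derivative `du`, vanishing at the ends of `[0,T]`, and the coefficient
`ε` of the nonlinearity. -/
structure Control (T : ℝ) where
  u : ℝ → ℝ
  du : ℝ → ℝ
  ε : ℝ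
  T_pos : 0 < T
  cont : Continuous u
  memLp : MemLp du 2 ((volume : Measure ℝ).restrict (Ioo 0 T))
  prim : IsPrimitive 0 T u du
  left : u 0 = 0
  right : u T = 0

namespace Control

open Coeff

variable {T : ℝ} (c : Control T)

/-- The quadratic potential that the gauge transform produces. -/
def V (s : ℝ) : ℝ := (c.du s - c.u s ^ 2) / 4

def U (t : ℝ) : ℝ := ∫ s in (0 : ℝ)..t, c.u s

/-- The weight of the nonlinearity after the gauge transform. -/
def g (t : ℝ) : ℝ := Real.exp (c.U t)

theorem hasDerivAt_U (t : ℝ) : HasDerivAt c.U (c.u t) t :=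
  intervalIntegral.integral_hasDerivAt_right (c.cont.intervalIntegrable _ _)
    (c.cont.stronglyMeasurableAtFilter _ _) c.cont.continuousAt

theorem continuous_U : Continuous c.U :=
  continuous_iff_continuousAt.2 fun t => (c.hasDerivAt_U t).continuousAt

theorem U_zero : c.U 0 = 0 := by simp [U]

theorem continuous_g : Continuous c.g := Real.continuous_exp.comp c.continuous_U

theorem g_pos (t : ℝ) : 0 < c.g t := Real.exp_pos _

theorem hasDerivAt_g (t : ℝ) : HasDerivAt c.g (c.g t * c.u t) t := (c.hasDerivAt_U t).exp

theorem memLp_V : MemLp c.V 2 ((volume : Measure ℝ).restrict (Ioo 0 T)) := by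
  have h := (c.memLp.sub ((c.cont.pow 2).memLp_Ioo (T := T))).const_mul (4⁻¹ : ℝ)
  refine h.ae_eq (Eventually.of_forall fun s => ?_)
  simp [V]; ring

theorem memLp_V_ofReal : MemLp (fun s => (c.V s : ℂ)) 2
    ((volume : Measure ℝ).restrict (Ioo 0 T)) := c.memLp_V.ofReal

theorem intervalIntegrable_V {t : ℝ} (ht : t ∈ Icc 0 T) : IntervalIntegrable c.V volume 0 t :=
  c.memLp_V.intervalIntegrable_of_le c.T_pos.le ht

theorem exists_g_bound : ∃ C, 0 ≤ C ∧ ∀ t ∈ Icc 0 T, c.g t ≤ C ∧ |c.u t| ≤ C := by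
  obtain ⟨C, hC⟩ := isCompact_Icc.exists_bound_of_continuousOn (s := Icc 0 T)
    c.continuous_g.continuousOn
  obtain ⟨D, hD⟩ := isCompact_Icc.exists_bound_of_continuousOn (s := Icc 0 T)
    c.cont.continuousOn
  refine ⟨max 0 (max C D), le_max_left _ _, fun t ht => ⟨?_, ?_⟩⟩
  · exact ((le_abs_self _).trans (hC t ht)).trans ((le_max_left _ _).trans (le_max_right _ _))
  · exact (hD t ht).trans ((le_max_right _ _).trans (le_max_right _ _))

/-- The index of a period of the Schrödinger group that exceeds `T`. -/
def per (T : ℝ) : ℕ := ⌈2 * T⌉₊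

/-- As `π ≤ 4`, the index `⌈2T⌉` is large enough. -/
theorem le_period (T : ℝ) : T ≤ period (per T) := by
  have h1 : 2 * T ≤ (per T : ℝ) := Nat.le_ceil _
  have h0 : (0 : ℝ) ≤ per T := Nat.cast_nonneg _
  have h2 := Real.pi_le_four
  rw [period, le_div_iff₀ Real.pi_pos]
  rcases le_or_gt 0 T with h | h
  · nlinarith
  · nlinarith [Real.pi_pos]

/-- The regular part of the forcing. -/
def forceReg (N : Coeff → Coeff) (a : ℝ → Coeff) (s : ℝ) : Coeff :=
  (-Complex.I * (c.V s : ℂ)) • sqMul (a s) + (Complex.I * ((c.ε * c.g s : ℝ) : ℂ)) • N (a s)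

/-- The boundary part of the forcing. -/
def forceBdry (a : ℝ → Coeff) (s : ℝ) : ℂ := -Complex.I * (c.V s : ℂ) * sqBdry (a s)

/-- The coefficients of the forcing. -/
def force (N : Coeff → Coeff) (a : ℝ → Coeff) (n : ℕ) (s : ℝ) : ℂ :=
  c.forceReg N a s n + (-1) ^ n * c.forceBdry a s

/-- Mild solutions on `[0,t₁]`, mode by mode. -/
def IsMild (N : Coeff → Coeff) (a₀ : Coeff) (a : ℝ → Coeff) (t₁ : ℝ) : Prop :=
  ∀ t ∈ Icc 0 t₁, ∀ n, Complex.exp (Complex.I * (omega n * t : ℝ)) * a t n =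
    a₀ n + ∫ s in (0 : ℝ)..t, Complex.exp (Complex.I * (omega n * s : ℝ)) * c.force N a n s

variable {N : Coeff → Coeff} {a b : ℝ → Coeff} {a₀ : Coeff}

theorem memLp_forceReg (hN : Continuous N) (ha : Continuous a) :
    MemLp (c.forceReg N a) 2 ((volume : Measure ℝ).restrict (Ioo 0 T)) := by
  have h1 : Continuous fun s => (Complex.I * ((c.ε * c.g s : ℝ) : ℂ)) • N (a s) :=
    (continuous_const.mul (Complex.continuous_ofReal.comp
      (continuous_const.mul c.continuous_g))).smul (hN.comp ha)
  exact ((c.memLp_V_ofReal.const_mul (-Complex.I)).smul_continuous (sqMul.continuous.comp ha)).add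
    h1.memLp_Ioo

theorem memLp_forceBdry (ha : Continuous a) :
    MemLp (c.forceBdry a) 2 ((volume : Measure ℝ).restrict (Ioo 0 T)) :=
  (c.memLp_V_ofReal.const_mul (-Complex.I)).smul_continuous (sqBdry.continuous.comp ha)

def opNorms : ℝ := ‖sqMul‖ + ‖sqBdry‖

theorem norm_sqMul_le (a : Coeff) : ‖sqMul a‖ ≤ opNorms * ‖a‖ :=
  (sqMul.le_opNorm a).trans (by gcongr; unfold opNorms; linarith [norm_nonneg sqBdry])

theorem norm_sqBdry_le (a : Coeff) : ‖sqBdry a‖ ≤ opNorms * ‖a‖ :=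
  (sqBdry.le_opNorm a).trans (by gcongr; unfold opNorms; linarith [norm_nonneg sqMul])

theorem opNorms_nonneg : 0 ≤ opNorms := by unfold opNorms; positivity

theorem norm_coeff_V (s : ℝ) : ‖-Complex.I * (c.V s : ℂ)‖ = |c.V s| := by simp

theorem norm_coeff_g (s : ℝ) : ‖Complex.I * ((c.ε * c.g s : ℝ) : ℂ)‖ = |c.ε| * c.g s := by
  rw [norm_mul, Complex.norm_I, one_mul, Complex.norm_real, Real.norm_eq_abs, abs_mul,
    abs_of_pos (c.g_pos s)]

theorem norm_comb_le {C L y s : ℝ} {x z : Coeff} (hL : 0 ≤ L) (hg : c.g s ≤ C)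
    (hx : ‖x‖ ≤ opNorms * y) (hz : ‖z‖ ≤ L * y) (hy : 0 ≤ y) :
    ‖(-Complex.I * (c.V s : ℂ)) • x + (Complex.I * ((c.ε * c.g s : ℝ) : ℂ)) • z‖ ≤
      (opNorms + |c.ε| * C * L) * (1 + |c.V s|) * y := by
  have h0 := opNorms_nonneg
  have hC : 0 ≤ C := (c.g_pos s).le.trans hg
  calc _ ≤ |c.V s| * ‖x‖ + |c.ε| * c.g s * ‖z‖ := by
        refine (norm_add_le _ _).trans (le_of_eq ?_)
        rw [norm_smul, norm_smul, norm_coeff_V, norm_coeff_g]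
    _ ≤ |c.V s| * (opNorms * y) + |c.ε| * C * (L * y) := by gcongr
    _ ≤ |c.V s| * (opNorms * y) + |c.ε| * C * (L * y) +
        (opNorms * y + |c.V s| * (|c.ε| * C * (L * y))) := le_add_of_nonneg_right (by positivity)
    _ = _ := by ring

theorem norm_bdry_le {s y K : ℝ} {a : Coeff} (hy : ‖a‖ ≤ y) (hK : 0 ≤ K) :
    ‖-Complex.I * (c.V s : ℂ) * sqBdry a‖ ≤ (opNorms + K) * (1 + |c.V s|) * y := by
  have h0 := opNorms_nonneg
  have hy0 : 0 ≤ y := (norm_nonneg _).trans hy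
  rw [norm_mul, norm_coeff_V]
  calc _ ≤ |c.V s| * (opNorms * y) := by
        gcongr; exact (norm_sqBdry_le a).trans (by gcongr)
    _ ≤ |c.V s| * (opNorms * y) + (opNorms * y + K * (1 + |c.V s|) * y) :=
        le_add_of_nonneg_right (by positivity)
    _ = _ := by ring

/-- The weight of the Gronwall and contraction estimates. -/
def weight (K s : ℝ) : ℝ := 4 * K ^ 2 * (T + period (per T)) * (1 + c.V s ^ 2)

theorem weight_nonneg (K s : ℝ) : 0 ≤ c.weight K s := by
  have := c.T_pos
  have := period_pos (per T)
  unfold weight; positivity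

theorem intervalIntegrable_weight (K : ℝ) : IntervalIntegrable (c.weight K) volume 0 T := by
  have h := c.memLp_V.intervalIntegrable_sq_of_le c.T_pos.le ⟨c.T_pos.le, le_rfl⟩
  simp only [Real.norm_eq_abs, sq_abs] at h
  exact (intervalIntegrable_const.add h).const_mul _

/-- A fixed point for the unknown in the interaction picture. Since the group acts by isometries,
Lipschitz bounds on the forcing carry over unchanged and give the hypothesis of
`exists_volterra_fixedPoint`. -/
theorem exists_mild {L : ℝ} (hL : 0 ≤ L) (hN : ∀ a b, ‖N a - N b‖ ≤ L * ‖a - b‖) (a₀ : Coeff) :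
    ∃ a : ℝ → Coeff, Continuous a ∧ c.IsMild N a₀ a T := by
  have hNc : Continuous N := (LipschitzWith.of_dist_le_mul (K := ⟨L, hL⟩) fun a b => by
    rw [dist_eq_norm, dist_eq_norm]; exact hN a b).continuous
  obtain ⟨C, hC0, hC⟩ := c.exists_g_bound
  set K := opNorms + |c.ε| * C * L with hK
  have hT := c.T_pos.le
  -- `d` is the solution with the free evolution removed, and `A d` restores it.
  set A : (ℝ → Coeff) → ℝ → Coeff := fun d s => group (-s) (d s) with hA
  have hAc : ∀ d, Continuous d → Continuous (A d) := fun d hd =>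
    continuous_group.comp (continuous_neg.prodMk hd)
  obtain ⟨d, hd, hfix⟩ := exists_volterra_fixedPoint hT (c.intervalIntegrable_weight K)
    (fun d t => a₀ + duhamel (per T) (c.forceReg N (A d)) (c.forceBdry (A d)) t)
    (fun d hd => continuousOn_const.add (continuousOn_duhamel hT (le_period T)
      (c.memLp_forceReg hNc (hAc d hd)) (c.memLp_forceBdry (hAc d hd)))) (by
    intro d d' hd hd' t ht
    rw [add_sub_add_left_eq_sub, duhamel_sub hT (c.memLp_forceReg hNc (hAc d hd))
      (c.memLp_forceBdry (hAc d hd)) (c.memLp_forceReg hNc (hAc d' hd'))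
      (c.memLp_forceBdry (hAc d' hd')) ht]
    have hn : ∀ s, ‖A d s - A d' s‖ = ‖d s - d' s‖ := fun s => by
      rw [hA]; simp only; rw [← map_sub, norm_group]
    refine (norm_duhamel_sq_le_weight (K := K) (V := c.V) (y := fun s => ‖d s - d' s‖) hT
      (le_period T)
      ((c.memLp_forceReg hNc (hAc d hd)).sub (c.memLp_forceReg hNc (hAc d' hd')))
      ((c.memLp_forceBdry (hAc d hd)).sub (c.memLp_forceBdry (hAc d' hd'))) c.memLp_V ht
      (hd.sub hd').norm.continuousOn ?_ ?_).trans (le_of_eq ?_)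
    · intro s hs
      have e : c.forceReg N (A d) s - c.forceReg N (A d') s =
          (-Complex.I * (c.V s : ℂ)) • sqMul (A d s - A d' s) +
          (Complex.I * ((c.ε * c.g s : ℝ) : ℂ)) • (N (A d s) - N (A d' s)) := by
        rw [forceReg, forceReg, map_sub, smul_sub, smul_sub]; abel
      rw [Pi.sub_apply, e]
      refine c.norm_comb_le hL (hC s ⟨hs.1, hs.2.trans ht.2⟩).1 ?_ ?_ (norm_nonneg _)
      · rw [← hn]; exact norm_sqMul_le _
      · rw [← hn]; exact hN _ _
    · intro s hs
      have e : c.forceBdry (A d) s - c.forceBdry (A d') s =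
          -Complex.I * (c.V s : ℂ) * sqBdry (A d s - A d' s) := by
        rw [forceBdry, forceBdry, map_sub, mul_sub]
      rw [Pi.sub_apply, e]
      exact c.norm_bdry_le (hn s).le (by positivity)
    · refine intervalIntegral.integral_congr fun s _ => ?_
      rw [abs_of_nonneg (c.weight_nonneg K s), weight])
  refine ⟨A d, hAc d hd, fun t ht n => ?_⟩
  have h1 := congrArg (fun x : Coeff => x n) (hfix t ht)
  simp only at h1
  rw [Coeff.add_apply, duhamel_apply hT (le_period T) (c.memLp_forceReg hNc (hAc d hd))
    (c.memLp_forceBdry (hAc d hd)) ht] at h1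
  rw [← group_apply t (A d t) n, hA]
  simp only
  rw [group_group_neg, ← h1]
  rfl

section mild

variable {t₁ : ℝ}

theorem IsMild.zero (h : c.IsMild N a₀ a t₁) (ht₁ : 0 ≤ t₁) : a 0 = a₀ := by
  ext n
  simpa using h 0 ⟨le_rfl, ht₁⟩ n

theorem IsMild.mono (h : c.IsMild N a₀ a T) (ht : t₁ ≤ T) : c.IsMild N a₀ a t₁ :=
  fun t ht' => h t ⟨ht'.1, ht'.2.trans ht⟩

/-- Only the values of the nonlinearity along the trajectory matter, so a cutoff may be dropped as
long as it is inactive there. -/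
theorem IsMild.congr {N' : Coeff → Coeff} (h : c.IsMild N a₀ a t₁)
    (hN : ∀ t ∈ Icc 0 t₁, N (a t) = N' (a t)) : c.IsMild N' a₀ a t₁ := by
  intro t ht n
  rw [h t ht n]
  congr 1
  refine intervalIntegral.integral_congr fun s hs => ?_
  rw [uIcc_of_le ht.1] at hs
  simp only [force, forceReg, hN s ⟨hs.1, hs.2.trans ht.2⟩]

theorem IsMild.group_eq (h : c.IsMild N a₀ a t₁) (ht₁ : t₁ ≤ T) (hN : Continuous N)
    (ha : Continuous a) {t : ℝ} (ht : t ∈ Icc 0 t₁) :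
    group t (a t) = a₀ + duhamel (per T) (c.forceReg N a) (c.forceBdry a) t := by
  ext n
  rw [Coeff.add_apply, duhamel_apply c.T_pos.le (le_period T) (c.memLp_forceReg hN ha)
    (c.memLp_forceBdry ha) ⟨ht.1, ht.2.trans ht₁⟩, group_apply, h t ht n]
  rfl

/-- The linear bound on the nonlinearity is required along the trajectory only. The cubic term
satisfies it once the `H¹` norm is under control. -/
theorem IsMild.norm_sq_le {L C : ℝ} (h : c.IsMild N a₀ a t₁) (ht₁ : t₁ ≤ T) (hL : 0 ≤ L)
    (hC0 : 0 ≤ C) (hC : ∀ t ∈ Icc 0 T, c.g t ≤ C)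
    (hN : Continuous N) (ha : Continuous a) (hNa : ∀ t ∈ Icc 0 t₁, ‖N (a t)‖ ≤ L * ‖a t‖)
    {t : ℝ} (ht : t ∈ Icc 0 t₁) :
    ‖a t‖ ^ 2 ≤ 2 * ‖a₀‖ ^ 2 +
      ∫ s in (0 : ℝ)..t, |2 * c.weight (opNorms + |c.ε| * C * L) s| * ‖a s‖ ^ 2 := by
  have hT := c.T_pos.le
  have h1 := norm_duhamel_sq_le_weight (K := opNorms + |c.ε| * C * L) (V := c.V)
    (y := fun s => ‖a s‖) hT (le_period T) (c.memLp_forceReg hN ha) (c.memLp_forceBdry ha)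
    c.memLp_V ⟨ht.1, ht.2.trans ht₁⟩ ha.norm.continuousOn
    (fun s hs => c.norm_comb_le hL (hC s ⟨hs.1, hs.2.trans (ht.2.trans ht₁)⟩) (norm_sqMul_le _)
      (hNa s ⟨hs.1, hs.2.trans ht.2⟩) (norm_nonneg _))
    (fun s hs => c.norm_bdry_le le_rfl (by positivity))
  calc ‖a t‖ ^ 2 = ‖a₀ + duhamel (per T) (c.forceReg N a) (c.forceBdry a) t‖ ^ 2 := by
        rw [← norm_group t (a t), IsMild.group_eq c h ht₁ hN ha ht]
    _ ≤ (‖a₀‖ + ‖duhamel (per T) (c.forceReg N a) (c.forceBdry a) t‖) ^ 2 := by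
        gcongr; exact norm_add_le _ _
    _ ≤ 2 * (‖a₀‖ ^ 2 + ‖duhamel (per T) (c.forceReg N a) (c.forceBdry a) t‖ ^ 2) := add_sq_le
    _ ≤ 2 * (‖a₀‖ ^ 2 + ∫ s in (0 : ℝ)..t, c.weight (opNorms + |c.ε| * C * L) s * ‖a s‖ ^ 2) := by
        gcongr; exact h1
    _ = _ := by
        rw [mul_add, ← intervalIntegral.integral_const_mul]
        congr 1
        refine intervalIntegral.integral_congr fun s _ => ?_
        rw [abs_of_nonneg (mul_nonneg zero_le_two (c.weight_nonneg _ s))]; ring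

/-- Each mode of a mild solution is absolutely continuous. -/
theorem IsMild.isPrimitive (h : c.IsMild N a₀ a t₁) (h0 : 0 ≤ t₁) (ht₁ : t₁ ≤ T)
    (hN : Continuous N) (ha : Continuous a) (n : ℕ) :
    IsPrimitive 0 t₁ (fun t => a t n)
      (fun t => -Complex.I * (omega n : ℂ) * a t n + c.force N a n t) := by
  have hev : Continuous fun x : Coeff => x n := (lp.evalCLM ℂ (fun _ : ℕ => ℂ) 2 n).continuous
  have hF : MemLp (c.force N a n) 2 ((volume : Measure ℝ).restrict (Ioo 0 T)) :=
    ((lp.evalCLM ℂ (fun _ : ℕ => ℂ) 2 n).comp_memLp' (c.memLp_forceReg hN ha)).add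
      ((c.memLp_forceBdry ha).const_mul _)
  have hi : IntervalIntegrable (fun s => Complex.exp (Complex.I * (omega n * s : ℝ)) *
      c.force N a n s) volume 0 t₁ :=
    (hF.intervalIntegrable_of_le c.T_pos.le ⟨h0, ht₁⟩).continuousOn_mul (by fun_prop)
  have h1 : IsPrimitive 0 t₁ (fun t => Complex.exp (Complex.I * (omega n * t : ℝ)) * a t n)
      (fun s => Complex.exp (Complex.I * (omega n * s : ℝ)) * c.force N a n s) := by
    refine ⟨hi, fun t ht => ?_⟩
    have h2 := h 0 ⟨le_rfl, h0⟩ n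
    rw [intervalIntegral.integral_same, add_zero] at h2
    rw [h t ht n, h2]
  -- The mode is recovered as a product with the inverse exponential, and the product rule supplies
  -- the term `-iωₙaₙ`.
  have h2 : IsPrimitive 0 t₁ (fun t : ℝ => Complex.exp (-Complex.I * (omega n : ℂ) * t))
      (fun t => -Complex.I * (omega n : ℂ) * 1 *
        Complex.exp (-Complex.I * (omega n : ℂ) * t)) :=
    ((IsPrimitive.id (𝕜 := ℂ) h0).const_mul h0 (-Complex.I * (omega n : ℂ))).cexp h0
  have e : ∀ t : ℝ, Complex.exp (-Complex.I * (omega n : ℂ) * t) *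
      Complex.exp (Complex.I * (omega n * t : ℝ)) = 1 := fun t => by
    rw [← Complex.exp_add]; push_cast; ring_nf; simp
  refine (h2.mul h0 h1).congr h0 (fun t _ => ?_) (fun t _ => ?_)
  · rw [← mul_assoc, e, one_mul]
  · linear_combination (-Complex.I * (omega n : ℂ) * a t n + c.force N a n t) * e t

end mild

end Control

/-! ### From the modes to the equation at every point -/

/-- Termwise integration of a series of primitives. -/
theorem IsPrimitive.hasSum {𝕜 : Type} [RCLike 𝕜] {a b : ℝ} {F F' : ℕ → ℝ → 𝕜} {G G' : ℝ → 𝕜}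
    {bound : ℝ → ℝ} (hab : a ≤ b) (h : ∀ n, IsPrimitive a b (F n) (F' n))
    (hF : ∀ t ∈ Icc a b, HasSum (fun n => F n t) (G t))
    (hF' : ∀ s ∈ Ioo a b, HasSum (fun n => F' n s) (G' s))
    (hbi : IntervalIntegrable bound volume a b)
    (hb : ∀ N : ℕ, ∀ s ∈ Ioo a b, ‖∑ n ∈ Finset.range N, F' n s‖ ≤ bound s) :
    IsPrimitive a b G G' := by
  have hlim : ∀ᵐ s ∂(volume : Measure ℝ).restrict (Ioo a b),
      Tendsto (fun N : ℕ => ∑ n ∈ Finset.range N, F' n s) atTop (𝓝 (G' s)) := by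
    filter_upwards [ae_restrict_mem measurableSet_Ioo] with s hs
    exact (hF' s hs).tendsto_sum_nat
  have hsum : ∀ N : ℕ, IntervalIntegrable (fun s => ∑ n ∈ Finset.range N, F' n s) volume a b :=
    fun N => by
      have := IntervalIntegrable.sum (Finset.range N) (f := F') fun n _ => (h n).integrable
      simpa [Finset.sum_fn] using this
  have hi : IntervalIntegrable G' volume a b := by
    rw [intervalIntegrable_iff_integrableOn_Ioo_of_le hab] at hbi ⊢
    refine Integrable.mono' hbi (aestronglyMeasurable_of_tendsto_ae atTop (fun N => ?_) hlim) ?_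
    · have := hsum N
      rw [intervalIntegrable_iff_integrableOn_Ioo_of_le hab] at this
      exact this.1
    · filter_upwards [hlim, ae_restrict_mem measurableSet_Ioo] with s h1 hs
      exact le_of_tendsto h1.norm (Eventually.of_forall fun N => hb N s hs)
  refine ⟨hi, fun t ht => ?_⟩
  have hsub : Ioo a t ⊆ Ioo a b := Ioo_subset_Ioo_right ht.2
  have hat : uIcc a t ⊆ uIcc a b := by
    rw [uIcc_of_le ht.1, uIcc_of_le hab]; exact Icc_subset_Icc_right ht.2
  have key : Tendsto (fun N : ℕ => ∫ s in a..t, ∑ n ∈ Finset.range N, F' n s) atTop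
      (𝓝 (∫ s in a..t, G' s)) := by
    simp only [← integral_Ioo_eq ht.1]
    refine tendsto_integral_of_dominated_convergence bound (fun N => ?_) ?_ (fun N => ?_) ?_
    · have := (hsum N).mono_set hat
      rw [intervalIntegrable_iff_integrableOn_Ioo_of_le ht.1] at this
      exact this.1
    · have := hbi.mono_set hat
      rwa [intervalIntegrable_iff_integrableOn_Ioo_of_le ht.1] at this
    · filter_upwards [ae_restrict_mem measurableSet_Ioo] with s hs using hb N s (hsub hs)
    · exact ae_mono (Measure.restrict_mono hsub le_rfl) hlim
  refine tendsto_nhds_unique (hF t ht).tendsto_sum_nat ?_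
  refine ((hF a ⟨le_rfl, hab⟩).tendsto_sum_nat.add key).congr fun N => ?_
  rw [intervalIntegral.integral_finsetSum fun n _ => (h n).integrable.mono_set hat,
    ← Finset.sum_add_distrib]
  exact Finset.sum_congr rfl fun n _ => ((h n).eq t ht).symm

/-- Integration of a family of primitives with respect to a parameter. -/
theorem IsPrimitive.integral {F r : ℝ → ℝ → ℝ} {b : ℝ}
    (h : ∀ x ∈ Icc (0 : ℝ) 1, IsPrimitive 0 b (fun t => F t x) (fun t => r t x))
    (hF : Continuous (F 0)) (hr : Continuous fun p : ℝ × ℝ => r p.1 p.2) :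
    IsPrimitive 0 b (fun t => ∫ x in (0 : ℝ)..1, F t x) (fun t => ∫ x in (0 : ℝ)..1, r t x) := by
  have hc : Continuous fun t => ∫ x in (0 : ℝ)..1, r t x :=
    intervalIntegral.continuous_parametric_intervalIntegral_of_continuous' hr 0 1
  refine ⟨hc.intervalIntegrable _ _, fun t ht => ?_⟩
  have h1 : ∫ x in (0 : ℝ)..1, F t x = ∫ x in (0 : ℝ)..1, (F 0 x + ∫ s in (0 : ℝ)..t, r s x) := by
    refine intervalIntegral.integral_congr fun x hx => ?_
    rw [uIcc_of_le zero_le_one] at hx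
    exact (h x hx).eq t ht
  have hc2 : Continuous fun x => ∫ s in (0 : ℝ)..t, r s x :=
    intervalIntegral.continuous_parametric_intervalIntegral_of_continuous'
      (f := fun x s => r s x) (hr.comp continuous_swap) 0 t
  rw [h1, intervalIntegral.integral_add (hF.intervalIntegrable _ _)
    (hc2.intervalIntegrable _ _)]
  congr 1
  -- The space and time integrals are exchanged by Fubini's theorem on a compact rectangle.
  simp only [intervalIntegral.integral_of_le ht.1, intervalIntegral.integral_of_le zero_le_one]
  refine integral_integral_swap (f := fun x s => r s x) ?_
  have : IntegrableOn (fun p : ℝ × ℝ => r p.2 p.1) (Icc 0 1 ×ˢ Icc 0 t) (volume.prod volume) :=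
    (hr.comp continuous_swap).continuousOn.integrableOn_compact (isCompact_Icc.prod isCompact_Icc)
  rw [Measure.prod_restrict]
  exact this.mono_set (prod_mono Ioc_subset_Icc_self Ioc_subset_Icc_self)

namespace Coeff

theorem norm_cube_inv_mul_le (n : ℕ) (x : ℝ) (z : ℂ) :
    ‖(((freq n)⁻¹ : ℝ) : ℂ) ^ 3 * z * sinB n x‖ ≤ ‖z‖ * ‖invFreq n‖ ^ 2 := by
  have h1 : ‖sinB n x‖ ≤ 1 := (sinB n).norm_coe_le_norm x |>.trans (norm_sinB_le n)
  have h2 := norm_inv_freq_le n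
  rw [norm_mul, norm_mul, norm_pow, invFreq_apply]
  set r := ‖(((freq n)⁻¹ : ℝ) : ℂ)‖
  have hr : 0 ≤ r := norm_nonneg _
  calc r ^ 3 * ‖z‖ * ‖sinB n x‖ ≤ (r ^ 2 * 1) * ‖z‖ * 1 := by
        rw [pow_succ]; gcongr
    _ = _ := by ring

theorem hasSum_J0 (a : Coeff) (x : ℝ) :
    HasSum (fun n => (((freq n)⁻¹ : ℝ) : ℂ) ^ 3 * a n * sinB n x) (J0 a x) := by
  refine (hasSum_sinSeries (invD (invD a)) x).congr_fun fun n => ?_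
  simp only [invD_apply]; ring

theorem hasSum_of_coef {f : ℝ → ℂ} (hf : ContinuousOn f (Icc 0 1)) (hl : f 0 = 0) (hr : f 1 = 0)
    {C : ℝ} (hC : ∀ n, ‖coef f n‖ ≤ C) {x : ℝ} (hx : x ∈ Icc (0 : ℝ) 1) :
    HasSum (fun n => (((freq n)⁻¹ : ℝ) : ℂ) ^ 3 * coef f n * sinB n x) (f x) := by
  have e : ∀ n, coef f n / (freq n : ℂ) ^ 3 = (((freq n)⁻¹ : ℝ) : ℂ) ^ 3 * coef f n := fun n => by
    push_cast; rw [inv_pow, div_eq_inv_mul]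
  have hs : Summable fun n => ‖coef f n / (freq n : ℂ) ^ 3‖ := by
    refine Summable.of_nonneg_of_le (fun n => norm_nonneg _) (fun n => ?_)
      ((summable_norm_sq invFreq).mul_left C)
    rw [e, norm_mul, norm_pow, invFreq_apply]
    have h2 := norm_inv_freq_le n
    set r := ‖(((freq n)⁻¹ : ℝ) : ℂ)‖
    have hr0 : 0 ≤ r := norm_nonneg _
    calc r ^ 3 * ‖coef f n‖ ≤ (r ^ 2 * 1) * C := by rw [pow_succ]; gcongr; exact hC n
      _ = _ := by ring
  refine (hasSum_sine hf hl hr hs hx).congr_fun fun n => ?_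
  rw [e]

theorem norm_sum_cube_le {z : ℕ → ℂ} {C : ℝ} (hC : ∀ n, ‖z n‖ ≤ C) (x : ℝ) (N : ℕ) :
    ‖∑ n ∈ Finset.range N, (((freq n)⁻¹ : ℝ) : ℂ) ^ 3 * z n * sinB n x‖ ≤ C * ‖invFreq‖ ^ 2 := by
  have hC0 : 0 ≤ C := (norm_nonneg _).trans (hC 0)
  calc _ ≤ ∑ n ∈ Finset.range N, C * ‖invFreq n‖ ^ 2 :=
        norm_sum_le_of_le _ fun n _ => (norm_cube_inv_mul_le n x _).trans (by gcongr; exact hC n)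
    _ = C * ∑ n ∈ Finset.range N, ‖invFreq n‖ ^ 2 := by rw [Finset.mul_sum]
    _ ≤ _ := by
        gcongr
        exact sum_le_hasSum _ (fun _ _ => by positivity) (hasSum_norm_sq invFreq)

/-- The integral against a bounded continuous function. -/
def pairing (F : ℝ →ᵇ ℂ) : (ℝ →ᵇ ℂ) →L[ℂ] ℂ :=
  (L2.integralTo 1 : L2 ℂ 0 1 →L[ℂ] ℂ) ∘L (L2.mul F ∘L L2.ofBCF)

theorem pairing_apply (F G : ℝ →ᵇ ℂ) : pairing F G = ∫ x in (0 : ℝ)..1, F x * G x := by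
  have h : pairing F G = L2.integralTo 1 (L2.mul F (L2.ofBCF G) : L2 ℂ 0 1) := rfl
  rw [h, L2.integralTo_apply ⟨zero_le_one, le_rfl⟩]
  refine intervalIntegral_congr_ae_Ioo zero_le_one ?_
  filter_upwards [L2.coeFn_mul F (L2.ofBCF G : L2 ℂ 0 1), L2.coeFn_ofBCF (a := 0) (b := 1) G]
    with x h1 h2
  rw [h1, h2]

/-- Parseval for the pairing of a forcing with `ξ''`: the weight `k³` in `coef` and the factor `1/k`
in the series of `ξ''` leave `k⁻⁴`. The kinetic energy carries the same weight, so the sum of its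
modewise derivatives becomes an integral in `x`. -/
theorem hasSum_pairing (F : ℝ →ᵇ ℂ) (b : Coeff) :
    HasSum (fun n => (((freq n)⁻¹ : ℝ) : ℂ) ^ 4 * (starRingEnd ℂ (b n) * coef F n))
      (-(2 / (Real.pi : ℂ) ^ 2) * ∫ x in (0 : ℝ)..1, F x * starRingEnd ℂ (J2 b x)) := by
  have hpi : (Real.pi : ℂ) ≠ 0 := by exact_mod_cast Real.pi_ne_zero
  have h := ((hasSum_series invFreq sinB norm_sinB_le (conj b)).mapL (pairing F)).mul_left 2
  have e : ∫ x in (0 : ℝ)..1, F x * starRingEnd ℂ (J2 b x) =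
      -(Real.pi : ℂ) ^ 2 * pairing F (sinSeries (conj b)) := by
    rw [pairing_apply, ← intervalIntegral.integral_const_mul]
    refine intervalIntegral.integral_congr fun x _ => ?_
    rw [J2_eval, sinSeries_conj, map_mul, map_neg, map_pow, Complex.conj_ofReal]; ring
  have e2 : -(2 / (Real.pi : ℂ) ^ 2) * (-(Real.pi : ℂ) ^ 2 * pairing F (sinSeries (conj b))) =
      2 * pairing F (sinSeries (conj b)) := by field_simp
  rw [e, e2]
  refine h.congr_fun fun n => ?_
  rw [map_smul, pairing_apply, coef, invFreq_apply, conj_apply, smul_eq_mul]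
  have h3 := invFreq_mul_freq n
  have h4 : (((freq n)⁻¹ : ℝ) : ℂ) ^ 3 * (freq n : ℂ) ^ 3 = 1 := by rw [← mul_pow, h3, one_pow]
  linear_combination (2 * (((freq n)⁻¹ : ℝ) : ℂ) * starRingEnd ℂ (b n) *
    ∫ x in (0 : ℝ)..1, F x * sinB n x) * h4

theorem continuous_uncurry {X : Type*} [TopologicalSpace X] {f : X → ℝ →ᵇ ℂ}
    (hf : Continuous f) : Continuous fun p : X × ℝ => f p.1 p.2 :=
  continuous_eval.comp
    ((hf.comp continuous_fst).prodMk continuous_snd)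

end Coeff

namespace Control

open Coeff

variable {T : ℝ} (c : Control T) {a : ℝ → Coeff} {a₀ : Coeff} {t₁ : ℝ}

/-- The forcing as a function of the space variable. -/
def forceB (a : ℝ → Coeff) (s : ℝ) : ℝ →ᵇ ℂ :=
  (-Complex.I * (c.V s : ℂ)) • (coordB * coordB * J0 (a s)) +
    (Complex.I * ((c.ε * c.g s : ℝ) : ℂ)) • (J0 (a s) * J0 (a s) * J0 (conj (a s)))

theorem forceB_eval (s x : ℝ) : c.forceB a s x =
    -Complex.I * (c.V s : ℂ) * (coordB x * coordB x * J0 (a s) x) +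
      Complex.I * ((c.ε * c.g s : ℝ) : ℂ) * (J0 (a s) x * J0 (a s) x * J0 (conj (a s)) x) := rfl

theorem forceB_apply (s : ℝ) {x : ℝ} (hx : x ∈ Icc (0 : ℝ) 1) : c.forceB a s x =
    -Complex.I * (c.V s : ℂ) * ((x : ℂ) ^ 2 * J0 (a s) x) +
      Complex.I * ((c.ε * c.g s : ℝ) : ℂ) *
        (J0 (a s) x * J0 (a s) x * starRingEnd ℂ (J0 (a s) x)) := by
  rw [forceB_eval, coordB_apply hx, J0_conj, ← sq]

/-- The bridge between the equation for the coefficients and the equation in the space variable. -/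
theorem coef_forceB (s : ℝ) (n : ℕ) : coef (c.forceB a s) n = c.force cubic a n s := by
  have h1 := coef_sq_mul (a s) n
  have h2 := coef_cubic (a s) n
  have h3 : coef (c.forceB a s) n =
      -Complex.I * (c.V s : ℂ) * coef (fun x => (x : ℂ) ^ 2 * J0 (a s) x) n +
      Complex.I * ((c.ε * c.g s : ℝ) : ℂ) *
        coef (fun x => J0 (a s) x * J0 (a s) x * starRingEnd ℂ (J0 (a s) x)) n := by
    have e : ∫ x in (0 : ℝ)..1, c.forceB a s x * sinB n x = ∫ x in (0 : ℝ)..1,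
        ((-Complex.I * (c.V s : ℂ)) * ((x : ℂ) ^ 2 * J0 (a s) x * sinB n x) +
        (Complex.I * ((c.ε * c.g s : ℝ) : ℂ)) *
          (J0 (a s) x * J0 (a s) x * starRingEnd ℂ (J0 (a s) x) * sinB n x)) := by
      refine intervalIntegral.integral_congr fun x hx => ?_
      rw [uIcc_of_le zero_le_one] at hx
      rw [forceB_apply c s hx]; ring
    have hJ := (J0 (a s)).continuous
    have hS := (sinB n).continuous
    have hx : Continuous fun x : ℝ => (x : ℂ) := Complex.continuous_ofReal
    have hcj : Continuous fun x : ℝ => starRingEnd ℂ (J0 (a s) x) := Complex.continuous_conj.comp hJ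
    have i1 : IntervalIntegrable (fun x : ℝ => -Complex.I * (c.V s : ℂ) *
        ((x : ℂ) ^ 2 * J0 (a s) x * sinB n x)) volume 0 1 :=
      (continuous_const.mul (((hx.pow 2).mul hJ).mul hS)).intervalIntegrable _ _
    have i2 : IntervalIntegrable (fun x : ℝ => Complex.I * ((c.ε * c.g s : ℝ) : ℂ) *
        (J0 (a s) x * J0 (a s) x * starRingEnd ℂ (J0 (a s) x) * sinB n x)) volume 0 1 :=
      (continuous_const.mul (((hJ.mul hJ).mul hcj).mul hS)).intervalIntegrable _ _
    rw [coef, coef, coef, e, intervalIntegral.integral_add i1 i2,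
      intervalIntegral.integral_const_mul, intervalIntegral.integral_const_mul]
    ring
  rw [h3, h1, h2, force, forceReg, Coeff.add_apply, Coeff.smul_apply, Coeff.smul_apply, forceBdry]
  ring

/-- A bound on the coefficients of the forcing. -/
def forceBound (a : ℝ → Coeff) (s : ℝ) : ℝ :=
  2 * (|c.V s| * (opNorms * ‖a s‖)) + |c.ε| * c.g s * ‖cubic (a s)‖

theorem norm_force_le (n : ℕ) (s : ℝ) : ‖c.force cubic a n s‖ ≤ c.forceBound a s := by
  have h1 : ‖c.forceReg cubic a s n‖ ≤
      |c.V s| * (opNorms * ‖a s‖) + |c.ε| * c.g s * ‖cubic (a s)‖ := by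
    refine (norm_apply_le _ n).trans ((norm_add_le _ _).trans ?_)
    rw [norm_smul, norm_smul, norm_coeff_V, norm_coeff_g]
    gcongr
    exact norm_sqMul_le _
  have h2 : ‖(-1) ^ n * c.forceBdry a s‖ ≤ |c.V s| * (opNorms * ‖a s‖) := by
    rw [norm_mul, norm_pow, norm_neg, norm_one, one_pow, one_mul, forceBdry, norm_mul,
      norm_coeff_V]
    gcongr
    exact norm_sqBdry_le _
  calc _ ≤ _ := norm_add_le _ _
    _ ≤ _ := add_le_add h1 h2
    _ = _ := by unfold forceBound; ring

theorem continuous_cubic : Continuous cubic := by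
  rw [continuous_iff_continuousAt]
  intro a
  have h0 := opBound_nonneg
  rw [ContinuousAt, tendsto_iff_norm_sub_tendsto_zero]
  have h1 : Tendsto (fun b : Coeff => 81 * opBound ^ 3 * (‖a‖ + 1) ^ 2 * ‖b - a‖) (𝓝 a) (𝓝 0) := by
    have : Continuous fun b : Coeff => 81 * opBound ^ 3 * (‖a‖ + 1) ^ 2 * ‖b - a‖ := by fun_prop
    simpa using this.tendsto a
  refine squeeze_zero' (Eventually.of_forall fun b => norm_nonneg _) ?_ h1
  filter_upwards [Metric.ball_mem_nhds a one_pos] with b hb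
  rw [mem_ball_iff_norm] at hb
  refine norm_cubic_sub_le ?_ (by linarith)
  have := norm_le_norm_add_norm_sub' b a
  linarith

theorem intervalIntegrable_forceBound (ha : Continuous a) (h0 : 0 ≤ t₁) (ht₁ : t₁ ≤ T) :
    IntervalIntegrable (c.forceBound a) volume 0 t₁ := by
  have hV := (c.intervalIntegrable_V ⟨h0, ht₁⟩).abs
  have h1 : Continuous fun s => |c.ε| * c.g s * ‖cubic (a s)‖ :=
    (continuous_const.mul c.continuous_g).mul (continuous_cubic.comp ha).norm
  exact ((hV.mul_continuousOn (continuous_const.mul ha.norm).continuousOn).const_mul 2).add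
    (h1.intervalIntegrable _ _)

/-- The equation holds at every point, in integrated form. -/
theorem IsMild.isPrimitive_J0 (h : c.IsMild cubic a₀ a t₁) (h0 : 0 ≤ t₁) (ht₁ : t₁ ≤ T)
    (ha : Continuous a) {x : ℝ} (hx : x ∈ Icc (0 : ℝ) 1) :
    IsPrimitive 0 t₁ (fun t => J0 (a t) x)
      (fun t => Complex.I * J2 (a t) x + c.forceB a t x) := by
  have hp := h.isPrimitive c h0 ht₁ continuous_cubic ha
  have hJ : ∀ s, HasSum (fun n => (((freq n)⁻¹ : ℝ) : ℂ) ^ 3 *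
      -- Here `k⁻³ ωₙ = π² k⁻¹`, so the free evolution of the modes sums to `iξ''`.
      (-Complex.I * (omega n : ℂ) * a s n) * sinB n x) (Complex.I * J2 (a s) x) := fun s => by
    have h1 := (hasSum_sinSeries (a s) x).mul_left (Complex.I * -(Real.pi : ℂ) ^ 2)
    rw [J2_eval, ← mul_assoc]
    refine h1.congr_fun fun n => ?_
    have h3 := invFreq_mul_freq n
    rw [invD_apply, omega]
    push_cast at h3 ⊢
    linear_combination (-Complex.I * (Real.pi : ℂ) ^ 2 * (freq n : ℂ)⁻¹ * a s n * sinB n x) *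
      ((freq n : ℂ)⁻¹ * (freq n : ℂ) + 1) * h3
  refine IsPrimitive.hasSum (bound := fun s => Real.pi ^ 2 * (‖invFreq‖ * ‖a s‖) +
      c.forceBound a s * ‖invFreq‖ ^ 2) h0
    (fun n => (hp n).const_mul h0 ((((freq n)⁻¹ : ℝ) : ℂ) ^ 3 * sinB n x)) (fun t _ => ?_)
    (fun s _ => ?_) ?_ (fun N s _ => ?_)
  · exact (hasSum_J0 (a t) x).congr_fun fun n => by ring
  -- The weighted coefficients of the forcing need only be bounded: the factor `k⁻³` makes the
  -- series absolutely convergent, and the forcing vanishes at both ends.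
  · have h2 := hasSum_of_coef (f := c.forceB a s) (C := c.forceBound a s)
      (c.forceB a s).continuous.continuousOn
      (by rw [forceB_apply c s ⟨le_rfl, zero_le_one⟩, J0_zero]; simp)
      (by rw [forceB_apply c s ⟨zero_le_one, le_rfl⟩, J0_one]; simp)
      (fun n => by rw [coef_forceB]; exact c.norm_force_le n s) hx
    refine ((hJ s).add h2).congr_fun fun n => ?_
    rw [coef_forceB]; ring
  · exact ((continuous_const.mul (continuous_const.mul ha.norm)).intervalIntegrable _ _).add
      ((c.intervalIntegrable_forceBound ha h0 ht₁).mul_const _)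
  · have e : ∑ n ∈ Finset.range N, (((freq n)⁻¹ : ℝ) : ℂ) ^ 3 * sinB n x *
        (-Complex.I * (omega n : ℂ) * a s n + c.force cubic a n s) =
        (∑ n ∈ Finset.range N, (((freq n)⁻¹ : ℝ) : ℂ) ^ 3 *
          (-Complex.I * (omega n : ℂ) * a s n) * sinB n x) +
        ∑ n ∈ Finset.range N, (((freq n)⁻¹ : ℝ) : ℂ) ^ 3 * c.force cubic a n s * sinB n x := by
      rw [← Finset.sum_add_distrib]
      exact Finset.sum_congr rfl fun n _ => by ring
    rw [e]
    refine (norm_add_le _ _).trans (add_le_add ?_ ?_)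
    · have h5 := mul_summable invFreq (a s)
      calc _ ≤ ∑ n ∈ Finset.range N, Real.pi ^ 2 * (‖invFreq n‖ * ‖a s n‖) := by
            refine norm_sum_le_of_le _ fun n _ => ?_
            have h1 : ‖sinB n x‖ ≤ 1 := (sinB n).norm_coe_le_norm x |>.trans (norm_sinB_le n)
            have h3 := invFreq_mul_freq n
            have e3 : (((freq n)⁻¹ : ℝ) : ℂ) ^ 3 * (-Complex.I * (omega n : ℂ) * a s n) * sinB n x =
                -Complex.I * (Real.pi : ℂ) ^ 2 * (invFreq n * a s n) * sinB n x := by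
              rw [invFreq_apply, omega]
              push_cast at h3 ⊢
              linear_combination (-Complex.I * (Real.pi : ℂ) ^ 2 * (freq n : ℂ)⁻¹ * a s n *
                sinB n x) * ((freq n : ℂ)⁻¹ * (freq n : ℂ) + 1) * h3
            rw [e3, norm_mul, norm_mul, norm_mul, norm_neg, Complex.norm_I, one_mul, norm_pow,
              Complex.norm_real, Real.norm_of_nonneg Real.pi_pos.le, norm_mul]
            exact mul_le_of_le_one_right (by positivity) h1
        _ = Real.pi ^ 2 * ∑ n ∈ Finset.range N, ‖invFreq n‖ * ‖a s n‖ := by rw [Finset.mul_sum]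
        _ ≤ _ := by
            gcongr
            exact (h5.1.sum_le_tsum _ (fun _ _ => by positivity)).trans h5.2
    · exact norm_sum_cube_le (fun n => c.norm_force_le n s) x N

end Control

/-! ### Mass, kinetic energy and the quartic term: estimates at fixed time -/

theorem intervalIntegral_re {f : ℝ → ℂ} {a b : ℝ} (hf : IntervalIntegrable f volume a b) :
    (∫ x in a..b, f x).re = ∫ x in a..b, (f x).re :=
  (Complex.reCLM.intervalIntegral_comp_comm hf).symm

theorem intervalIntegral_im {f : ℝ → ℂ} {a b : ℝ} (hf : IntervalIntegrable f volume a b) :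
    (∫ x in a..b, f x).im = ∫ x in a..b, (f x).im :=
  (Complex.imCLM.intervalIntegral_comp_comm hf).symm

theorem Continuous.comp_path {X Y Z : Type*} [TopologicalSpace X] [TopologicalSpace Y]
    [TopologicalSpace Z] {f : X → Y → Z} (hf : Continuous fun p : X × Y => f p.1 p.2)
    {W : Type*} [TopologicalSpace W] {a : W → X} (ha : Continuous a) :
    Continuous fun p : W × Y => f (a p.1) p.2 :=
  hf.comp ((ha.comp continuous_fst).prodMk continuous_snd)

namespace Coeff

/-- The density `|ξ|²`. -/
def dens (b : Coeff) (x : ℝ) : ℝ := ‖J0 b x‖ ^ 2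

/-- The time derivative of the density along the flow. -/
def cur (b : Coeff) (x : ℝ) : ℝ := -2 * (J2 b x * starRingEnd ℂ (J0 b x)).im

def mass (b : Coeff) : ℝ := ∫ x in (0 : ℝ)..1, dens b x

def quart (b : Coeff) : ℝ := ∫ x in (0 : ℝ)..1, dens b x * dens b x

/-- The time derivative of `quart` along the flow. -/
def quartCur (b : Coeff) : ℝ := ∫ x in (0 : ℝ)..1, (cur b x * dens b x + dens b x * cur b x)

/-- Equal to `‖ξ'‖²` by `kin_eq`. Written in coefficients, it can be differentiated in time mode by
mode. -/
def kin (b : Coeff) : ℝ := Real.pi ^ 2 / 2 * ‖invD (invD b)‖ ^ 2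

/-- The quantity through which the potential `V x²` changes the kinetic energy. -/
def virial (b : Coeff) : ℝ := (∫ x in (0 : ℝ)..1, (x : ℂ) ^ 2 * J0 b x * starRingEnd ℂ (J2 b x)).im

theorem dens_nonneg (b : Coeff) (x : ℝ) : 0 ≤ dens b x := by unfold dens; positivity

theorem mass_nonneg (b : Coeff) : 0 ≤ mass b :=
  intervalIntegral.integral_nonneg zero_le_one fun x _ => dens_nonneg b x

theorem quart_nonneg (b : Coeff) : 0 ≤ quart b :=
  intervalIntegral.integral_nonneg zero_le_one fun _ _ => mul_self_nonneg _

theorem kin_nonneg (b : Coeff) : 0 ≤ kin b := by unfold kin; positivity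

theorem continuous_dens_uncurry : Continuous fun p : Coeff × ℝ => dens p.1 p.2 :=
  (continuous_uncurry J0.continuous).norm.pow 2

theorem continuous_cur_uncurry : Continuous fun p : Coeff × ℝ => cur p.1 p.2 :=
  continuous_const.mul (Complex.continuous_im.comp ((continuous_uncurry J2.continuous).mul
    (Complex.continuous_conj.comp (continuous_uncurry J0.continuous))))

theorem continuous_dens (b : Coeff) : Continuous (dens b) := (J0 b).continuous.norm.pow 2

theorem kin_eq (b : Coeff) : kin b = ∫ x in (0 : ℝ)..1, ‖J1 b x‖ ^ 2 := by
  rw [kin, ← norm_ofBCF_J1_sq, L2.norm_sq_eq, integral_Ioo_eq zero_le_one]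
  refine intervalIntegral_congr_ae_Ioo zero_le_one ?_
  filter_upwards [L2.coeFn_ofBCF (a := 0) (b := 1) (J1 b)] with x hx
  rw [hx]

/-- After an integration by parts the integrand is `|ξ'|²`, which has no imaginary part. -/
theorem integral_cur (b : Coeff) : ∫ x in (0 : ℝ)..1, cur b x = 0 := by
  have h := IsPrimitive.integral_mul_eq_sub zero_le_one (isPrimitive_J1 b) (isPrimitive_J0 b).star
  rw [J0_zero, J0_one] at h
  have c1 : Continuous fun x => J2 b x * starRingEnd ℂ (J0 b x) :=
    (J2 b).continuous.mul (Complex.continuous_conj.comp (J0 b).continuous)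
  have c2 : Continuous fun x => J1 b x * starRingEnd ℂ (J1 b x) :=
    (J1 b).continuous.mul (Complex.continuous_conj.comp (J1 b).continuous)
  have h2 := congrArg Complex.im h
  simp only [map_zero, mul_zero, sub_self, zero_sub, Complex.neg_im] at h2
  rw [intervalIntegral_im (c1.intervalIntegrable _ _),
    intervalIntegral_im (c2.intervalIntegrable _ _)] at h2
  simp only [Complex.mul_conj, Complex.ofReal_im, intervalIntegral.integral_zero, neg_zero] at h2
  simp only [cur]
  rw [intervalIntegral.integral_const_mul, h2, mul_zero]

/-- An integration by parts removes `ξ''`. The term `x²|ξ'|²` is real and drops out, and `2x Im(ξ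
ξ̄')` is left. -/
theorem abs_virial_le (b : Coeff) : |virial b| ≤ mass b + kin b := by
  have hx : Continuous fun x : ℝ => (x : ℂ) := Complex.continuous_ofReal
  have hp : IsPrimitive 0 1 (fun x : ℝ => (x : ℂ) * x * J0 b x)
      (fun x : ℝ => (1 * (x : ℂ) + x * 1) * J0 b x + (x : ℂ) * x * J1 b x) :=
    ((IsPrimitive.id zero_le_one).mul zero_le_one (IsPrimitive.id zero_le_one)).mul zero_le_one
      (isPrimitive_J0 b)
  have h := hp.integral_mul_eq_sub zero_le_one (isPrimitive_J1 b).star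
  simp only [J0_one, mul_zero, zero_mul, Complex.ofReal_zero, sub_self, zero_sub] at h
  have e0 : virial b = -(∫ x in (0 : ℝ)..1, ((1 * (x : ℂ) + x * 1) * J0 b x + (x : ℂ) * x * J1 b x) *
      starRingEnd ℂ (J1 b x)).im := by
    rw [h, Complex.neg_im, neg_neg, virial]
    congr 2
    ext x; ring
  have c1 : Continuous fun x : ℝ => ((1 * (x : ℂ) + x * 1) * J0 b x + (x : ℂ) * x * J1 b x) *
      starRingEnd ℂ (J1 b x) :=
    ((((continuous_const.mul hx).add (hx.mul continuous_const)).mul (J0 b).continuous).add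
      ((hx.mul hx).mul (J1 b).continuous)).mul (Complex.continuous_conj.comp (J1 b).continuous)
  have c2 : Continuous fun x => dens b x + ‖J1 b x‖ ^ 2 :=
    (continuous_dens b).add ((J1 b).continuous.norm.pow 2)
  have c3 : Continuous fun x => ‖J1 b x‖ ^ 2 := (J1 b).continuous.norm.pow 2
  rw [e0, intervalIntegral_im (c1.intervalIntegrable _ _), abs_neg, kin_eq, mass,
    ← intervalIntegral.integral_add ((continuous_dens b).intervalIntegrable _ _)
    (c3.intervalIntegrable _ _), ← Real.norm_eq_abs]
  refine intervalIntegral.norm_integral_le_of_norm_le zero_le_one ?_ (c2.intervalIntegrable _ _)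
  refine Eventually.of_forall fun x hx => ?_
  have e1 : (((1 * (x : ℂ) + x * 1) * J0 b x + (x : ℂ) * x * J1 b x) *
      starRingEnd ℂ (J1 b x)).im = 2 * x * (J0 b x * starRingEnd ℂ (J1 b x)).im := by
    simp only [Complex.mul_im, Complex.mul_re, Complex.add_re, Complex.add_im, Complex.ofReal_re,
      Complex.ofReal_im, Complex.conj_re, Complex.conj_im, Complex.one_re, Complex.one_im]
    ring
  have h1 : |(J0 b x * starRingEnd ℂ (J1 b x)).im| ≤ ‖J0 b x‖ * ‖J1 b x‖ := by
    refine (Complex.abs_im_le_norm _).trans (le_of_eq ?_)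
    rw [norm_mul, RCLike.norm_conj]
  rw [e1, Real.norm_eq_abs, abs_mul, abs_of_nonneg (by linarith [hx.1] : 0 ≤ 2 * x), dens]
  calc 2 * x * |(J0 b x * starRingEnd ℂ (J1 b x)).im| ≤ 2 * 1 * (‖J0 b x‖ * ‖J1 b x‖) := by
        gcongr; exact hx.2
    _ ≤ _ := by nlinarith [sq_nonneg (‖J0 b x‖ - ‖J1 b x‖)]

/-- Since `ξ(0) = 0`, the density is the integral of `2 Re(ξ'ξ̄)`, to which Young's inequality with
parameter `l` applies. A large `l` makes the factor of the kinetic energy small. -/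
theorem dens_le (b : Coeff) {l : ℝ} (hl : 0 < l) {x : ℝ} (hx : x ∈ Icc (0 : ℝ) 1) :
    dens b x ≤ l * mass b + kin b / l := by
  have hp := ((isPrimitive_J0 b).mul zero_le_one (isPrimitive_J0 b).star).re
  have h1 := hp.eq x hx
  rw [J0_zero, zero_mul, Complex.zero_re, zero_add] at h1
  have e : dens b x = (J0 b x * starRingEnd ℂ (J0 b x)).re := by
    rw [Complex.mul_conj, Complex.ofReal_re, Complex.normSq_eq_norm_sq, dens]
  have c2 : Continuous fun x => l * dens b x + ‖J1 b x‖ ^ 2 / l :=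
    (continuous_const.mul (continuous_dens b)).add (((J1 b).continuous.norm.pow 2).div_const _)
  have h2 : ∀ y, (J1 b y * starRingEnd ℂ (J0 b y) + J0 b y * starRingEnd ℂ (J1 b y)).re ≤
      l * dens b y + ‖J1 b y‖ ^ 2 / l := fun y => by
    have h3 : (J1 b y * starRingEnd ℂ (J0 b y) + J0 b y * starRingEnd ℂ (J1 b y)).re ≤
        2 * (‖J0 b y‖ * ‖J1 b y‖) := by
      refine (Complex.re_le_norm _).trans ((norm_add_le _ _).trans (le_of_eq ?_))
      rw [norm_mul, norm_mul, RCLike.norm_conj, RCLike.norm_conj]; ring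
    refine h3.trans ?_
    have h4 : l * dens b y + ‖J1 b y‖ ^ 2 / l - 2 * (‖J0 b y‖ * ‖J1 b y‖) =
        (l * ‖J0 b y‖ - ‖J1 b y‖) ^ 2 / l := by
      unfold dens; field_simp; ring
    have h5 : 0 ≤ (l * ‖J0 b y‖ - ‖J1 b y‖) ^ 2 / l := by positivity
    linarith
  have hi : ∀ y z : ℝ, IntervalIntegrable (fun y => l * dens b y + ‖J1 b y‖ ^ 2 / l) volume y z :=
    fun y z => c2.intervalIntegrable _ _
  rw [e, h1]
  calc _ ≤ ∫ y in (0 : ℝ)..x, (l * dens b y + ‖J1 b y‖ ^ 2 / l) :=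
        intervalIntegral.integral_mono_on hx.1 ((hp.mono hx.1 hx.2).integrable) (hi _ _)
          fun y _ => h2 y
    _ ≤ ∫ y in (0 : ℝ)..1, (l * dens b y + ‖J1 b y‖ ^ 2 / l) := by
        rw [← intervalIntegral.integral_add_adjacent_intervals (hi 0 x) (hi x 1)]
        refine le_add_of_nonneg_right (intervalIntegral.integral_nonneg hx.2 fun y _ => ?_)
        have := dens_nonneg b y
        positivity
    _ = _ := by
        have c3 : Continuous fun x => ‖J1 b x‖ ^ 2 / l := ((J1 b).continuous.norm.pow 2).div_const _
        have c4 : Continuous fun x => l * dens b x := continuous_const.mul (continuous_dens b)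
        rw [intervalIntegral.integral_add (c4.intervalIntegrable _ _) (c3.intervalIntegrable _ _),
          intervalIntegral.integral_const_mul, intervalIntegral.integral_div, kin_eq, mass]

theorem quart_le (b : Coeff) {l : ℝ} (hl : 0 < l) :
    quart b ≤ (l * mass b + kin b / l) * mass b := by
  rw [quart, mass, ← intervalIntegral.integral_const_mul]
  refine intervalIntegral.integral_mono_on zero_le_one
    (((continuous_dens b).mul (continuous_dens b)).intervalIntegrable _ _)
    ((continuous_const.mul (continuous_dens b)).intervalIntegrable _ _) fun x hx => ?_
  have := dens_le b hl hx
  have := dens_nonneg b x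
  unfold mass at *
  gcongr

theorem continuous_kin : Continuous kin := by
  unfold kin; fun_prop

theorem continuous_virial : Continuous virial := by
  refine Complex.continuous_im.comp
    (intervalIntegral.continuous_parametric_intervalIntegral_of_continuous'
      (f := fun b (x : ℝ) => (x : ℂ) ^ 2 * J0 b x * starRingEnd ℂ (J2 b x)) ?_ 0 1)
  exact (((Complex.continuous_ofReal.comp continuous_snd).pow 2).mul
    (continuous_uncurry J0.continuous)).mul
    (Complex.continuous_conj.comp (continuous_uncurry J2.continuous))

theorem continuous_quart : Continuous quart :=
  intervalIntegral.continuous_parametric_intervalIntegral_of_continuous'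
    (f := fun b (x : ℝ) => dens b x * dens b x)
    (continuous_dens_uncurry.mul continuous_dens_uncurry) 0 1

theorem continuous_quartCur : Continuous quartCur :=
  intervalIntegral.continuous_parametric_intervalIntegral_of_continuous'
    (f := fun b (x : ℝ) => cur b x * dens b x + dens b x * cur b x)
    ((continuous_cur_uncurry.mul continuous_dens_uncurry).add
      (continuous_dens_uncurry.mul continuous_cur_uncurry)) 0 1

end Coeff

/-! ### Evolution of mass and kinetic energy -/

namespace Control

open Coeff

variable {T : ℝ} (c : Control T) {a : ℝ → Coeff} {a₀ : Coeff} {t₁ : ℝ}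

/-- The forcing is `i` times a real potential times `ξ`, so it does not contribute to the derivative
of `|ξ|²`; only the term `iξ''` does. -/
theorem IsMild.isPrimitive_dens (h : c.IsMild cubic a₀ a t₁) (h0 : 0 ≤ t₁) (ht₁ : t₁ ≤ T)
    (ha : Continuous a) {x : ℝ} (hx : x ∈ Icc (0 : ℝ) 1) :
    IsPrimitive 0 t₁ (fun t => dens (a t) x) (fun t => cur (a t) x) := by
  have hp := h.isPrimitive_J0 c h0 ht₁ ha hx
  refine (hp.mul h0 hp.star).re.congr h0 (fun t _ => ?_) (fun t _ => ?_)
  · rw [Complex.mul_conj, Complex.ofReal_re, Complex.normSq_eq_norm_sq, dens]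
  · have e : c.forceB a t x = Complex.I *
        ((-c.V t * x ^ 2 + c.ε * c.g t * Complex.normSq (J0 (a t) x) : ℝ) : ℂ) * J0 (a t) x := by
      rw [c.forceB_apply t hx]
      push_cast
      rw [← Complex.mul_conj]; ring
    rw [e, cur]
    generalize (-c.V t * x ^ 2 + c.ε * c.g t * Complex.normSq (J0 (a t) x) : ℝ) = r
    simp only [Complex.mul_im, Complex.mul_re, Complex.add_re, Complex.add_im, Complex.ofReal_re,
      Complex.ofReal_im, Complex.conj_re, Complex.conj_im, Complex.I_re, Complex.I_im]
    ring

theorem IsMild.mass_eq (h : c.IsMild cubic a₀ a t₁) (h0 : 0 ≤ t₁) (ht₁ : t₁ ≤ T)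
    (ha : Continuous a) {t : ℝ} (ht : t ∈ Icc 0 t₁) : mass (a t) = mass a₀ := by
  have hp := IsPrimitive.integral (F := fun t x => dens (a t) x) (r := fun t x => cur (a t) x)
    (fun x hx => h.isPrimitive_dens c h0 ht₁ ha hx) (continuous_dens _)
    (continuous_cur_uncurry.comp_path ha)
  have h1 := hp.eq t ht
  simp only [integral_cur, intervalIntegral.integral_zero, add_zero] at h1
  rw [mass, h1, h.zero c h0, mass]

theorem IsMild.isPrimitive_quart (h : c.IsMild cubic a₀ a t₁) (h0 : 0 ≤ t₁) (ht₁ : t₁ ≤ T)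
    (ha : Continuous a) :
    IsPrimitive 0 t₁ (fun t => quart (a t)) (fun t => quartCur (a t)) := by
  have h1 := continuous_dens_uncurry.comp_path ha
  have h2 := continuous_cur_uncurry.comp_path ha
  exact IsPrimitive.integral (F := fun t x => dens (a t) x * dens (a t) x)
    (r := fun t x => cur (a t) x * dens (a t) x + dens (a t) x * cur (a t) x)
    (fun x hx => (h.isPrimitive_dens c h0 ht₁ ha hx).mul h0 (h.isPrimitive_dens c h0 ht₁ ha hx))
    ((continuous_dens _).mul (continuous_dens _)) ((h2.mul h1).add (h1.mul h2))

/-- The cubic part of the integrand is a multiple of `|ξ|² Im(ξ ξ̄'')`, that is of density times its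
own time derivative. This exhibits it as a derivative of the quartic integral. -/
theorem re_integral_forceB (t : ℝ) :
    (∫ x in (0 : ℝ)..1, c.forceB a t x * starRingEnd ℂ (J2 (a t) x)).re =
      c.V t * virial (a t) - c.ε * c.g t * (quartCur (a t) / 4) := by
  have hJ := (J0 (a t)).continuous
  have hJ2 : Continuous fun x => starRingEnd ℂ (J2 (a t) x) :=
    Complex.continuous_conj.comp (J2 (a t)).continuous
  have hx : Continuous fun x : ℝ => (x : ℂ) := Complex.continuous_ofReal
  have cB : Continuous fun x => c.forceB a t x * starRingEnd ℂ (J2 (a t) x) :=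
    (c.forceB a t).continuous.mul hJ2
  have c1 : Continuous fun x : ℝ => (x : ℂ) ^ 2 * J0 (a t) x * starRingEnd ℂ (J2 (a t) x) :=
    ((hx.pow 2).mul hJ).mul hJ2
  have hcur : Continuous (cur (a t)) :=
    Continuous.uncurry_left (f := cur) (a t) continuous_cur_uncurry
  have cq : Continuous fun x => cur (a t) x * dens (a t) x + dens (a t) x * cur (a t) x :=
    (hcur.mul (continuous_dens _)).add ((continuous_dens _).mul hcur)
  have c2 : Continuous fun x : ℝ =>
      c.V t * ((x : ℂ) ^ 2 * J0 (a t) x * starRingEnd ℂ (J2 (a t) x)).im :=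
    continuous_const.mul (Complex.continuous_im.comp c1)
  have c3 : Continuous fun x : ℝ => c.ε * c.g t *
      ((cur (a t) x * dens (a t) x + dens (a t) x * cur (a t) x) / 4) :=
    continuous_const.mul (cq.div_const _)
  rw [intervalIntegral_re (cB.intervalIntegrable _ _), virial,
    intervalIntegral_im (c1.intervalIntegrable _ _), quartCur,
    ← intervalIntegral.integral_const_mul, ← intervalIntegral.integral_div,
    ← intervalIntegral.integral_const_mul, ← intervalIntegral.integral_sub
      (c2.intervalIntegrable _ _) (c3.intervalIntegrable _ _)]
  refine intervalIntegral.integral_congr fun x hx => ?_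
  rw [uIcc_of_le zero_le_one] at hx
  rw [c.forceB_apply t hx, cur, dens, ← Complex.normSq_eq_norm_sq, Complex.normSq_apply, sq (x : ℂ)]
  simp only [Complex.mul_im, Complex.mul_re, Complex.add_re, Complex.add_im, Complex.ofReal_re,
    Complex.ofReal_im, Complex.conj_re, Complex.conj_im, Complex.I_re, Complex.I_im,
    Complex.neg_re, Complex.neg_im]
  ring

theorem IsMild.isPrimitive_kin (h : c.IsMild cubic a₀ a t₁) (h0 : 0 ≤ t₁) (ht₁ : t₁ ≤ T)
    (ha : Continuous a) :
    IsPrimitive 0 t₁ (fun t => kin (a t))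
      (fun t => -2 * (c.V t * virial (a t)) + c.ε / 2 * (quartCur (a t) * c.g t)) := by
  have hpi : (Real.pi : ℂ) ≠ 0 := by exact_mod_cast Real.pi_ne_zero
  set r : ℕ → ℂ := fun n => (((freq n)⁻¹ : ℝ) : ℂ) with hr
  have hrc : ∀ n, starRingEnd ℂ (r n) = r n := fun n => Complex.conj_ofReal _
  set D : ℝ → ℂ := fun t => -(2 / (Real.pi : ℂ) ^ 2) *
    ∫ x in (0 : ℝ)..1, c.forceB a t x * starRingEnd ℂ (J2 (a t) x) with hD
  have hDs : ∀ t, HasSum (fun n => r n ^ 4 * (starRingEnd ℂ (a t n) * c.force cubic a n t)) (D t) :=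
    fun t => by
      have := hasSum_pairing (c.forceB a t) (a t)
      simp only [coef_forceB] at this
      exact this
  have hmode : ∀ n, IsPrimitive 0 t₁ (fun t => r n ^ 4 * (a t n * starRingEnd ℂ (a t n)))
      -- The free evolution contributes `-iωₙ|aₙ|²` and its conjugate, which cancel; only the
      -- forcing changes `|aₙ|²`.
      (fun t => r n ^ 4 * (starRingEnd ℂ (a t n) * c.force cubic a n t) +
        starRingEnd ℂ (r n ^ 4 * (starRingEnd ℂ (a t n) * c.force cubic a n t))) := fun n => by
    have hp := h.isPrimitive c h0 ht₁ continuous_cubic ha n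
    refine ((hp.mul h0 hp.star).const_mul h0 (r n ^ 4)).congr_right h0 fun t _ => ?_
    simp only [map_mul, map_add, map_neg, map_pow, hrc, Complex.conj_conj, Complex.conj_I,
      Complex.conj_ofReal]
    ring
  have hterm : ∀ n t, ‖r n ^ 4 * (starRingEnd ℂ (a t n) * c.force cubic a n t) +
      starRingEnd ℂ (r n ^ 4 * (starRingEnd ℂ (a t n) * c.force cubic a n t))‖ ≤
      2 * (‖a t‖ * c.forceBound a t) * ‖invFreq n‖ ^ 2 := fun n t => by
    refine (norm_add_le _ _).trans ?_
    rw [RCLike.norm_conj, norm_mul, norm_mul, RCLike.norm_conj, norm_pow]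
    have h1 : ‖r n‖ ^ 4 ≤ ‖invFreq n‖ ^ 2 :=
      pow_le_pow_of_le_one (norm_nonneg _) (norm_inv_freq_le n) (by norm_num)
    have h2 := norm_apply_le (a t) n
    have h3 := c.norm_force_le (a := a) n t
    have h4 : ‖r n‖ ^ 4 * (‖a t n‖ * ‖c.force cubic a n t‖) ≤
        ‖invFreq n‖ ^ 2 * (‖a t‖ * c.forceBound a t) := by gcongr
    linarith
  have key : IsPrimitive 0 t₁ (fun t => ((‖invD (invD (a t))‖ ^ 2 : ℝ) : ℂ))
      (fun t => D t + starRingEnd ℂ (D t)) := by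
    refine IsPrimitive.hasSum (bound := fun t => 2 * (‖a t‖ * c.forceBound a t) * ‖invFreq‖ ^ 2)
      h0 hmode (fun t _ => ?_) (fun t _ => ?_) ?_ (fun N t _ => ?_)
    · refine (Complex.hasSum_ofReal.2 (hasSum_norm_sq (invD (invD (a t))))).congr_fun fun n => ?_
      rw [← Complex.normSq_eq_norm_sq, ← Complex.mul_conj, invD_apply, invD_apply, map_mul, map_mul,
        Complex.conj_ofReal]
      ring
    · exact (hDs t).add (Complex.hasSum_conj.2 (by simpa using hDs t))
    · exact (((c.intervalIntegrable_forceBound ha h0 ht₁).continuousOn_mul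
        ha.norm.continuousOn).const_mul 2).mul_const _
    · calc _ ≤ ∑ n ∈ Finset.range N, 2 * (‖a t‖ * c.forceBound a t) * ‖invFreq n‖ ^ 2 :=
            norm_sum_le_of_le _ fun n _ => hterm n t
        _ = 2 * (‖a t‖ * c.forceBound a t) * ∑ n ∈ Finset.range N, ‖invFreq n‖ ^ 2 := by
            rw [Finset.mul_sum]
        _ ≤ _ := by
            have h3 := (norm_nonneg _).trans (c.norm_force_le (a := a) 0 t)
            gcongr
            exact sum_le_hasSum _ (fun _ _ => by positivity) (hasSum_norm_sq invFreq)
  refine (key.re.const_mul h0 (Real.pi ^ 2 / 2)).congr h0 (fun t _ => ?_) (fun t _ => ?_)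
  · rw [Complex.ofReal_re, kin]
  · have h1 := c.re_integral_forceB (a := a) t
    have e : D t = ((-(2 / Real.pi ^ 2) : ℝ) : ℂ) *
      ∫ x in (0 : ℝ)..1, c.forceB a t x * starRingEnd ℂ (J2 (a t) x) := by
      rw [hD]; push_cast; rfl
    have hp0 := Real.pi_ne_zero
    rw [Complex.add_re, Complex.conj_re, e, Complex.re_ofReal_mul, h1]
    field_simp
    ring

end Control

/-! ### Cutoff, a priori bounds and global existence -/

namespace Coeff

/-- A cutoff of the cubic nonlinearity, which makes it globally Lipschitz. -/
def cutCubic (R : ℝ) (a : Coeff) : Coeff := ((max 0 (min 1 (R + 1 - ‖a‖)) : ℝ) : ℂ) • cubic a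

theorem cutCubic_eq {R : ℝ} {a : Coeff} (h : ‖a‖ ≤ R) : cutCubic R a = cubic a := by
  rw [cutCubic, min_eq_left (by linarith), max_eq_right zero_le_one, Complex.ofReal_one, one_smul]

theorem cutCubic_eq_zero {R : ℝ} {a : Coeff} (h : R + 1 ≤ ‖a‖) : cutCubic R a = 0 := by
  rw [cutCubic, max_eq_left ((min_le_right _ _).trans (by linarith)), Complex.ofReal_zero, zero_smul]

theorem norm_cutCubic_sub_le {R : ℝ} (hR : 0 ≤ R) (a b : Coeff) :
    ‖cutCubic R a - cutCubic R b‖ ≤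
      (81 * opBound ^ 3 * (R + 1) ^ 2 + 27 * opBound ^ 3 * (R + 1) ^ 3) * ‖a - b‖ := by
  have hB := opBound_nonneg
  -- The difference splits into the cutoff at `a` times the difference of the cubic terms, and the
  -- difference of the cutoffs times the cubic term at `b`. One point in the ball of radius `R + 1`
  -- suffices, since the cutoff kills the first part when `a` is outside it.
  have hmain : ∀ a b : Coeff, ‖b‖ ≤ R + 1 → ‖cutCubic R a - cutCubic R b‖ ≤
      (81 * opBound ^ 3 * (R + 1) ^ 2 + 27 * opBound ^ 3 * (R + 1) ^ 3) * ‖a - b‖ := by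
    intro a b hb
    set χ : Coeff → ℝ := fun a => max 0 (min 1 (R + 1 - ‖a‖)) with hχ
    have h1 : |χ a - χ b| ≤ ‖a - b‖ := by
      have e : |χ a - χ b| ≤ |(R + 1 - ‖a‖) - (R + 1 - ‖b‖)| := by
        refine (abs_max_sub_max_le_max _ _ _ _).trans ?_
        rw [sub_self, abs_zero]
        refine max_le (abs_nonneg _) ((abs_min_sub_min_le_max _ _ _ _).trans ?_)
        rw [sub_self, abs_zero]
        exact max_le (abs_nonneg _) le_rfl
      refine e.trans ?_
      rw [sub_sub_sub_cancel_left, abs_sub_comm]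
      exact abs_norm_sub_norm_le a b
    have h2 : ‖cubic b‖ ≤ 27 * opBound ^ 3 * (R + 1) ^ 3 := by
      have hi := (norm_invD_invD_le b).trans hb
      calc _ ≤ 27 * opBound ^ 3 * ‖invD (invD b)‖ ^ 2 * ‖b‖ := norm_cubic_le b
        _ ≤ 27 * opBound ^ 3 * (R + 1) ^ 2 * (R + 1) := by gcongr
        _ = _ := by ring
    have hχ0 : 0 ≤ χ a := le_max_left _ _
    have hχ1 : χ a ≤ 1 := max_le zero_le_one (min_le_left _ _)
    have h3 : ‖((χ a : ℝ) : ℂ) • (cubic a - cubic b)‖ ≤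
        81 * opBound ^ 3 * (R + 1) ^ 2 * ‖a - b‖ := by
      rcases le_or_gt ‖a‖ (R + 1) with ha | ha
      · rw [norm_smul, Complex.norm_real, Real.norm_of_nonneg hχ0]
        calc _ ≤ 1 * (81 * opBound ^ 3 * (R + 1) ^ 2 * ‖a - b‖) := by
              gcongr; exact norm_cubic_sub_le ha hb
          _ = _ := one_mul _
      · have : χ a = 0 := max_eq_left ((min_le_right _ _).trans (by linarith))
        rw [this, Complex.ofReal_zero, zero_smul, norm_zero]; positivity
    have e : cutCubic R a - cutCubic R b =
        ((χ a : ℝ) : ℂ) • (cubic a - cubic b) + ((χ a - χ b : ℝ) : ℂ) • cubic b := by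
      rw [Complex.ofReal_sub, sub_smul, smul_sub]
      change ((χ a : ℝ) : ℂ) • cubic a - ((χ b : ℝ) : ℂ) • cubic b = _
      abel
    rw [e, add_mul]
    refine (norm_add_le _ _).trans (add_le_add h3 ?_)
    rw [norm_smul, Complex.norm_real, Real.norm_eq_abs, mul_comm]
    gcongr
  rcases le_or_gt ‖b‖ (R + 1) with hb | hb
  · exact hmain a b hb
  · rcases le_or_gt ‖a‖ (R + 1) with ha | ha
    · rw [norm_sub_rev, norm_sub_rev a b]; exact hmain b a ha
    · rw [cutCubic_eq_zero ha.le, cutCubic_eq_zero hb.le, sub_zero, norm_zero]; positivity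

end Coeff

namespace Control

open Coeff

variable {T : ℝ} (c : Control T) {a : ℝ → Coeff} {a₀ : Coeff} {t₁ : ℝ}

/-- The energy estimate, before the use of Gronwall's inequality. -/
theorem IsMild.kin_le {C l : ℝ} (h : c.IsMild cubic a₀ a t₁) (h0 : 0 ≤ t₁) (ht₁ : t₁ ≤ T)
    (ha : Continuous a) (hC0 : 0 ≤ C) (hC : ∀ t ∈ Icc 0 T, c.g t ≤ C ∧ |c.u t| ≤ C)
    (hl : 0 < l) (hl' : |c.ε| * C * mass a₀ ≤ l) {t : ℝ} (ht : t ∈ Icc 0 t₁) :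
    kin (a t) ≤ 2 * kin a₀ + |c.ε| * C * l * mass a₀ ^ 2 + |c.ε| * C * quart a₀ +
      ∫ s in (0 : ℝ)..t, (4 * (|c.V s| * (mass a₀ + kin (a s))) +
        |c.ε| * (C ^ 2 * ((l * mass a₀ + kin (a s) / l) * mass a₀))) := by
  set m := mass a₀ with hm
  have hm0 : 0 ≤ m := mass_nonneg a₀
  have htT : ∀ s ∈ Icc 0 t, s ∈ Icc 0 T := fun s hs => ⟨hs.1, hs.2.trans (ht.2.trans ht₁)⟩
  have hmass : ∀ s ∈ Icc 0 t, mass (a s) = m := fun s hs =>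
    h.mass_eq c h0 ht₁ ha ⟨hs.1, hs.2.trans ht.2⟩
  have hq : ∀ s ∈ Icc 0 t, quart (a s) ≤ (l * m + kin (a s) / l) * m := fun s hs => by
    have := quart_le (a s) hl
    rwa [hmass s hs] at this
  have ck : Continuous fun s => kin (a s) := continuous_kin.comp ha
  have cv : Continuous fun s => virial (a s) := continuous_virial.comp ha
  have cq : Continuous fun s => quart (a s) := continuous_quart.comp ha
  have cqc : Continuous fun s => quartCur (a s) := continuous_quartCur.comp ha
  have hVi := c.intervalIntegrable_V (htT t ⟨ht.1, le_rfl⟩)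
  have i1 : IntervalIntegrable (fun s => c.V s * virial (a s)) volume 0 t :=
    hVi.mul_continuousOn cv.continuousOn
  have i2 : IntervalIntegrable (fun s => quartCur (a s) * c.g s) volume 0 t :=
    (cqc.mul c.continuous_g).intervalIntegrable _ _
  have i3 : IntervalIntegrable (fun s => |c.V s| * (m + kin (a s))) volume 0 t :=
    hVi.abs.mul_continuousOn (continuous_const.add ck).continuousOn
  have c4 : Continuous fun s => C ^ 2 * ((l * m + kin (a s) / l) * m) :=
    continuous_const.mul ((continuous_const.add (ck.div_const _)).mul continuous_const)
  have hk := (h.isPrimitive_kin c h0 ht₁ ha).eq t ht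
  rw [intervalIntegral.integral_add (i1.const_mul _) (i2.const_mul _),
    intervalIntegral.integral_const_mul, intervalIntegral.integral_const_mul, h.zero c h0] at hk
  have hg : IsPrimitive 0 t c.g (fun s => c.g s * c.u s) :=
    IsPrimitive.of_continuous ht.1 c.hasDerivAt_g (c.continuous_g.mul c.cont)
  -- The quartic current contains `ξ''`, which the kinetic energy does not control. Integration by
  -- parts in time moves the derivative to `g`, whose derivative `g u` is bounded.
  have hibp := IsPrimitive.integral_mul_eq_sub ht.1
    ((h.isPrimitive_quart c h0 ht₁ ha).mono ht.1 ht.2) hg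
  rw [h.zero c h0] at hibp
  have b1 : |∫ s in (0 : ℝ)..t, c.V s * virial (a s)| ≤
      ∫ s in (0 : ℝ)..t, |c.V s| * (m + kin (a s)) := by
    rw [← Real.norm_eq_abs]
    refine intervalIntegral.norm_integral_le_of_norm_le ht.1
      (Eventually.of_forall fun s hs => ?_) i3
    rw [norm_mul, Real.norm_eq_abs, Real.norm_eq_abs, ← hmass s ⟨hs.1.le, hs.2⟩]
    gcongr
    exact abs_virial_le _
  have b2 : |∫ s in (0 : ℝ)..t, quart (a s) * (c.g s * c.u s)| ≤
      ∫ s in (0 : ℝ)..t, C ^ 2 * ((l * m + kin (a s) / l) * m) := by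
    rw [← Real.norm_eq_abs]
    refine intervalIntegral.norm_integral_le_of_norm_le ht.1
      (Eventually.of_forall fun s hs => ?_) (c4.intervalIntegrable _ _)
    have hs' : s ∈ Icc 0 t := ⟨hs.1.le, hs.2⟩
    obtain ⟨g1, g2⟩ := hC s (htT s hs')
    have g3 := hq s hs'
    have g4 := quart_nonneg (a s)
    have g5 := (c.g_pos s).le
    rw [norm_mul, norm_mul, Real.norm_of_nonneg g4, Real.norm_of_nonneg g5, Real.norm_eq_abs,
      mul_comm]
    calc _ ≤ (C * C) * ((l * m + kin (a s) / l) * m) := by gcongr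
      _ = _ := by ring
  have b3 : quart (a t) * c.g t ≤ C * ((l * m + kin (a t) / l) * m) := by
    rw [mul_comm]
    have g1 := (hC t (htT t ⟨ht.1, le_rfl⟩)).1
    have g3 := hq t ⟨ht.1, le_rfl⟩
    have g4 := quart_nonneg (a t)
    gcongr
  have b3' : 0 ≤ quart (a t) * c.g t := mul_nonneg (quart_nonneg _) (c.g_pos _).le
  have b4 : quart a₀ * c.g 0 ≤ C * quart a₀ := by
    rw [mul_comm]
    have g1 := (hC 0 (htT 0 ⟨le_rfl, ht.1⟩)).1
    have g4 := quart_nonneg a₀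
    gcongr
  have b4' : 0 ≤ quart a₀ * c.g 0 := mul_nonneg (quart_nonneg _) (c.g_pos _).le
  have b5 : c.ε / 2 * (∫ s in (0 : ℝ)..t, quartCur (a s) * c.g s) ≤ |c.ε| / 2 *
      (C * ((l * m + kin (a t) / l) * m) + C * quart a₀ +
        ∫ s in (0 : ℝ)..t, C ^ 2 * ((l * m + kin (a s) / l) * m)) := by
    rw [hibp]
    refine (le_abs_self _).trans ?_
    rw [abs_mul, abs_div, abs_two]
    gcongr
    refine (abs_sub _ _).trans (add_le_add ?_ b2)
    refine (abs_sub _ _).trans (add_le_add ?_ ?_)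
    · rwa [abs_of_nonneg b3']
    · rwa [abs_of_nonneg b4']
  -- By the choice of `l`, the quartic term at time `t` costs at most half of the kinetic energy.
  -- Absorbing it doubles the remaining terms.
  have b6 : |c.ε| * C * m * (kin (a t) / l) ≤ kin (a t) := by
    calc _ ≤ l * (kin (a t) / l) := by
          have := kin_nonneg (a t)
          gcongr
      _ = _ := by field_simp
  have hsplit : ∫ s in (0 : ℝ)..t, (4 * (|c.V s| * (m + kin (a s))) +
      |c.ε| * (C ^ 2 * ((l * m + kin (a s) / l) * m))) =
      4 * (∫ s in (0 : ℝ)..t, |c.V s| * (m + kin (a s))) +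
      |c.ε| * ∫ s in (0 : ℝ)..t, C ^ 2 * ((l * m + kin (a s) / l) * m) := by
    rw [intervalIntegral.integral_add (i3.const_mul _)
      ((c4.intervalIntegrable _ _).const_mul _), intervalIntegral.integral_const_mul,
      intervalIntegral.integral_const_mul]
  rw [hsplit]
  have b1' := neg_abs_le (∫ s in (0 : ℝ)..t, c.V s * virial (a s))
  have b7 : |c.ε| / 2 * (C * ((l * m + kin (a t) / l) * m) + C * quart a₀ +
        ∫ s in (0 : ℝ)..t, C ^ 2 * ((l * m + kin (a s) / l) * m)) =
      (|c.ε| * C * l * m ^ 2 + |c.ε| * C * m * (kin (a t) / l) + |c.ε| * C * quart a₀ +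
        |c.ε| * ∫ s in (0 : ℝ)..t, C ^ 2 * ((l * m + kin (a s) / l) * m)) / 2 := by ring
  linarith

/-- Gronwall's inequality for the kinetic energy with a weight built from `|V|`. The bound is
uniform in the time of existence and in the solution, as the continuation argument demands. -/
theorem exists_kin_bound (a₀ : Coeff) : ∃ B, 0 ≤ B ∧ ∀ t₁ ∈ Icc 0 T, ∀ a, Continuous a →
    c.IsMild cubic a₀ a t₁ → ∀ t ∈ Icc 0 t₁, kin (a t) ≤ B := by
  obtain ⟨C, hC0, hC⟩ := c.exists_g_bound
  have hT := c.T_pos.le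
  set m := mass a₀ with hm
  have hm0 : 0 ≤ m := mass_nonneg a₀
  -- Large enough for the absorption in `IsMild.kin_le`; the summand `1` keeps it positive.
  set l := |c.ε| * C * m + 1 with hl
  have hl0 : 0 < l := by positivity
  set w : ℝ → ℝ := fun s => 4 * |c.V s| + |c.ε| * C ^ 2 * m / l with hw
  set ρ : ℝ → ℝ := fun s => 4 * (|c.V s| * m) + |c.ε| * (C ^ 2 * (l * m * m)) with hρ
  have hw0 : ∀ s, 0 ≤ w s := fun s => by rw [hw]; positivity
  have hρ0 : ∀ s, 0 ≤ ρ s := fun s => by rw [hρ]; positivity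
  have hVT := (c.intervalIntegrable_V ⟨hT, le_rfl⟩).abs
  have hwi : IntervalIntegrable w volume 0 T := (hVT.const_mul 4).add intervalIntegrable_const
  have hρi : IntervalIntegrable ρ volume 0 T :=
    ((hVT.mul_const m).const_mul 4).add intervalIntegrable_const
  obtain ⟨K, hK0, hK⟩ := exists_gronwall_const hT hwi
  set A := 2 * kin a₀ + |c.ε| * C * l * m ^ 2 + |c.ε| * C * quart a₀ + ∫ s in (0 : ℝ)..T, ρ s
    with hA
  have hA0 : 0 ≤ A := by
    have h1 := kin_nonneg a₀
    have h2 := quart_nonneg a₀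
    have h3 : 0 ≤ ∫ s in (0 : ℝ)..T, ρ s := intervalIntegral.integral_nonneg hT fun s _ => hρ0 s
    positivity
  refine ⟨K * A, by positivity, fun t₁ ht₁ a ha h => ?_⟩
  have ck : Continuous fun s => kin (a s) := continuous_kin.comp ha
  refine hK t₁ A (fun t => kin (a t)) ht₁ hA0 ck.continuousOn (fun t _ => kin_nonneg _) ?_
  intro t ht
  have htT : t ≤ T := ht.2.trans ht₁.2
  have hsub : uIcc 0 t ⊆ uIcc 0 T := by
    rw [uIcc_of_le ht.1, uIcc_of_le hT]; exact Icc_subset_Icc_right htT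
  refine (h.kin_le c ht₁.1 ht₁.2 ha hC0 hC hl0 (by rw [hl]; linarith) ht).trans ?_
  have e : ∫ s in (0 : ℝ)..t, (4 * (|c.V s| * (m + kin (a s))) +
      |c.ε| * (C ^ 2 * ((l * m + kin (a s) / l) * m))) =
      (∫ s in (0 : ℝ)..t, ρ s) + ∫ s in (0 : ℝ)..t, |w s| * kin (a s) := by
    rw [← intervalIntegral.integral_add (hρi.mono_set hsub)
      ((hwi.mono_set hsub).abs.mul_continuousOn ck.continuousOn)]
    refine intervalIntegral.integral_congr fun s _ => ?_
    rw [abs_of_nonneg (hw0 s), hw, hρ]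
    field_simp
    ring
  have hle : ∫ s in (0 : ℝ)..t, ρ s ≤ ∫ s in (0 : ℝ)..T, ρ s :=
    intervalIntegral.integral_mono_interval le_rfl ht.1 htT
      (Eventually.of_forall hρ0) hρi
  rw [e, hA]
  linarith

/-- With the `H¹` norm bounded, `norm_cubic_le` makes the nonlinearity linearly bounded in `H³`, and
Gronwall's inequality applies again, now to `‖a‖²`. -/
theorem exists_norm_bound (a₀ : Coeff) : ∃ M, 0 ≤ M ∧ ∀ t₁ ∈ Icc 0 T, ∀ a, Continuous a →
    c.IsMild cubic a₀ a t₁ → ∀ t ∈ Icc 0 t₁, ‖a t‖ ≤ M := by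
  obtain ⟨B, hB0, hB⟩ := c.exists_kin_bound a₀
  obtain ⟨C, hC0, hC⟩ := c.exists_g_bound
  have hT := c.T_pos.le
  have hop := opBound_nonneg
  set L := 27 * opBound ^ 3 * B with hL
  obtain ⟨K, hK0, hK⟩ := exists_gronwall_const hT
    ((c.intervalIntegrable_weight (opNorms + |c.ε| * C * L)).const_mul 2)
  refine ⟨√(K * (2 * ‖a₀‖ ^ 2)), Real.sqrt_nonneg _, fun t₁ ht₁ a ha h t ht => ?_⟩
  refine Real.le_sqrt_of_sq_le ?_
  refine hK t₁ (2 * ‖a₀‖ ^ 2) (fun t => ‖a t‖ ^ 2) ht₁ (by positivity)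
    (ha.norm.pow 2).continuousOn (fun t _ => by positivity) (fun t ht => ?_) t ht
  refine h.norm_sq_le c ht₁.2 (by positivity) hC0 (fun t ht => (hC t ht).1) continuous_cubic ha
    (fun s hs => ?_) ht
  refine (norm_cubic_le _).trans ?_
  have h1 : ‖invD (invD (a s))‖ ^ 2 ≤ B := by
    refine le_trans ?_ (hB t₁ ht₁ a ha h s hs)
    rw [kin]
    refine le_mul_of_one_le_left (by positivity) ?_
    nlinarith [Real.pi_gt_three]
  rw [hL]
  gcongr

/-- Global existence of mild solutions. -/
theorem exists_mild_cubic (a₀ : Coeff) :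
    ∃ a : ℝ → Coeff, Continuous a ∧ c.IsMild cubic a₀ a T := by
  obtain ⟨M, hM0, hM⟩ := c.exists_norm_bound a₀
  have hT := c.T_pos.le
  have hop := opBound_nonneg
  -- The cutoff starts one unit above the a priori bound `M`, which leaves a gap that a continuous
  -- norm would have to cross.
  obtain ⟨a, ha, h⟩ := c.exists_mild (by positivity)
    (norm_cutCubic_sub_le (R := M + 1) (by positivity)) a₀
  refine ⟨a, ha, ?_⟩
  have key : ∀ t ∈ Icc 0 T, (∀ s ∈ Icc 0 t, ‖a s‖ ≤ M + 1) → ‖a t‖ ≤ M := fun t ht hs =>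
    hM t ht a ha ((h.mono c ht.2).congr c fun s hs' => cutCubic_eq (hs s hs')) t ⟨ht.1, le_rfl⟩
  have ha0 : ‖a 0‖ ≤ M := by
    have hz : c.IsMild cubic a₀ a 0 := by
      intro t ht n
      obtain rfl : t = 0 := le_antisymm ht.2 ht.1
      have := h.zero c hT
      simp [this]
    exact hM 0 ⟨le_rfl, hT⟩ a ha hz 0 ⟨le_rfl, le_rfl⟩
  refine h.congr c fun t ht => cutCubic_eq ?_
  by_contra! hcon
  -- If the norm exceeded `M + 1`, there would be a first time `τ` at which it equals `M + 1`. Up to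
  -- `τ` the cutoff is inactive, so the a priori bound gives `‖a τ‖ ≤ M`, a contradiction.
  have hZ : (Icc 0 T ∩ {t | ‖a t‖ = M + 1}).Nonempty := by
    obtain ⟨s, hs, hs'⟩ := intermediate_value_Icc ht.1 ha.norm.continuousOn
      (⟨by linarith, hcon.le⟩ : M + 1 ∈ Icc ‖a 0‖ ‖a t‖)
    exact ⟨s, ⟨hs.1, hs.2.trans ht.2⟩, hs'⟩
  have hZc : IsCompact (Icc 0 T ∩ {t | ‖a t‖ = M + 1}) :=
    isCompact_Icc.inter_right (isClosed_eq ha.norm continuous_const)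
  obtain ⟨τ, ⟨hτ, hτ'⟩, hmin⟩ := hZc.exists_isLeast hZ
  have h1 := key τ hτ fun s hs => by
    by_contra! hc
    obtain ⟨r, hr, hr'⟩ := intermediate_value_Icc hs.1 ha.norm.continuousOn
      (⟨by linarith, hc.le⟩ : M + 1 ∈ Icc ‖a 0‖ ‖a s‖)
    have h2 : τ ≤ r := hmin ⟨⟨hr.1, hr.2.trans (hs.2.trans hτ.2)⟩, hr'⟩
    have h3 : r = s := le_antisymm hr.2 (hs.2.trans h2)
    rw [h3] at hr'
    exact hc.ne' hr'
  have h2 : ‖a τ‖ = M + 1 := hτ'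
  linarith

end Control

/-! ### Weak derivatives and absolutely continuous representatives -/

section Weak

variable {𝕜 : Type} [RCLike 𝕜] {a b : ℝ}

theorem IsPrimitive.ae_unique {f f' g' : ℝ → 𝕜} (hab : a ≤ b) (h : IsPrimitive a b f f')
    (h' : IsPrimitive a b f g') :
    ∀ᵐ x ∂(volume : Measure ℝ).restrict (Ioo a b), f' x = g' x := by
  rw [ae_restrict_iff' measurableSet_Ioo]
  filter_upwards [h.ae_hasDerivAt hab, h'.ae_hasDerivAt hab] with x h1 h2 hx
  exact (h1 hx).unique (h2 hx)

theorem IsWeakDeriv.congr_ae {f g f' g' : ℝ → 𝕜} {k : ℕ} (h : IsWeakDeriv a b k f g)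
    (hf : ∀ᵐ x ∂(volume : Measure ℝ).restrict (Ioo a b), f x = f' x)
    (hg : ∀ᵐ x ∂(volume : Measure ℝ).restrict (Ioo a b), g x = g' x) :
    IsWeakDeriv a b k f' g' := by
  intro θ h1 h2 h3
  have e1 : ∫ x in Ioo a b, iteratedDeriv k θ x • f' x = ∫ x in Ioo a b, iteratedDeriv k θ x • f x :=
    integral_congr_ae (by filter_upwards [hf] with x hx; rw [hx])
  have e2 : ∫ x in Ioo a b, θ x • g' x = ∫ x in Ioo a b, θ x • g x :=
    integral_congr_ae (by filter_upwards [hg] with x hx; rw [hx])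
  rw [e1, e2, h θ h1 h2 h3]

theorem IsWeakDeriv.refl (f : ℝ → 𝕜) : IsWeakDeriv a b 0 f f := fun θ _ _ _ => by simp

theorem IsPrimitive.of_contDiff {θ : ℝ → ℝ} (hab : a ≤ b) (h : ContDiff ℝ ∞ θ) :
    IsPrimitive a b (fun x => (θ x : 𝕜)) (fun x => ((deriv θ x : ℝ) : 𝕜)) := by
  refine IsPrimitive.of_continuous hab (fun x => ?_)
    (RCLike.continuous_ofReal.comp (h.continuous_deriv (by simp)))
  exact (RCLike.ofRealCLM (K := 𝕜)).hasFDerivAt.comp_hasDerivAt x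
    ((h.differentiable (by simp)) x).hasDerivAt

/-- Use `θ'` as the test function for order `k`, then integrate by parts once; `θ` vanishes at the
ends of the interval. -/
theorem IsWeakDeriv.succ {f g g' : ℝ → 𝕜} {k : ℕ} (hab : a ≤ b) (h : IsWeakDeriv a b k f g)
    (hg : IsPrimitive a b g g') : IsWeakDeriv a b (k + 1) f g' := by
  intro θ h1 h2 h3
  have hd : ContDiff ℝ ∞ (deriv θ) := (contDiff_infty_iff_deriv.1 h1).2
  rw [iteratedDeriv_succ', h (deriv θ) hd h2.deriv (tsupport_deriv_subset.trans h3), pow_succ,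
    mul_assoc]
  congr 1
  have ha : θ a = 0 := image_eq_zero_of_notMem_tsupport fun hx => lt_irrefl _ (h3 hx).1
  have hb : θ b = 0 := image_eq_zero_of_notMem_tsupport fun hx => lt_irrefl _ (h3 hx).2
  have := (IsPrimitive.of_contDiff (𝕜 := 𝕜) hab h1).integral_mul_eq_sub hab hg
  rw [ha, hb] at this
  simp only [RCLike.ofReal_zero, zero_mul, sub_self, zero_sub] at this
  simp only [RCLike.real_smul_eq_coe_mul]
  rw [integral_Ioo_eq hab, integral_Ioo_eq hab, this]
  ring

/-- The lemma of du Bois-Reymond. -/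
theorem ae_eq_const_of_integral_deriv_eq_zero {w : ℝ → 𝕜} (hab : a < b)
    (hw : IntegrableOn w (Ioo a b))
    (h : ∀ θ : ℝ → ℝ, ContDiff ℝ ∞ θ → HasCompactSupport θ → tsupport θ ⊆ Ioo a b →
      ∫ x in Ioo a b, deriv θ x • w x = 0) :
    ∃ c : 𝕜, ∀ᵐ x ∂(volume : Measure ℝ).restrict (Ioo a b), w x = c := by
  set m := (a + b) / 2 with hm
  let B : ContDiffBump m := ⟨(b - a) / 8, (b - a) / 4, by linarith, by linarith⟩
  set η : ℝ → ℝ := B.normed volume with hη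
  have hη1 : ContDiff ℝ ∞ η := B.contDiff_normed
  have hη2 : HasCompactSupport η := B.hasCompactSupport_normed
  have hη3 : tsupport η ⊆ Ioo a b := by
    rw [hη, B.tsupport_normed_eq, Real.closedBall_eq_Icc]
    intro x hx
    have h1 : m - (b - a) / 4 ≤ x := hx.1
    have h2 : x ≤ m + (b - a) / 4 := hx.2
    constructor <;> linarith
  have hη4 : ∫ x, η x = 1 := B.integral_normed
  set c : 𝕜 := ∫ x in Ioo a b, η x • w x with hc
  have hsm : ∀ φ : ℝ → ℝ, Continuous φ → HasCompactSupport φ →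
      IntegrableOn (fun x => φ x • w x) (Ioo a b) := fun φ hφ hφ' => by
    obtain ⟨C, hC⟩ := hφ.bounded_above_of_compact_support hφ'
    exact hw.bdd_smul C hφ.aestronglyMeasurable (Filter.Eventually.of_forall hC)
  refine ⟨c, ?_⟩
  -- Subtracting `(∫ φ) η`, where `η` is a bump of integral one, leaves a function of integral zero.
  -- Its primitive is again a test function, so the hypothesis applies.
  have key : ∀ φ : ℝ → ℝ, ContDiff ℝ ∞ φ → HasCompactSupport φ → tsupport φ ⊆ Ioo a b →
      ∫ x in Ioo a b, φ x • w x = (∫ x, φ x) • c := by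
    intro φ h1 h2 h3
    set A := ∫ x, φ x with hA
    set q : ℝ → ℝ := fun x => φ x - A * η x with hq
    have hq1 : ContDiff ℝ ∞ q := h1.sub (contDiff_const.mul hη1)
    have hq2 : HasCompactSupport q := h2.sub (hη2.mul_left (f := fun _ => A))
    have hq3 : tsupport q ⊆ Ioo a b :=
      (tsupport_sub φ fun x => A * η x).trans (union_subset h3
        ((closure_mono (Function.support_mul_subset_right (fun _ => A) η)).trans hη3))
    have hqI : Integrable q := hq1.continuous.integrable_of_hasCompactSupport hq2
    have hq4 : ∫ x, q x = 0 := by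
      rw [hq, integral_sub (h1.continuous.integrable_of_hasCompactSupport h2)
        ((hη1.continuous.integrable_of_hasCompactSupport hη2).const_mul A),
        integral_const_mul, hη4, mul_one, sub_self]
    -- The primitive of `q` vanishes outside the convex hull of the support of `q`, so this hull
    -- must be a compact subinterval of `(a,b)`. An empty support is handled by the midpoint.
    obtain ⟨α, β, hα, hβ, hK⟩ : ∃ α β, a < α ∧ β < b ∧ tsupport q ⊆ Icc α β := by
      rcases (tsupport q).eq_empty_or_nonempty with he | hne
      · exact ⟨m, m, by linarith, by linarith, by simp [he]⟩
      · have hcp : IsCompact (tsupport q) := hq2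
        refine ⟨sInf (tsupport q), sSup (tsupport q), (hq3 (hcp.sInf_mem hne)).1,
          (hq3 (hcp.sSup_mem hne)).2, fun x hx => ⟨csInf_le hcp.bddBelow hx,
          le_csSup hcp.bddAbove hx⟩⟩
    have hq0 : ∀ x, x ∉ Icc α β → q x = 0 := fun x hx =>
      image_eq_zero_of_notMem_tsupport fun hx' => hx (hK hx')
    set θ : ℝ → ℝ := fun x => ∫ y in a..x, q y with hθ
    have hθd : ∀ x, HasDerivAt θ (q x) x := fun x =>
      intervalIntegral.integral_hasDerivAt_right (hq1.continuous.intervalIntegrable _ _)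
        (hq1.continuous.stronglyMeasurableAtFilter _ _) hq1.continuous.continuousAt
    have hdθ : deriv θ = q := funext fun x => (hθd x).deriv
    have hθ1 : ContDiff ℝ ∞ θ :=
      contDiff_infty_iff_deriv.2 ⟨fun x => (hθd x).differentiableAt, by rwa [hdθ]⟩
    have hθ0 : ∀ x, x ∉ Icc α β → θ x = 0 := by
      intro x hx
      rcases lt_or_ge x α with hx1 | hx1
      · have : ∀ y ∈ uIcc a x, q y = (fun _ => (0 : ℝ)) y := fun y hy =>
          hq0 y fun h => absurd h.1 (not_le.2 (lt_of_le_of_lt hy.2 (max_lt hα hx1)))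
        rw [hθ]; simp only
        rw [intervalIntegral.integral_congr this, intervalIntegral.integral_zero]
      · have hx2 : β < x := by
          by_contra! h; exact hx ⟨hx1, h⟩
        have e : ∫ y in a..x, q y = ∫ y, q y := by
          rw [intervalIntegral.integral_of_le (hα.le.trans hx1)]
          refine setIntegral_eq_integral_of_forall_compl_eq_zero fun y hy => hq0 y fun h => hy ?_
          exact ⟨hα.trans_le h.1, h.2.trans hx2.le⟩
        rw [hθ]; simp only
        rw [e, hq4]
    have hsupp : tsupport θ ⊆ Icc α β :=
      closure_minimal (fun x hx => by_contra fun h => hx (hθ0 x h)) isClosed_Icc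
    have h5 := h θ hθ1 (isCompact_Icc.of_isClosed_subset (isClosed_tsupport θ) hsupp)
      (hsupp.trans fun x hx => ⟨hα.trans_le hx.1, hx.2.trans_lt hβ⟩)
    rw [hdθ] at h5
    have e : ∫ x in Ioo a b, q x • w x =
        (∫ x in Ioo a b, φ x • w x) - A • ∫ x in Ioo a b, η x • w x := by
      have hs2 : IntegrableOn (fun x => A • η x • w x) (Ioo a b) :=
        (hsm η hη1.continuous hη2).smul A
      rw [← integral_smul, ← integral_sub (hsm φ h1.continuous h2) hs2]
      refine integral_congr_ae (Eventually.of_forall fun x => ?_)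
      simp only [hq, sub_smul, smul_smul]
    rw [e, sub_eq_zero] at h5
    exact h5
  have hwc : IntegrableOn (fun x => w x - c) (Ioo a b) :=
    hw.sub (integrableOn_const (by simp))
  have hz := isOpen_Ioo.ae_eq_zero_of_integral_contDiff_smul_eq_zero
    (f := fun x => w x - c) (U := Ioo a b) (μ := volume) hwc.locallyIntegrableOn (by
    intro φ h1 h2 h3
    have e0 : ∫ x, φ x • (w x - c) = ∫ x in Ioo a b, φ x • (w x - c) := by
      refine (setIntegral_eq_integral_of_forall_compl_eq_zero fun x hx => ?_).symm
      rw [image_eq_zero_of_notMem_tsupport fun h => hx (h3 h), zero_smul]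
    have e1 : ∫ x in Ioo a b, φ x = ∫ x, φ x :=
      setIntegral_eq_integral_of_forall_compl_eq_zero fun x hx =>
        image_eq_zero_of_notMem_tsupport fun h => hx (h3 h)
    have hφi : IntegrableOn φ (Ioo a b) :=
      (h1.continuous.integrable_of_hasCompactSupport h2).integrableOn
    rw [e0]
    simp only [smul_sub]
    rw [integral_sub (hsm φ h1.continuous h2) (hφi.smul_const c), key φ h1 h2 h3,
      integral_smul_const, e1, sub_self])
  rw [ae_restrict_iff' measurableSet_Ioo]
  filter_upwards [hz] with x hx hx'
  exact sub_eq_zero.1 (hx hx')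

/-- A function with a weak derivative is almost everywhere a primitive of it. -/
theorem IsWeakDeriv.exists_isPrimitive {f g : L2 𝕜 a b} (hab : a < b)
    (h : IsWeakDeriv a b 1 f g) :
    ∃ F : ℝ → 𝕜, IsPrimitive a b F g ∧
      ∀ᵐ x ∂(volume : Measure ℝ).restrict (Ioo a b), f x = F x := by
  set G : ℝ → 𝕜 := fun x => ∫ t in a..x, g t with hG
  have hgi : IntervalIntegrable g volume a b := L2.intervalIntegrable hab.le g
  have hGp : IsPrimitive a b G g := ⟨hgi, fun x _ => by simp [hG]⟩
  have hGw : IsWeakDeriv a b 1 G g := (IsWeakDeriv.refl G).succ hab.le hGp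
  have hGc : IntegrableOn G (Ioo a b) :=
    ((hGp.continuousOn hab.le).integrableOn_Icc).mono_set Ioo_subset_Icc_self
  have hfi : IntegrableOn f (Ioo a b) := L2.integrable f
  have hsm : ∀ (v : ℝ → 𝕜), IntegrableOn v (Ioo a b) → ∀ φ : ℝ → ℝ, Continuous φ →
      HasCompactSupport φ → IntegrableOn (fun x => φ x • v x) (Ioo a b) := fun v hv φ hφ hφ' => by
    obtain ⟨C, hC⟩ := hφ.bounded_above_of_compact_support hφ'
    exact hv.bdd_smul C hφ.aestronglyMeasurable (Filter.Eventually.of_forall hC)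
  obtain ⟨c, hc⟩ := ae_eq_const_of_integral_deriv_eq_zero (w := fun x => f x - G x) hab
    (hfi.sub hGc) (by
      intro θ h1 h2 h3
      have k1 := h θ h1 h2 h3
      have k2 := hGw θ h1 h2 h3
      have hd : Continuous (deriv θ) := h1.continuous_deriv (by simp)
      simp only [smul_sub]
      rw [integral_sub (hsm f hfi _ hd h2.deriv) (hsm G hGc _ hd h2.deriv)]
      rw [iteratedDeriv_one] at k1 k2
      rw [k1, k2, sub_self])
  refine ⟨fun x => c + G x, ⟨hgi, fun x hx => ?_⟩, ?_⟩
  · simp [hG]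
  · filter_upwards [hc] with x hx
    rw [← hx]; ring

theorem eq_on_Icc_of_ae {F c : ℝ → 𝕜} (hab : a < b) (hF : ContinuousOn F (Icc a b))
    (hc : ContinuousOn c (Icc a b))
    (h : ∀ᵐ x ∂(volume : Measure ℝ).restrict (Ioo a b), F x = c x) : EqOn F c (Icc a b) := by
  have h1 : EqOn F c (Ioo a b) :=
    MeasureTheory.Measure.eqOn_open_of_ae_eq h isOpen_Ioo (hF.mono Ioo_subset_Icc_self)
      (hc.mono Ioo_subset_Icc_self)
  rw [← closure_Ioo hab.ne]
  exact h1.of_subset_closure (by rwa [closure_Ioo hab.ne]) (by rwa [closure_Ioo hab.ne])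
    subset_closure le_rfl

/-- The absolutely continuous representative of an element of `Hᵏ ∩ H¹₀`. -/
theorem SobolevZero.exists_repr {k : ℕ} (hab : a < b) (F : SobolevZero 𝕜 a b (k + 1)) :
    ∃ f : ℝ → 𝕜, IsPrimitive a b f (wderiv F 1) ∧ f a = 0 ∧ f b = 0 ∧
      ∀ᵐ x ∂(volume : Measure ℝ).restrict (Ioo a b), wderiv F 0 x = f x := by
  have hw : IsWeakDeriv a b 1 (wderiv F 0) (wderiv F 1) := F.2.1 1
  obtain ⟨f, hf, hf'⟩ := hw.exists_isPrimitive hab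
  obtain ⟨c, hc, hc', hca, hcb⟩ := F.2.2
  have he := eq_on_Icc_of_ae hab (hf.continuousOn hab.le) hc (by
    filter_upwards [hf', hc'] with x h1 h2
    rw [← h1, ← h2]; rfl)
  exact ⟨f, hf, (he ⟨le_rfl, hab.le⟩).trans hca, (he ⟨hab.le, le_rfl⟩).trans hcb, hf'⟩

end Weak

/-! ### Elements of the Sobolev spaces with prescribed derivatives -/

theorem BoundedContinuousFunction.exp_apply (f : ℝ →ᵇ ℂ) (x : ℝ) :
    NormedSpace.exp f x = Complex.exp (f x) := by
  let ev : (ℝ →ᵇ ℂ) →+* ℂ :=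
    { toFun := fun f => f x
      map_one' := rfl
      map_mul' := fun _ _ => rfl
      map_zero' := rfl
      map_add' := fun _ _ => rfl }
  rw [Complex.exp_eq_exp_ℂ]
  exact NormedSpace.map_exp ev (continuous_eval_const x) f

theorem L2.ofBCF_congr {f g : ℝ →ᵇ ℂ} (h : ∀ x ∈ Ioo (0 : ℝ) 1, f x = g x) :
    (L2.ofBCF f : L2 ℂ 0 1) = L2.ofBCF g := by
  refine Lp.ext ?_
  filter_upwards [L2.coeFn_ofBCF (a := 0) (b := 1) f, L2.coeFn_ofBCF (a := 0) (b := 1) g,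
    ae_restrict_mem measurableSet_Ioo] with x h1 h2 hx
  rw [h1, h2, h x hx]

/-- An `L²` function is determined by its primitive. This transfers pointwise identities for a
function to its `L²` derivative. -/
theorem L2.ext_integralTo {f g : L2 ℂ 0 1}
    (h : ∀ x ∈ Icc (0 : ℝ) 1, L2.integralTo x f = L2.integralTo x g) : f = g := by
  have h1 : IsPrimitive 0 1 (fun x => ∫ t in (0 : ℝ)..x, f t) f :=
    ⟨L2.intervalIntegrable zero_le_one f, fun x _ => by simp⟩
  have h2 : IsPrimitive 0 1 (fun x => ∫ t in (0 : ℝ)..x, f t) g :=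
    ⟨L2.intervalIntegrable zero_le_one g, fun x hx => by
      rw [← L2.integralTo_apply hx, ← L2.integralTo_apply hx, h x hx]; simp⟩
  exact Lp.ext (h1.ae_unique zero_le_one h2)

namespace SobolevZero

theorem weakDeriv_one {f₀ : ℝ →ᵇ ℂ} {g : L2 ℂ 0 1} (h : IsPrimitive 0 1 f₀ g) :
    IsWeakDeriv 0 1 1 (L2.ofBCF f₀ : L2 ℂ 0 1) g :=
  ((IsWeakDeriv.refl (f₀ : ℝ → ℂ)).succ zero_le_one h).congr_ae
    (by filter_upwards [L2.coeFn_ofBCF (a := 0) (b := 1) f₀] with x hx using hx.symm)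
    (Eventually.of_forall fun _ => rfl)

theorem isPrimitive_ofBCF {f₀ f₁ : ℝ →ᵇ ℂ} (h : IsPrimitive 0 1 f₀ f₁) :
    IsPrimitive 0 1 f₀ (L2.ofBCF f₁ : L2 ℂ 0 1) :=
  h.congr_ae (L2.intervalIntegrable zero_le_one _) (by
    filter_upwards [L2.coeFn_ofBCF (a := 0) (b := 1) f₁] with x hx using hx.symm)

theorem vanishesAtEnds_ofBCF {f : ℝ →ᵇ ℂ} (hl : f 0 = 0) (hr : f 1 = 0) :
    VanishesAtEnds (L2.ofBCF f : L2 ℂ 0 1) :=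
  ⟨f, f.continuous.continuousOn, L2.coeFn_ofBCF f, hl, hr⟩

/-- The element of `H¹₀` with given derivatives. -/
def mk1 (f₀ : ℝ →ᵇ ℂ) (f₁ : L2 ℂ 0 1) (h₀ : IsPrimitive 0 1 f₀ f₁) (hl : f₀ 0 = 0)
    (hr : f₀ 1 = 0) : SobolevZero ℂ 0 1 1 :=
  ⟨WithLp.toLp 2 ![L2.ofBCF f₀, f₁], by
    refine ⟨fun j => ?_, vanishesAtEnds_ofBCF hl hr⟩
    fin_cases j
    · exact IsWeakDeriv.refl _
    · exact weakDeriv_one h₀⟩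

/-- The element of `H³ ∩ H¹₀` with given derivatives. -/
def mk3 (f₀ f₁ f₂ : ℝ →ᵇ ℂ) (f₃ : L2 ℂ 0 1) (h₀ : IsPrimitive 0 1 f₀ f₁)
    (h₁ : IsPrimitive 0 1 f₁ f₂) (h₂ : IsPrimitive 0 1 f₂ f₃) (hl : f₀ 0 = 0)
    (hr : f₀ 1 = 0) : SobolevZero ℂ 0 1 3 :=
  ⟨WithLp.toLp 2 ![L2.ofBCF f₀, L2.ofBCF f₁, L2.ofBCF f₂, f₃], by
    refine ⟨fun j => ?_, vanishesAtEnds_ofBCF hl hr⟩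
    have c0 : ∀ᵐ x ∂(volume : Measure ℝ).restrict (Ioo 0 1),
        f₀ x = (L2.ofBCF f₀ : L2 ℂ 0 1) x := by
      filter_upwards [L2.coeFn_ofBCF (a := 0) (b := 1) f₀] with x hx using hx.symm
    have c2 : ∀ᵐ x ∂(volume : Measure ℝ).restrict (Ioo 0 1),
        f₂ x = (L2.ofBCF f₂ : L2 ℂ 0 1) x := by
      filter_upwards [L2.coeFn_ofBCF (a := 0) (b := 1) f₂] with x hx using hx.symm
    have w2 : IsWeakDeriv 0 1 2 f₀ f₂ :=
      ((IsWeakDeriv.refl (f₀ : ℝ → ℂ)).succ zero_le_one h₀).succ zero_le_one h₁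
    fin_cases j
    · exact IsWeakDeriv.refl _
    · exact weakDeriv_one (isPrimitive_ofBCF h₀)
    · exact w2.congr_ae c0 c2
    · exact (w2.succ zero_le_one h₂).congr_ae c0 (Eventually.of_forall fun _ => rfl)⟩

end SobolevZero

/-! ### Undoing the gauge transform: derivatives in space and in time -/

namespace Control

open Coeff

variable {T : ℝ} (c : Control T) (a : ℝ → Coeff)

/-- The gauge factor. -/
def phase (t : ℝ) : ℝ →ᵇ ℂ :=
  -- The exponential of the Banach algebra of bounded continuous functions makes continuity in time
  -- with respect to the supremum norm immediate.
  NormedSpace.exp ((Complex.I * (c.u t : ℂ) / 4) • (coordB * coordB) + ((c.U t : ℂ) / 2) • 1)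

theorem phase_apply (t : ℝ) {x : ℝ} (hx : x ∈ Icc (0 : ℝ) 1) :
    c.phase t x = Complex.exp (Complex.I * (c.u t : ℂ) / 4 * (x * x) + (c.U t : ℂ) / 2) := by
  rw [phase, BoundedContinuousFunction.exp_apply]
  have : ((Complex.I * (c.u t : ℂ) / 4) • (coordB * coordB) + ((c.U t : ℂ) / 2) • 1 : ℝ →ᵇ ℂ) x =
    Complex.I * (c.u t : ℂ) / 4 * (coordB x * coordB x) + (c.U t : ℂ) / 2 * 1 := rfl
  rw [this, coordB_apply hx, mul_one]

theorem norm_phase_sq (t : ℝ) {x : ℝ} (hx : x ∈ Icc (0 : ℝ) 1) : ‖c.phase t x‖ ^ 2 = c.g t := by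
  rw [c.phase_apply t hx, Complex.norm_exp, g, ← Real.exp_nat_mul]
  congr 1
  simp [Complex.add_re, Complex.mul_re]
  ring

theorem continuous_phase : Continuous c.phase := by
  have hu := c.cont
  have hU := c.continuous_U
  have : Continuous fun t => ((Complex.I * (c.u t : ℂ) / 4) • (coordB * coordB) +
    ((c.U t : ℂ) / 2) • 1 : ℝ →ᵇ ℂ) := by fun_prop
  exact NormedSpace.exp_continuous.comp this

theorem isPrimitive_phase (t : ℝ) : IsPrimitive 0 1 (c.phase t)
    (fun x => Complex.I * (c.u t : ℂ) / 2 * x * c.phase t x) := by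
  have h := (((((IsPrimitive.id (𝕜 := ℂ) zero_le_one).mul zero_le_one
    (IsPrimitive.id (𝕜 := ℂ) zero_le_one)).const_mul zero_le_one
    (Complex.I * (c.u t : ℂ) / 4)).add zero_le_one
    (IsPrimitive.const ((c.U t : ℂ) / 2))).cexp zero_le_one)
  refine h.congr zero_le_one (fun x hx => c.phase_apply t hx) (fun x hx => ?_)
  rw [c.phase_apply t (Ioo_subset_Icc_self hx)]
  simp only [RCLike.ofReal, Complex.coe_algebraMap]
  ring

/-- The potential that appears in the second derivative of the gauge factor. -/
def gaugeB (t : ℝ) : ℝ →ᵇ ℂ :=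
  (Complex.I * (c.u t : ℂ) / 2) • 1 - ((c.u t : ℂ) ^ 2 / 4) • (coordB * coordB)

def psi0 (t : ℝ) : ℝ →ᵇ ℂ := c.phase t * J0 (a t)

def psi1 (t : ℝ) : ℝ →ᵇ ℂ :=
  c.phase t * (J1 (a t) + (Complex.I * (c.u t : ℂ) / 2) • (coordB * J0 (a t)))

def psi2 (t : ℝ) : ℝ →ᵇ ℂ :=
  c.phase t * (J2 (a t) + (Complex.I * (c.u t : ℂ)) • (coordB * J1 (a t)) + c.gaugeB t * J0 (a t))

/-- Only the term with `ξ'''` is merely in `L²`. It is kept apart from the others, which are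
continuous in `x`; the same holds for `dot1`. -/
def psi3 (t : ℝ) : L2 ℂ 0 1 :=
  L2.mul (c.phase t) (J3 (a t)) + L2.ofBCF (c.phase t *
    ((3 / 2 * Complex.I * (c.u t : ℂ)) • (coordB * J2 (a t)) + (3 : ℂ) • (c.gaugeB t * J1 (a t)) -
      ((3 / 4 * (c.u t : ℂ) ^ 2) • coordB +
        (Complex.I * (c.u t : ℂ) ^ 3 / 8) • (coordB * coordB * coordB)) * J0 (a t)))

/-- The cubic term as a function of the space variable. -/
def cubB (t : ℝ) : ℝ →ᵇ ℂ := J0 (a t) * J0 (a t) * J0 (conj (a t))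

/-- What is left of the logarithmic time derivative of the gauge factor after `-iVx²` has been
added: `u'` has cancelled. -/
def growthB (t : ℝ) : ℝ →ᵇ ℂ :=
  ((c.u t : ℂ) / 2) • 1 + (Complex.I * (c.u t : ℂ) ^ 2 / 4) • (coordB * coordB)

/-- The time derivative without the gauge factor. -/
def rateB (t : ℝ) : ℝ →ᵇ ℂ :=
  Complex.I • J2 (a t) + c.growthB t * J0 (a t) +
    (Complex.I * ((c.ε * c.g t : ℝ) : ℂ)) • cubB a t

def dot0 (t : ℝ) : ℝ →ᵇ ℂ := c.phase t * c.rateB a t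

def dot1 (t : ℝ) : L2 ℂ 0 1 :=
  Complex.I • L2.mul (c.phase t) (J3 (a t)) + L2.ofBCF (c.phase t *
    ((Complex.I * (c.u t : ℂ) ^ 2 / 2) • (coordB * J0 (a t)) + c.growthB t * J1 (a t) +
      (Complex.I * ((c.ε * c.g t : ℝ) : ℂ)) • (J1 (a t) * J0 (a t) * J0 (conj (a t)) +
        J0 (a t) * J1 (a t) * J0 (conj (a t)) + J0 (a t) * J0 (a t) * J1 (conj (a t))) +
      (Complex.I * (c.u t : ℂ) / 2) • (coordB * c.rateB a t)))

section eval

variable (t : ℝ) {x : ℝ}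

theorem gaugeB_apply (hx : x ∈ Icc (0 : ℝ) 1) : c.gaugeB t x =
    Complex.I * (c.u t : ℂ) / 2 - (c.u t : ℂ) ^ 2 / 4 * (x * x) := by
  have : c.gaugeB t x =
    Complex.I * (c.u t : ℂ) / 2 * 1 - (c.u t : ℂ) ^ 2 / 4 * (coordB x * coordB x) := rfl
  rw [this, coordB_apply hx, mul_one]

theorem growthB_apply (hx : x ∈ Icc (0 : ℝ) 1) : c.growthB t x =
    (c.u t : ℂ) / 2 + Complex.I * (c.u t : ℂ) ^ 2 / 4 * (x * x) := by
  have : c.growthB t x =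
    (c.u t : ℂ) / 2 * 1 + Complex.I * (c.u t : ℂ) ^ 2 / 4 * (coordB x * coordB x) := rfl
  rw [this, coordB_apply hx, mul_one]

theorem psi0_apply (x : ℝ) : c.psi0 a t x = c.phase t x * J0 (a t) x := rfl

theorem psi1_apply (hx : x ∈ Icc (0 : ℝ) 1) : c.psi1 a t x =
    c.phase t x * (J1 (a t) x + Complex.I * (c.u t : ℂ) / 2 * (x * J0 (a t) x)) := by
  have : c.psi1 a t x = c.phase t x *
    (J1 (a t) x + Complex.I * (c.u t : ℂ) / 2 * (coordB x * J0 (a t) x)) := rfl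
  rw [this, coordB_apply hx]

theorem psi2_apply (hx : x ∈ Icc (0 : ℝ) 1) : c.psi2 a t x =
    c.phase t x * (J2 (a t) x + Complex.I * (c.u t : ℂ) * (x * J1 (a t) x) +
      (Complex.I * (c.u t : ℂ) / 2 - (c.u t : ℂ) ^ 2 / 4 * (x * x)) * J0 (a t) x) := by
  have : c.psi2 a t x = c.phase t x * (J2 (a t) x +
    Complex.I * (c.u t : ℂ) * (coordB x * J1 (a t) x) + c.gaugeB t x * J0 (a t) x) := rfl
  rw [this, coordB_apply hx, c.gaugeB_apply t hx]

theorem rateB_apply (hx : x ∈ Icc (0 : ℝ) 1) : c.rateB a t x =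
    Complex.I * J2 (a t) x +
      ((c.u t : ℂ) / 2 + Complex.I * (c.u t : ℂ) ^ 2 / 4 * (x * x)) * J0 (a t) x +
      Complex.I * ((c.ε * c.g t : ℝ) : ℂ) * (J0 (a t) x * J0 (a t) x * J0 (conj (a t)) x) := by
  have : c.rateB a t x = Complex.I * J2 (a t) x + c.growthB t x * J0 (a t) x +
    Complex.I * ((c.ε * c.g t : ℝ) : ℂ) * (J0 (a t) x * J0 (a t) x * J0 (conj (a t)) x) := rfl
  rw [this, c.growthB_apply t hx]

theorem dot0_apply (x : ℝ) : c.dot0 a t x = c.phase t x * c.rateB a t x := rfl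

theorem coeFn_psi3 : ∀ᵐ x ∂(volume : Measure ℝ).restrict (Ioo 0 1), c.psi3 a t x =
    c.phase t x * (J3 (a t) x + 3 / 2 * Complex.I * (c.u t : ℂ) * (x * J2 (a t) x) +
      3 * ((Complex.I * (c.u t : ℂ) / 2 - (c.u t : ℂ) ^ 2 / 4 * (x * x)) * J1 (a t) x) -
      (3 / 4 * (c.u t : ℂ) ^ 2 * x + Complex.I * (c.u t : ℂ) ^ 3 / 8 * (x * x * x)) *
        J0 (a t) x) := by
  set F : ℝ →ᵇ ℂ := c.phase t *
    ((3 / 2 * Complex.I * (c.u t : ℂ)) • (coordB * J2 (a t)) + (3 : ℂ) • (c.gaugeB t * J1 (a t)) -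
      ((3 / 4 * (c.u t : ℂ) ^ 2) • coordB +
        (Complex.I * (c.u t : ℂ) ^ 3 / 8) • (coordB * coordB * coordB)) * J0 (a t)) with hF
  have h : c.psi3 a t = L2.mul (c.phase t) (J3 (a t)) + L2.ofBCF F := rfl
  rw [h]
  filter_upwards [Lp.coeFn_add (L2.mul (c.phase t) (J3 (a t))) (L2.ofBCF F : L2 ℂ 0 1),
    L2.coeFn_mul (c.phase t) (J3 (a t)), L2.coeFn_ofBCF (a := 0) (b := 1) F,
    ae_restrict_mem measurableSet_Ioo] with x h1 h2 h3 hx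
  have hx' := Ioo_subset_Icc_self hx
  have e : F x = c.phase t x *
    (3 / 2 * Complex.I * (c.u t : ℂ) * (coordB x * J2 (a t) x) + 3 * (c.gaugeB t x * J1 (a t) x) -
      (3 / 4 * (c.u t : ℂ) ^ 2 * coordB x +
        Complex.I * (c.u t : ℂ) ^ 3 / 8 * (coordB x * coordB x * coordB x)) * J0 (a t) x) := rfl
  rw [h1, Pi.add_apply, h2, h3, e, coordB_apply hx', c.gaugeB_apply t hx']
  ring

theorem coeFn_dot1 : ∀ᵐ x ∂(volume : Measure ℝ).restrict (Ioo 0 1), c.dot1 a t x =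
    c.phase t x * (Complex.I * J3 (a t) x + (Complex.I * (c.u t : ℂ) ^ 2 / 2 * (x * J0 (a t) x) +
      ((c.u t : ℂ) / 2 + Complex.I * (c.u t : ℂ) ^ 2 / 4 * (x * x)) * J1 (a t) x +
      Complex.I * ((c.ε * c.g t : ℝ) : ℂ) * (J1 (a t) x * J0 (a t) x * J0 (conj (a t)) x +
        J0 (a t) x * J1 (a t) x * J0 (conj (a t)) x +
        J0 (a t) x * J0 (a t) x * J1 (conj (a t)) x) +
      Complex.I * (c.u t : ℂ) / 2 * (x * c.rateB a t x))) := by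
  set F : ℝ →ᵇ ℂ := c.phase t *
    ((Complex.I * (c.u t : ℂ) ^ 2 / 2) • (coordB * J0 (a t)) + c.growthB t * J1 (a t) +
      (Complex.I * ((c.ε * c.g t : ℝ) : ℂ)) • (J1 (a t) * J0 (a t) * J0 (conj (a t)) +
        J0 (a t) * J1 (a t) * J0 (conj (a t)) + J0 (a t) * J0 (a t) * J1 (conj (a t))) +
      (Complex.I * (c.u t : ℂ) / 2) • (coordB * c.rateB a t)) with hF
  have h : c.dot1 a t = Complex.I • L2.mul (c.phase t) (J3 (a t)) + L2.ofBCF F := rfl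
  rw [h]
  filter_upwards [Lp.coeFn_add (Complex.I • L2.mul (c.phase t) (J3 (a t))) (L2.ofBCF F : L2 ℂ 0 1),
    Lp.coeFn_smul Complex.I (L2.mul (c.phase t) (J3 (a t))),
    L2.coeFn_mul (c.phase t) (J3 (a t)), L2.coeFn_ofBCF (a := 0) (b := 1) F,
    ae_restrict_mem measurableSet_Ioo] with x h1 h4 h2 h3 hx
  have hx' := Ioo_subset_Icc_self hx
  have e : F x = c.phase t x *
    (Complex.I * (c.u t : ℂ) ^ 2 / 2 * (coordB x * J0 (a t) x) + c.growthB t x * J1 (a t) x +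
      Complex.I * ((c.ε * c.g t : ℝ) : ℂ) * (J1 (a t) x * J0 (a t) x * J0 (conj (a t)) x +
        J0 (a t) x * J1 (a t) x * J0 (conj (a t)) x +
        J0 (a t) x * J0 (a t) x * J1 (conj (a t)) x) +
      Complex.I * (c.u t : ℂ) / 2 * (coordB x * c.rateB a t x)) := rfl
  rw [h1, Pi.add_apply, h4, Pi.smul_apply, h2, h3, e, coordB_apply hx', c.growthB_apply t hx',
    smul_eq_mul]
  ring

theorem isPrimitive_coord : IsPrimitive 0 1 (fun x : ℝ => (x : ℂ)) (fun _ => 1) :=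
  IsPrimitive.id zero_le_one

theorem isPrimitive_psi0 : IsPrimitive 0 1 (c.psi0 a t) (c.psi1 a t) := by
  refine ((c.isPrimitive_phase t).mul zero_le_one (isPrimitive_J0 (a t))).congr zero_le_one
    (fun x _ => rfl) (fun x hx => ?_)
  rw [c.psi1_apply a t (Ioo_subset_Icc_self hx)]
  ring

theorem isPrimitive_psi1 : IsPrimitive 0 1 (c.psi1 a t) (c.psi2 a t) := by
  refine ((c.isPrimitive_phase t).mul zero_le_one ((isPrimitive_J1 (a t)).add zero_le_one
    ((isPrimitive_coord.mul zero_le_one (isPrimitive_J0 (a t))).const_mul zero_le_one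
      (Complex.I * (c.u t : ℂ) / 2)))).congr zero_le_one
    (fun x hx => c.psi1_apply a t hx) (fun x hx => ?_)
  rw [c.psi2_apply a t (Ioo_subset_Icc_self hx)]
  linear_combination (c.phase t x * (c.u t : ℂ) ^ 2 / 4 * x * x * J0 (a t) x) * Complex.I_sq

theorem isPrimitive_psi2 : IsPrimitive 0 1 (c.psi2 a t) (c.psi3 a t) := by
  have hx := isPrimitive_coord
  have hp := (c.isPrimitive_phase t).mul zero_le_one (((isPrimitive_J2 (a t)).add zero_le_one
    ((hx.mul zero_le_one (isPrimitive_J1 (a t))).const_mul zero_le_one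
      (Complex.I * (c.u t : ℂ)))).add zero_le_one
    (((IsPrimitive.const (Complex.I * (c.u t : ℂ) / 2)).sub zero_le_one
      ((hx.mul zero_le_one hx).const_mul zero_le_one ((c.u t : ℂ) ^ 2 / 4))).mul zero_le_one
      (isPrimitive_J0 (a t))))
  refine (hp.congr_left fun x hx => c.psi2_apply a t hx).congr_ae
    (L2.intervalIntegrable zero_le_one _) ?_
  filter_upwards [c.coeFn_psi3 a t] with x h
  rw [h]
  linear_combination (c.phase t x * ((c.u t : ℂ) ^ 2 / 2 * x * x * J1 (a t) x +
    (c.u t : ℂ) ^ 2 / 4 * x * J0 (a t) x)) * Complex.I_sq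

theorem isPrimitive_dot0 : IsPrimitive 0 1 (c.dot0 a t) (c.dot1 a t) := by
  have hx := isPrimitive_coord
  have hJ := isPrimitive_J0 (a t)
  have hr := (((isPrimitive_J2 (a t)).const_mul zero_le_one Complex.I).add zero_le_one
    (((IsPrimitive.const ((c.u t : ℂ) / 2)).add zero_le_one
      ((hx.mul zero_le_one hx).const_mul zero_le_one (Complex.I * (c.u t : ℂ) ^ 2 / 4))).mul
      zero_le_one hJ)).add zero_le_one
    (((hJ.mul zero_le_one hJ).mul zero_le_one (isPrimitive_J0 (conj (a t)))).const_mul zero_le_one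
      (Complex.I * ((c.ε * c.g t : ℝ) : ℂ)))
  have hr' := hr.congr_left (g := c.rateB a t) fun x hx => c.rateB_apply a t hx
  refine (((c.isPrimitive_phase t).mul zero_le_one hr').congr_left fun x _ => rfl).congr_ae
    (L2.intervalIntegrable zero_le_one _) ?_
  filter_upwards [c.coeFn_dot1 a t] with x h
  rw [h]
  ring

theorem psi0_zero : c.psi0 a t 0 = 0 := by rw [psi0_apply, J0_zero, mul_zero]

theorem psi0_one : c.psi0 a t 1 = 0 := by rw [psi0_apply, J0_one, mul_zero]

theorem rateB_zero : c.rateB a t 0 = 0 := by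
  rw [rateB_apply c a t ⟨le_rfl, zero_le_one⟩, J0_zero, J2_zero]; simp

theorem rateB_one : c.rateB a t 1 = 0 := by
  rw [rateB_apply c a t ⟨zero_le_one, le_rfl⟩, J0_one, J2_one]; simp

theorem dot0_zero : c.dot0 a t 0 = 0 := by rw [dot0_apply, rateB_zero, mul_zero]

theorem dot0_one : c.dot0 a t 1 = 0 := by rw [dot0_apply, rateB_one, mul_zero]

end eval

/-- The solution as a path in `H³ ∩ H¹₀`. -/
def psi (t : ℝ) : SobolevZero ℂ 0 1 3 :=
  SobolevZero.mk3 (c.psi0 a t) (c.psi1 a t) (c.psi2 a t) (c.psi3 a t) (c.isPrimitive_psi0 a t)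
    (c.isPrimitive_psi1 a t) (c.isPrimitive_psi2 a t) (c.psi0_zero a t) (c.psi0_one a t)

/-- The time derivative of the solution as a path in `H¹₀`. -/
def psiDot (t : ℝ) : SobolevZero ℂ 0 1 1 :=
  SobolevZero.mk1 (c.dot0 a t) (c.dot1 a t) (c.isPrimitive_dot0 a t) (c.dot0_zero a t)
    (c.dot0_one a t)

section continuity

variable {a}

theorem continuous_psi0 (ha : Continuous a) : Continuous (c.psi0 a) :=
  c.continuous_phase.mul (J0.continuous.comp ha)

theorem continuous_J0_conj (ha : Continuous a) : Continuous fun t => J0 (conj (a t)) :=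
  J0.continuous.comp (continuous_conj.comp ha)

theorem continuous_J1_conj (ha : Continuous a) : Continuous fun t => J1 (conj (a t)) :=
  J1.continuous.comp (continuous_conj.comp ha)

theorem continuous_psi1 (ha : Continuous a) : Continuous (c.psi1 a) := by
  have hp := c.continuous_phase
  have hu := c.cont
  unfold psi1; fun_prop

theorem continuous_gaugeB : Continuous c.gaugeB := by
  have hu := c.cont
  unfold gaugeB; fun_prop

theorem continuous_growthB : Continuous c.growthB := by
  have hu := c.cont
  unfold growthB; fun_prop

theorem continuous_psi2 (ha : Continuous a) : Continuous (c.psi2 a) := by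
  have hp := c.continuous_phase
  have hg := c.continuous_gaugeB
  have hu := c.cont
  unfold psi2; fun_prop

theorem continuous_psi3 (ha : Continuous a) : Continuous (c.psi3 a) := by
  have hp := c.continuous_phase
  have hg := c.continuous_gaugeB
  have hu := c.cont
  unfold psi3; fun_prop

theorem continuous_rateB (ha : Continuous a) : Continuous (c.rateB a) := by
  have hp := c.continuous_phase
  have hg := c.continuous_growthB
  have hu := c.cont
  have hG := c.continuous_g
  have hc := continuous_J0_conj ha
  unfold rateB cubB; fun_prop

theorem continuous_dot0 (ha : Continuous a) : Continuous (c.dot0 a) :=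
  c.continuous_phase.mul (c.continuous_rateB ha)

theorem continuous_dot1 (ha : Continuous a) : Continuous (c.dot1 a) := by
  have hp := c.continuous_phase
  have hg := c.continuous_growthB
  have hr := c.continuous_rateB ha
  have hu := c.cont
  have hG := c.continuous_g
  have hc := continuous_J0_conj ha
  have hc1 := continuous_J1_conj ha
  unfold dot1; fun_prop

theorem continuous_psi (ha : Continuous a) : Continuous (c.psi a) := by
  refine Continuous.subtype_mk ((PiLp.continuous_toLp 2 _).comp (continuous_pi fun j => ?_)) _
  fin_cases j
  · exact L2.ofBCF.continuous.comp (c.continuous_psi0 ha)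
  · exact L2.ofBCF.continuous.comp (c.continuous_psi1 ha)
  · exact L2.ofBCF.continuous.comp (c.continuous_psi2 ha)
  · exact c.continuous_psi3 ha

theorem continuous_psiDot (ha : Continuous a) : Continuous (c.psiDot a) := by
  refine Continuous.subtype_mk ((PiLp.continuous_toLp 2 _).comp (continuous_pi fun j => ?_)) _
  fin_cases j
  · exact L2.ofBCF.continuous.comp (c.continuous_dot0 ha)
  · exact c.continuous_dot1 ha

end continuity

end Control

/-! ### The classical solution: regularity in time, boundary values and norm -/

theorem SobolevZero.hasDerivWithinAt_of_coe {k : ℕ} {f : ℝ → SobolevZero ℂ 0 1 k}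
    {f' : SobolevZero ℂ 0 1 k} {s : Set ℝ} {t : ℝ}
    (h : HasDerivWithinAt (fun t => (f t : PiLp 2 fun _ : Fin (k + 1) => L2 ℂ 0 1)) f' s t) :
    HasDerivWithinAt f f' s t := by
  rw [hasDerivWithinAt_iff_tendsto_slope] at h ⊢
  rw [Topology.IsInducing.subtypeVal.tendsto_nhds_iff]
  exact h

namespace Control

open Coeff

variable {T : ℝ} (c : Control T) {a : ℝ → Coeff} {a₀ : Coeff}

theorem isPrimitive_phase_time {x : ℝ} (hx : x ∈ Icc (0 : ℝ) 1) :
    IsPrimitive 0 T (fun t => c.phase t x)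
      (fun t => (Complex.I * (c.du t : ℂ) / 4 * (x * x) + (c.u t : ℂ) / 2) * c.phase t x) := by
  have hT := c.T_pos.le
  have hU : IsPrimitive 0 T c.U c.u := IsPrimitive.of_continuous hT c.hasDerivAt_U c.cont
  have h := ((c.prim.ofReal.const_mul hT (Complex.I / 4 * (x * x))).add hT
    (hU.ofReal.const_mul hT (1 / 2 : ℂ))).cexp hT
  have e : ∀ t, Complex.I / 4 * (x * x) * (c.u t : ℂ) + 1 / 2 * (c.U t : ℂ) =
      Complex.I * (c.u t : ℂ) / 4 * (x * x) + (c.U t : ℂ) / 2 := fun t => by ring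
  refine h.congr hT (fun t _ => ?_) (fun t _ => ?_)
  · rw [c.phase_apply t hx, e]
  · rw [c.phase_apply t hx, e]; ring

/-- Both the gauge factor and `ξ` are only absolutely continuous in time, since `u'` is only in
`L²`. In the product rule the two occurrences of `u'` cancel, so the derivative is continuous in
time. -/
theorem IsMild.isPrimitive_psi0_time (h : c.IsMild cubic a₀ a T) (ha : Continuous a) {x : ℝ}
    (hx : x ∈ Icc (0 : ℝ) 1) :
    IsPrimitive 0 T (fun t => c.psi0 a t x) (fun t => c.dot0 a t x) := by
  have hT := c.T_pos.le
  refine ((c.isPrimitive_phase_time hx).mul hT (h.isPrimitive_J0 c hT le_rfl ha hx)).congr hT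
    (fun t _ => rfl) (fun t _ => ?_)
  rw [dot0_apply, c.rateB_apply a t hx, c.forceB_apply t hx, J0_conj, V]
  push_cast
  ring

theorem IsMild.ofBCF_psi0_eq (h : c.IsMild cubic a₀ a T) (ha : Continuous a) {t : ℝ}
    (ht : t ∈ Icc 0 T) : (L2.ofBCF (c.psi0 a t) : L2 ℂ 0 1) =
      L2.ofBCF (c.psi0 a 0) + ∫ s in (0 : ℝ)..t, L2.ofBCF (c.dot0 a s) := by
  have hi : IntervalIntegrable (c.dot0 a) volume 0 t :=
    (c.continuous_dot0 ha).intervalIntegrable _ _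
  rw [ContinuousLinearMap.intervalIntegral_comp_comm _ hi, ← map_add]
  refine L2.ofBCF_congr fun x hx => ?_
  have e : (∫ s in (0 : ℝ)..t, c.dot0 a s) x = ∫ s in (0 : ℝ)..t, c.dot0 a s x :=
    ((BoundedContinuousFunction.evalCLM ℂ x).intervalIntegral_comp_comm hi).symm
  rw [BoundedContinuousFunction.add_apply, e]
  exact (h.isPrimitive_psi0_time c ha (Ioo_subset_Icc_self hx)).eq t ht

/-- Integrating in `x` from `0`, where `ψ` and `∂ₜψ` vanish, reduces the claim to the pointwise
identity for `ψ`. No time derivative of higher space derivatives is needed. -/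
theorem IsMild.ofBCF_psi1_eq (h : c.IsMild cubic a₀ a T) (ha : Continuous a) {t : ℝ}
    (ht : t ∈ Icc 0 T) : (L2.ofBCF (c.psi1 a t) : L2 ℂ 0 1) =
      L2.ofBCF (c.psi1 a 0) + ∫ s in (0 : ℝ)..t, c.dot1 a s := by
  have hi : IntervalIntegrable (c.dot1 a) volume 0 t :=
    (c.continuous_dot1 ha).intervalIntegrable _ _
  refine L2.ext_integralTo fun x hx => ?_
  have h1 : ∀ s, L2.integralTo x (L2.ofBCF (c.psi1 a s) : L2 ℂ 0 1) = c.psi0 a s x := fun s => by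
    have := (SobolevZero.isPrimitive_ofBCF (c.isPrimitive_psi0 a s)).eq x hx
    rw [L2.integralTo_apply hx, this, psi0_zero, zero_add]
  have h2 : ∀ s, L2.integralTo x (c.dot1 a s) = c.dot0 a s x := fun s => by
    have := (c.isPrimitive_dot0 a s).eq x hx
    rw [L2.integralTo_apply hx, this, dot0_zero, zero_add]
  rw [map_add, h1, h1, ← ContinuousLinearMap.intervalIntegral_comp_comm _ hi]
  simp only [h2]
  exact (h.isPrimitive_psi0_time c ha hx).eq t ht

theorem _root_.hasDerivWithinAt_of_eq_integral {X : Type*} [NormedAddCommGroup X] [NormedSpace ℝ X]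
    [CompleteSpace X] {A B : ℝ → X} {s : Set ℝ} (hB : Continuous B)
    (h : ∀ t ∈ s, A t = A 0 + ∫ r in (0 : ℝ)..t, B r) {t : ℝ} (ht : t ∈ s) :
    HasDerivWithinAt A (B t) s t := by
  have h1 : HasDerivAt (fun t => A 0 + ∫ r in (0 : ℝ)..t, B r) (B t) t :=
    (intervalIntegral.integral_hasDerivAt_right (hB.intervalIntegrable _ _)
      (hB.stronglyMeasurableAtFilter _ _) hB.continuousAt).const_add _
  exact h1.hasDerivWithinAt.congr h (h t ht)

theorem IsMild.hasDerivWithinAt_psi (h : c.IsMild cubic a₀ a T) (ha : Continuous a) {t : ℝ}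
    (ht : t ∈ Icc 0 T) :
    HasDerivWithinAt (fun t => toH10 (c.psi a t)) (c.psiDot a t) (Icc 0 T) t := by
  refine SobolevZero.hasDerivWithinAt_of_coe ?_
  have h0 := hasDerivWithinAt_of_eq_integral (L2.ofBCF.continuous.comp (c.continuous_dot0 ha))
    (fun t ht => h.ofBCF_psi0_eq c ha ht) ht
  have h1 := hasDerivWithinAt_of_eq_integral (c.continuous_dot1 ha)
    (fun t ht => h.ofBCF_psi1_eq c ha ht) ht
  have h2 : HasDerivWithinAt (fun t => (![L2.ofBCF (c.psi0 a t), L2.ofBCF (c.psi1 a t)] :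
      Fin 2 → L2 ℂ 0 1)) ![L2.ofBCF (c.dot0 a t), c.dot1 a t] (Icc 0 T) t := by
    rw [hasDerivWithinAt_pi]
    intro j
    fin_cases j
    · exact h0
    · exact h1
  exact ((PiLp.continuousLinearEquiv 2 ℝ (fun _ : Fin 2 => L2 ℂ 0 1)).symm.toContinuousLinearMap
    |>.hasFDerivAt.comp_hasDerivWithinAt t h2)

theorem IsMild.contDiffOn_psi (h : c.IsMild cubic a₀ a T) (ha : Continuous a) :
    ContDiffOn ℝ 1 (fun t => toH10 (c.psi a t)) (Icc 0 T) := by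
  have hu := uniqueDiffOn_Icc c.T_pos
  rw [contDiffOn_one_iff_derivWithin hu]
  refine ⟨fun t ht => (h.hasDerivWithinAt_psi c ha ht).differentiableWithinAt, ?_⟩
  exact (c.continuous_psiDot ha).continuousOn.congr fun t ht =>
    (h.hasDerivWithinAt_psi c ha ht).derivWithin (hu t ht)

theorem IsMild.isClassicalSolution {φ : ℝ → ℝ} (h : c.IsMild cubic a₀ a T) (ha : Continuous a)
    (hφ : ∀ x ∈ Icc (0 : ℝ) 1, J0 a₀ x = (φ x : ℂ)) :
    IsClassicalSolution c.ε T c.u φ (c.psi a) where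
  continuousOn := (c.continuous_psi ha).continuousOn
  contDiffOn := h.contDiffOn_psi c ha
  equation := by
    intro t ht
    have hd := ((h.hasDerivWithinAt_psi c ha (Ioo_subset_Icc_self ht)).hasDerivAt
      (Icc_mem_nhds ht.1 ht.2)).deriv
    rw [hd]
    have e0 : wderiv (c.psiDot a t) 0 = L2.ofBCF (c.dot0 a t) := rfl
    have e1 : wderiv (c.psi a t) 0 = L2.ofBCF (c.psi0 a t) := rfl
    have e2 : wderiv (c.psi a t) 1 = L2.ofBCF (c.psi1 a t) := rfl
    have e3 : wderiv (c.psi a t) 2 = L2.ofBCF (c.psi2 a t) := rfl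
    rw [e0, e1, e2, e3]
    filter_upwards [L2.coeFn_ofBCF (a := 0) (b := 1) (c.dot0 a t),
      L2.coeFn_ofBCF (a := 0) (b := 1) (c.psi0 a t), L2.coeFn_ofBCF (a := 0) (b := 1) (c.psi1 a t),
      L2.coeFn_ofBCF (a := 0) (b := 1) (c.psi2 a t), ae_restrict_mem measurableSet_Ioo]
      with x h0 h1 h2 h3 hx
    have hx' := Ioo_subset_Icc_self hx
    have hn : ((‖c.psi0 a t x‖ ^ 2 : ℝ) : ℂ) =
        (c.g t : ℂ) * (J0 (a t) x * starRingEnd ℂ (J0 (a t) x)) := by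
      rw [psi0_apply, norm_mul, mul_pow, c.norm_phase_sq t hx', Complex.mul_conj,
        Complex.normSq_eq_norm_sq]
      push_cast; rfl
    rw [h0, h1, h2, h3, hn, dot0_apply, c.rateB_apply a t hx', psi0_apply, c.psi1_apply a t hx',
      c.psi2_apply a t hx', J0_conj]
    push_cast
    linear_combination (c.phase t x * (J2 (a t) x - (c.u t : ℂ) ^ 2 / 4 * (x * x) * J0 (a t) x +
      (c.ε : ℂ) * (c.g t : ℂ) * (J0 (a t) x * J0 (a t) x * starRingEnd ℂ (J0 (a t) x)))) *
      Complex.I_sq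
  initial := by
    have e1 : wderiv (c.psi a 0) 0 = L2.ofBCF (c.psi0 a 0) := rfl
    rw [e1]
    filter_upwards [L2.coeFn_ofBCF (a := 0) (b := 1) (c.psi0 a 0),
      ae_restrict_mem measurableSet_Ioo] with x h1 hx
    have hx' := Ioo_subset_Icc_self hx
    rw [h1, psi0_apply, c.phase_apply 0 hx', c.left, c.U_zero, h.zero c c.T_pos.le, hφ x hx']
    simp

/-- In general `ψ''` has the boundary term `i u ξ'` at `x = 1`; it disappears at time `T` because
`u(T) = 0`. -/
theorem memH3Paren_psi : MemH3Paren (c.psi a T) := by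
  have e0 : wderiv (c.psi a T) 0 = L2.ofBCF (c.psi0 a T) := rfl
  have e2 : wderiv (c.psi a T) 2 = L2.ofBCF (c.psi2 a T) := rfl
  rw [MemH3Paren, e0, e2]
  refine ⟨SobolevZero.vanishesAtEnds_ofBCF (c.psi0_zero a T) (c.psi0_one a T),
    SobolevZero.vanishesAtEnds_ofBCF ?_ ?_⟩
  · rw [c.psi2_apply a T ⟨le_rfl, zero_le_one⟩, c.right, J2_zero, J0_zero]; simp
  · rw [c.psi2_apply a T ⟨zero_le_one, le_rfl⟩, c.right, J2_one, J0_one]; simp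

theorem IsMild.norm_psi {φ : ℝ → ℝ} (h : c.IsMild cubic a₀ a T) (ha : Continuous a)
    (hφ : ∀ x ∈ Icc (0 : ℝ) 1, J0 a₀ x = (φ x : ℂ)) {t : ℝ} (ht : t ∈ Icc 0 T) :
    ‖wderiv (c.psi a t) 0‖ =
      √(∫ x in Ioo (0 : ℝ) 1, φ x ^ 2) * Real.exp (1 / 2 * ∫ s in (0 : ℝ)..t, c.u s) := by
  have e1 : wderiv (c.psi a t) 0 = L2.ofBCF (c.psi0 a t) := rfl
  have hm : mass a₀ = ∫ x in Ioo (0 : ℝ) 1, φ x ^ 2 := by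
    rw [integral_Ioo_eq zero_le_one, mass]
    refine intervalIntegral.integral_congr fun x hx => ?_
    rw [uIcc_of_le zero_le_one] at hx
    simp only [dens, hφ x hx, Complex.norm_real, Real.norm_eq_abs, sq_abs]
  have h2 : ‖wderiv (c.psi a t) 0‖ ^ 2 = mass a₀ * c.g t := by
    rw [e1, L2.norm_sq_eq, integral_Ioo_eq zero_le_one, ← h.mass_eq c c.T_pos.le le_rfl ha ht, mass,
      ← intervalIntegral.integral_mul_const]
    refine intervalIntegral_congr_ae_Ioo zero_le_one ?_
    filter_upwards [L2.coeFn_ofBCF (a := 0) (b := 1) (c.psi0 a t),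
      ae_restrict_mem measurableSet_Ioo] with x h1 hx
    rw [h1, psi0_apply, norm_mul, mul_pow, c.norm_phase_sq t (Ioo_subset_Icc_self hx), dens,
      mul_comm]
  rw [← Real.sqrt_sq (norm_nonneg _), h2, Real.sqrt_mul (mass_nonneg _), hm]
  congr 1
  rw [Real.sqrt_eq_iff_mul_self_eq (c.g_pos t).le (Real.exp_pos _).le, ← Real.exp_add, g, U]
  congr 1
  ring

end Control

/-! ### Uniqueness of classical solutions -/

theorem IsWeakDeriv.ae_unique {𝕜 : Type} [RCLike 𝕜] {a b : ℝ} {k : ℕ} {f : ℝ → 𝕜} {g g' : L2 𝕜 a b}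
    (h : IsWeakDeriv a b k f g) (h' : IsWeakDeriv a b k f g') : g = g' := by
  have hi : IntegrableOn (fun x => g x - g' x) (Ioo a b) := (L2.integrable g).sub (L2.integrable g')
  have hz := isOpen_Ioo.ae_eq_zero_of_integral_contDiff_smul_eq_zero
    (f := fun x => g x - g' x) (U := Ioo a b) (μ := volume) hi.locallyIntegrableOn (by
    intro φ h1 h2 h3
    have e0 : ∫ x, φ x • (g x - g' x) = ∫ x in Ioo a b, φ x • (g x - g' x) := by
      refine (setIntegral_eq_integral_of_forall_compl_eq_zero fun x hx => ?_).symm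
      rw [image_eq_zero_of_notMem_tsupport fun h => hx (h3 h), zero_smul]
    have k1 := (h φ h1 h2 h3).symm.trans (h' φ h1 h2 h3)
    have k2 := mul_left_cancel₀ (pow_ne_zero k (neg_ne_zero.2 (one_ne_zero (α := 𝕜)))) k1
    rw [e0]
    simp only [smul_sub]
    rw [integral_sub (integrable_smul_L2 h1.continuous h2 g)
      (integrable_smul_L2 h1.continuous h2 g'), k2, sub_self])
  refine Lp.ext ?_
  rw [EventuallyEq, ae_restrict_iff' measurableSet_Ioo]
  filter_upwards [hz] with x hx hx'
  exact sub_eq_zero.1 (hx hx')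

theorem IsWeakDeriv.weakDeriv_of_succ {𝕜 : Type} [RCLike 𝕜] {a b : ℝ} {k : ℕ} {f g g' : ℝ → 𝕜}
    (h : IsWeakDeriv a b k f g) (h' : IsWeakDeriv a b (k + 1) f g') : IsWeakDeriv a b 1 g g' := by
  intro θ h1 h2 h3
  have hd : ContDiff ℝ ∞ (deriv θ) := (contDiff_infty_iff_deriv.1 h1).2
  have k1 := h (deriv θ) hd h2.deriv (tsupport_deriv_subset.trans h3)
  have k2 := h' θ h1 h2 h3
  rw [iteratedDeriv_succ', k1, pow_succ, mul_assoc] at k2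
  have k3 := mul_left_cancel₀ (pow_ne_zero k (neg_ne_zero.2 (one_ne_zero (α := 𝕜)))) k2
  rw [iteratedDeriv_one, k3, pow_one]

namespace SobolevZero

/-- Weak derivatives are unique, so an `L²` estimate suffices for uniqueness in `H³`. -/
theorem ext_of_wderiv_zero {k : ℕ} {F G : SobolevZero ℂ 0 1 k} (h : wderiv F 0 = wderiv G 0) :
    F = G := by
  refine Subtype.ext (PiLp.ext fun j => ?_)
  have h1 : IsWeakDeriv 0 1 j (wderiv F 0) (wderiv F j) := F.2.1 j
  have h2 : IsWeakDeriv 0 1 j (wderiv G 0) (wderiv G j) := G.2.1 j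
  rw [h] at h1
  exact h1.ae_unique h2

theorem norm_wderiv_le {k : ℕ} (F : SobolevZero ℂ 0 1 k) (j : Fin (k + 1)) : ‖wderiv F j‖ ≤ ‖F‖ :=
  PiLp.norm_apply_le F.1 j

/-- The representative vanishes at `0`, so it is bounded by the `L¹` norm of its derivative, hence
by the `L²` norm. -/
theorem ae_norm_le {k : ℕ} (F : SobolevZero ℂ 0 1 (k + 1)) :
    ∀ᵐ x ∂(volume : Measure ℝ).restrict (Ioo 0 1), ‖wderiv F 0 x‖ ≤ ‖F‖ := by
  obtain ⟨f, hf, hf0, -, hfe⟩ := SobolevZero.exists_repr one_pos F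
  have hi : IntervalIntegrable (fun x => ‖wderiv F 1 x‖) volume 0 1 :=
    (L2.intervalIntegrable zero_le_one _).norm
  have hi2 : IntervalIntegrable (fun x => ‖wderiv F 1 x‖ ^ 2) volume 0 1 := by
    rw [intervalIntegrable_iff_integrableOn_Ioo_of_le zero_le_one]
    exact (memLp_two_iff_integrable_sq_norm (Lp.memLp _).1).1 (Lp.memLp (wderiv F 1))
  have h1 : ∫ x in (0 : ℝ)..1, ‖wderiv F 1 x‖ ≤ ‖F‖ := by
    have h2 := sq_intervalIntegral_le zero_le_one hi hi2
    rw [one_mul, ← integral_Ioo_eq zero_le_one, ← integral_Ioo_eq zero_le_one, ← L2.norm_sq_eq] at h2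
    rw [← integral_Ioo_eq zero_le_one]
    exact (abs_le_of_sq_le_sq' h2 (norm_nonneg _)).2.trans (SobolevZero.norm_wderiv_le F 1)
  filter_upwards [hfe, ae_restrict_mem measurableSet_Ioo] with x hx hx'
  rw [hx, hf.eq x (Ioo_subset_Icc_self hx'), hf0, zero_add]
  refine (intervalIntegral.norm_integral_le_integral_norm hx'.1.le).trans (le_trans ?_ h1)
  exact intervalIntegral.integral_mono_interval le_rfl hx'.1.le hx'.2.le
    (Eventually.of_forall fun _ => norm_nonneg _) hi

theorem wderiv_sub {k : ℕ} (F G : SobolevZero ℂ 0 1 k) (j : Fin (k + 1)) :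
    wderiv (F - G) j = wderiv F j - wderiv G j := rfl

end SobolevZero

theorem norm_cubic_diff_le {z w : ℂ} {M : ℝ} (hz : ‖z‖ ≤ M) (hw : ‖w‖ ≤ M) :
    ‖((‖z‖ ^ 2 : ℝ) : ℂ) * z - ((‖w‖ ^ 2 : ℝ) : ℂ) * w‖ ≤ 3 * M ^ 2 * ‖z - w‖ := by
  have hM : 0 ≤ M := (norm_nonneg _).trans hz
  have e : ((‖z‖ ^ 2 : ℝ) : ℂ) * z - ((‖w‖ ^ 2 : ℝ) : ℂ) * w =
      (z - w) * starRingEnd ℂ z * z + w * starRingEnd ℂ (z - w) * z +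
        w * starRingEnd ℂ w * (z - w) := by
    rw [← Complex.normSq_eq_norm_sq, ← Complex.normSq_eq_norm_sq, ← Complex.mul_conj,
      ← Complex.mul_conj, map_sub]
    ring
  rw [e]
  calc _ ≤ ‖z - w‖ * ‖z‖ * ‖z‖ + ‖w‖ * ‖z - w‖ * ‖z‖ + ‖w‖ * ‖w‖ * ‖z - w‖ := by
        refine (norm_add₃_le).trans (le_of_eq ?_)
        simp only [norm_mul, RCLike.norm_conj]
    _ ≤ ‖z - w‖ * M * M + M * ‖z - w‖ * M + M * M * ‖z - w‖ := by gcongr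
    _ = _ := by ring

/-- The dissipation estimate for the difference of two solutions. -/
theorem re_integral_diff_le {ε v M : ℝ} {F G : SobolevZero ℂ 0 1 3} {Ft Gt : L2 ℂ 0 1}
    (hF : ‖F‖ ≤ M) (hG : ‖G‖ ≤ M)
    (eF : ∀ᵐ x ∂(volume : Measure ℝ).restrict (Ioo (0 : ℝ) 1), Complex.I * Ft x =
      - wderiv F 2 x - (ε : ℂ) * (‖wderiv F 0 x‖ ^ 2 : ℝ) * wderiv F 0 x +
        Complex.I * (v : ℂ) * (wderiv F 0 x + (x : ℂ) * wderiv F 1 x))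
    (eG : ∀ᵐ x ∂(volume : Measure ℝ).restrict (Ioo (0 : ℝ) 1), Complex.I * Gt x =
      - wderiv G 2 x - (ε : ℂ) * (‖wderiv G 0 x‖ ^ 2 : ℝ) * wderiv G 0 x +
        Complex.I * (v : ℂ) * (wderiv G 0 x + (x : ℂ) * wderiv G 1 x)) :
    ∫ x in Ioo (0 : ℝ) 1, (starRingEnd ℂ ((wderiv F 0 - wderiv G 0) x) * (Ft - Gt) x).re ≤
      (|v| / 2 + |ε| * (3 * M ^ 2)) * ‖wderiv F 0 - wderiv G 0‖ ^ 2 := by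
  obtain ⟨w, hw, hw0, hw1, hwe⟩ := SobolevZero.exists_repr one_pos (F - G)
  have hwk : IsWeakDeriv 0 1 1 (wderiv (F - G) 1) (wderiv (F - G) 2) := by
    have h1 : IsWeakDeriv 0 1 1 (wderiv (F - G) 0) (wderiv (F - G) 1) := (F - G).2.1 1
    have h2 : IsWeakDeriv 0 1 2 (wderiv (F - G) 0) (wderiv (F - G) 2) := (F - G).2.1 2
    exact h1.weakDeriv_of_succ h2
  obtain ⟨w₁, hw₁, hw₁e⟩ := hwk.exists_isPrimitive one_pos
  set W := wderiv F 0 - wderiv G 0 with hW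
  have hx : IsPrimitive 0 1 (fun x : ℝ => (x : ℂ)) (fun _ => 1) := IsPrimitive.id zero_le_one
  -- With `w` the difference, the function `Re(i w̄ w' + (v/2) x |w|²)` vanishes at both ends, so
  -- its derivative has integral zero. Subtracting this derivative removes all derivatives of `w`
  -- from the integrand and leaves `(v/2)|w|²` and the cubic difference.
  have hH := (((hw.star.mul zero_le_one hw₁).const_mul zero_le_one Complex.I).add zero_le_one
    ((hx.mul zero_le_one (hw.mul zero_le_one hw.star)).const_mul zero_le_one ((v : ℂ) / 2))).re
  have hz := hH.integral_eq_sub zero_le_one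
  simp only [hw0, hw1, map_zero, zero_mul, mul_zero, add_zero, sub_self] at hz
  rw [← integral_Ioo_eq zero_le_one] at hz
  have hHi := hH.integrable
  rw [intervalIntegrable_iff_integrableOn_Ioo_of_le zero_le_one] at hHi
  have hWi : Integrable (fun x => (starRingEnd ℂ (W x) * (Ft - Gt) x).re)
      ((volume : Measure ℝ).restrict (Ioo (0 : ℝ) 1)) := by
    have := (L2.integrable_inner (𝕜 := ℂ) W (Ft - Gt)).re
    refine this.congr (Eventually.of_forall fun x => ?_)
    simp [RCLike.inner_apply, mul_comm]
  have hW2 : Integrable (fun x => ‖W x‖ ^ 2) ((volume : Measure ℝ).restrict (Ioo (0 : ℝ) 1)) :=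
    (memLp_two_iff_integrable_sq_norm (Lp.memLp W).1).1 (Lp.memLp W)
  have hs := integral_sub hWi hHi
  rw [hz, sub_zero] at hs
  rw [L2.norm_sq_eq, ← integral_const_mul, ← hs]
  refine integral_mono_ae (hWi.sub hHi) (hW2.const_mul _) ?_
  filter_upwards [eF, eG, hwe, hw₁e, SobolevZero.ae_norm_le F, SobolevZero.ae_norm_le G, Lp.coeFn_sub Ft Gt,
    Lp.coeFn_sub (wderiv F 0) (wderiv G 0), Lp.coeFn_sub (wderiv F 1) (wderiv G 1),
    Lp.coeFn_sub (wderiv F 2) (wderiv G 2)] with x k1 k2 k3 k4 k5 k6 k7 k8 k9 k10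
  rw [SobolevZero.wderiv_sub] at k3 k4 ⊢
  rw [SobolevZero.wderiv_sub, ← k4, ← k3]
  rw [k7, hW, k8, k9, k10]
  simp only [Pi.sub_apply]
  have hd := norm_cubic_diff_le (k5.trans hF) (k6.trans hG)
  set z := wderiv F 0 x
  set y := wderiv G 0 x
  set cz := ((‖z‖ ^ 2 : ℝ) : ℂ) * z - ((‖y‖ ^ 2 : ℝ) : ℂ) * y with hcz
  have k11 : Ft x - Gt x = Complex.I * (wderiv F 2 x - wderiv G 2 x) + Complex.I * (ε : ℂ) * cz +
      (v : ℂ) * ((z - y) + (x : ℂ) * (wderiv F 1 x - wderiv G 1 x)) := by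
    rw [hcz]
    linear_combination -Complex.I * k1 + Complex.I * k2 + (Ft x - Gt x - v * (z - y +
      x * (wderiv F 1 x - wderiv G 1 x))) * Complex.I_sq
  rw [k11]
  generalize wderiv F 1 x - wderiv G 1 x = p
  generalize wderiv F 2 x - wderiv G 2 x = q
  set r := z - y with hr
  have h1 : (starRingEnd ℂ r * (Complex.I * q + Complex.I * (ε : ℂ) * cz + v * (r + x * p))).re -
      (Complex.I * (starRingEnd ℂ p * p + starRingEnd ℂ r * q) +
        (v : ℂ) / 2 * (1 * (r * starRingEnd ℂ r) +
          x * (p * starRingEnd ℂ r + r * starRingEnd ℂ p))).re =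
      v / 2 * ‖r‖ ^ 2 + ε * (starRingEnd ℂ r * (Complex.I * cz)).re := by
    rw [← Complex.normSq_eq_norm_sq, Complex.normSq_apply]
    have hv : (v : ℂ) / 2 = ((v / 2 : ℝ) : ℂ) := by push_cast; rfl
    rw [hv]
    simp only [Complex.mul_im, Complex.mul_re, Complex.add_re, Complex.add_im, Complex.ofReal_re,
      Complex.ofReal_im, Complex.conj_re, Complex.conj_im, Complex.I_re, Complex.I_im,
      Complex.one_re, Complex.one_im]
    ring
  rw [h1, add_mul]
  refine add_le_add (by gcongr; exact le_abs_self v) ((le_abs_self _).trans ?_)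
  rw [abs_mul, mul_assoc]
  gcongr
  refine (Complex.abs_re_le_norm _).trans ?_
  rw [norm_mul, norm_mul, RCLike.norm_conj, Complex.norm_I, one_mul]
  calc ‖r‖ * ‖cz‖ ≤ ‖r‖ * (3 * M ^ 2 * ‖r‖) := by gcongr
    _ = _ := by ring

/-- The zeroth component as a real-linear map. -/
def SobolevZero.fstL : SobolevZero ℂ 0 1 1 →L[ℝ] L2 ℂ 0 1 :=
  ((PiLp.proj (𝕜 := ℂ) 2 (fun _ : Fin 2 => L2 ℂ 0 1) 0) ∘L
    (SobolevZero ℂ 0 1 1).subtypeL).restrictScalars ℝ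

/-- Both solutions are bounded on `[0,T]`, so the cubic term is Lipschitz along them, and the
squared `L²` distance `y` satisfies `y' ≤ 2Ky` with `y(0) = 0`. -/
theorem IsClassicalSolution.unique {ε T : ℝ} {u φ : ℝ → ℝ} {ψ ψ' : ℝ → SobolevZero ℂ 0 1 3}
    (hT : 0 < T) (hu : ContinuousOn u (Icc 0 T)) (h : IsClassicalSolution ε T u φ ψ)
    (h' : IsClassicalSolution ε T u φ ψ') : ∀ t ∈ Icc 0 T, ψ' t = ψ t := by
  obtain ⟨M₁, hM₁⟩ := isCompact_Icc.exists_bound_of_continuousOn h.continuousOn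
  obtain ⟨M₂, hM₂⟩ := isCompact_Icc.exists_bound_of_continuousOn h'.continuousOn
  obtain ⟨Cu, hCu⟩ := isCompact_Icc.exists_bound_of_continuousOn hu
  set M := max M₁ M₂ with hM
  set K := Cu / 2 + |ε| * (3 * M ^ 2) with hK
  set A : ℝ → L2 ℂ 0 1 := fun t => wderiv (ψ t) 0 - wderiv (ψ' t) 0 with hA
  have hAd : ∀ t ∈ Ioo 0 T, HasDerivAt A (wderiv (deriv (fun s => toH10 (ψ s)) t) 0 -
      wderiv (deriv (fun s => toH10 (ψ' s)) t) 0) t := fun t ht => by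
    have d1 := ((h.contDiffOn.differentiableOn one_ne_zero t (Ioo_subset_Icc_self ht)).differentiableAt
      (Icc_mem_nhds ht.1 ht.2)).hasDerivAt
    have d2 := ((h'.contDiffOn.differentiableOn one_ne_zero t
      (Ioo_subset_Icc_self ht)).differentiableAt (Icc_mem_nhds ht.1 ht.2)).hasDerivAt
    exact (SobolevZero.fstL.hasFDerivAt.comp_hasDerivAt t d1).sub
      (SobolevZero.fstL.hasFDerivAt.comp_hasDerivAt t d2)
  have hAc : ContinuousOn A (Icc 0 T) :=
    (SobolevZero.fstL.continuous.comp_continuousOn h.contDiffOn.continuousOn).sub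
      (SobolevZero.fstL.continuous.comp_continuousOn h'.contDiffOn.continuousOn)
  set y : ℝ → ℝ := fun t => ‖A t‖ ^ 2 with hy
  have hyd : ∀ t ∈ Ioo 0 T, ∃ y', HasDerivAt y y' t ∧ y' ≤ 2 * K * y t := fun t ht => by
    have ht' := Ioo_subset_Icc_self ht
    refine ⟨_, (hAd t ht).norm_sq, ?_⟩
    have k1 := re_integral_diff_le ((hM₁ t ht').trans (le_max_left _ _))
      ((hM₂ t ht').trans (le_max_right _ _)) (h.equation t ht) (h'.equation t ht)
    have k2 := hCu t ht'
    rw [Real.norm_eq_abs] at k2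
    have k3 : (|u t| / 2 + |ε| * (3 * M ^ 2)) * ‖A t‖ ^ 2 ≤ K * ‖A t‖ ^ 2 := by
      rw [hK]; gcongr
    have k4 : inner ℝ (A t) (wderiv (deriv (fun s => toH10 (ψ s)) t) 0 -
        wderiv (deriv (fun s => toH10 (ψ' s)) t) 0) ≤ K * ‖A t‖ ^ 2 := by
      refine le_trans (le_of_eq ?_) (k1.trans k3)
      rw [L2.inner_def]
      refine integral_congr_ae (Eventually.of_forall fun x => ?_)
      simp only [Complex.inner, hA]
      rw [mul_comm]
    rw [hy]; simp only
    linarith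
  have hy0 : y 0 = 0 := by
    have : A 0 = 0 := by
      rw [hA]; simp only
      rw [sub_eq_zero]
      refine Lp.ext ?_
      filter_upwards [h.initial, h'.initial] with x k1 k2
      rw [k1, k2]
    rw [hy]; simp only
    rw [this]; simp
  have hanti : AntitoneOn (fun t => y t * Real.exp (-(2 * K) * t)) (Icc 0 T) := by
    have hd : ∀ t ∈ Ioo 0 T, ∃ y', HasDerivAt (fun t => y t * Real.exp (-(2 * K) * t)) y' t ∧
        y' ≤ 0 := fun t ht => by
      obtain ⟨y', h1, h2⟩ := hyd t ht
      have h3 : HasDerivAt (fun t => Real.exp (-(2 * K) * t))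
          (Real.exp (-(2 * K) * t) * (-(2 * K) * 1)) t :=
        ((hasDerivAt_id t).const_mul (-(2 * K))).exp
      refine ⟨_, h1.mul h3, ?_⟩
      have h4 := Real.exp_pos (-(2 * K) * t)
      nlinarith
    refine antitoneOn_of_deriv_nonpos (convex_Icc 0 T)
      ((hAc.norm.pow 2).mul (by fun_prop)) ?_ ?_
    · rw [interior_Icc]
      intro t ht
      obtain ⟨y', h1, -⟩ := hd t ht
      exact h1.differentiableAt.differentiableWithinAt
    · rw [interior_Icc]
      intro t ht
      obtain ⟨y', h1, h2⟩ := hd t ht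
      rw [h1.deriv]; exact h2
  intro t ht
  have h1 := hanti ⟨le_rfl, hT.le⟩ ht ht.1
  simp only [hy0, zero_mul] at h1
  have h2 : y t ≤ 0 := by
    by_contra! hc
    exact absurd h1 (not_le.2 (mul_pos hc (Real.exp_pos _)))
  have h3 : A t = 0 := by
    rw [hy] at h2; simp only at h2
    exact norm_eq_zero.1 (pow_eq_zero_iff two_ne_zero |>.1 (le_antisymm h2 (by positivity)))
  exact (SobolevZero.ext_of_wderiv_zero (sub_eq_zero.1 h3)).symm

/-! ### The ground state, the control and the conclusion -/

theorem ContinuousOn.memLp_Ioo {f : ℝ → ℂ} {a b : ℝ} (h : ContinuousOn f (Icc a b)) :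
    MemLp f 2 ((volume : Measure ℝ).restrict (Ioo a b)) := by
  obtain ⟨C, hC⟩ := isCompact_Icc.exists_bound_of_continuousOn h
  refine MemLp.of_bound
    ((h.mono Ioo_subset_Icc_self).aestronglyMeasurable measurableSet_Ioo) C ?_
  filter_upwards [ae_restrict_mem measurableSet_Ioo] with x hx
  exact hC x (Ioo_subset_Icc_self hx)

open Coeff

namespace IsGroundState

variable {ε μ : ℝ} {φ : ℝ → ℝ}

theorem exists_isPrimitive (h : IsGroundState ε μ φ) : ∃ φ' : ℝ → ℝ, IsPrimitive 0 1 φ φ' ∧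
    IsPrimitive 0 1 φ' (fun x => ε * μ * φ x - ε * φ x ^ 3) := by
  have hc : ContinuousOn (fun x => ε * μ * φ x - ε * φ x ^ 3) (Icc 0 1) :=
    (h.continuousOn.const_mul _).sub ((h.continuousOn.pow 3).const_mul _)
  have hi : IntervalIntegrable (fun x => ε * μ * φ x - ε * φ x ^ 3) volume 0 1 :=
    hc.intervalIntegrable_of_Icc zero_le_one
  have hd1 : ∀ x ∈ Ioo (0 : ℝ) 1, HasDerivAt φ (deriv φ x) x := fun x hx =>
    ((h.contDiffOn.differentiableOn two_ne_zero).differentiableAt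
      (isOpen_Ioo.mem_nhds hx)).hasDerivAt
  have hd2 : ∀ x ∈ Ioo (0 : ℝ) 1, HasDerivAt (deriv φ) (ε * μ * φ x - ε * φ x ^ 3) x := by
    intro x hx
    have h1 : ContDiffOn ℝ 1 (deriv φ) (Ioo 0 1) :=
      ((contDiffOn_succ_iff_deriv_of_isOpen (n := 1) isOpen_Ioo).1 h.contDiffOn).2.2
    have h2 := ((h1.differentiableOn one_ne_zero).differentiableAt
      (isOpen_Ioo.mem_nhds hx)).hasDerivAt
    rwa [eq_sub_of_add_eq (h.ode x hx)] at h2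
  have hm : (1 / 2 : ℝ) ∈ Ioo (0 : ℝ) 1 := by norm_num
  have hs : ∀ x ∈ Ioo (0 : ℝ) 1, uIcc (1 / 2) x ⊆ Ioo 0 1 := fun x hx =>
    ordConnected_Ioo.uIcc_subset hm hx
  -- The equation holds only in the open interval. The derivative is therefore rebuilt as a constant
  -- plus the integral of the right-hand side, which is continuous up to the ends; the constant is
  -- matched at `1/2`.
  set k := deriv φ (1 / 2) - ∫ t in (0 : ℝ)..1 / 2, ε * μ * φ t - ε * φ t ^ 3 with hk
  have hi' : ∀ x ∈ Icc (0 : ℝ) 1,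
      IntervalIntegrable (fun x => ε * μ * φ x - ε * φ x ^ 3) volume 0 x := fun x hx =>
    hi.mono_set (by rw [uIcc_of_le hx.1, uIcc_of_le zero_le_one]; exact Icc_subset_Icc_right hx.2)
  refine ⟨fun x => k + ∫ t in (0 : ℝ)..x, ε * μ * φ t - ε * φ t ^ 3, ?_, hi, fun x _ => by simp⟩
  refine IsPrimitive.of_hasDerivAt zero_le_one h.continuousOn (fun x hx => ?_) ?_
  · have e1 := intervalIntegral.integral_eq_sub_of_hasDerivAt (fun y hy => hd2 y (hs x hx hy))
      (((hc.mono Ioo_subset_Icc_self).mono (hs x hx)).intervalIntegrable)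
    have e2 := intervalIntegral.integral_add_adjacent_intervals
      (hi' _ (Ioo_subset_Icc_self hm))
      ((hi' _ (Ioo_subset_Icc_self hm)).symm.trans (hi' _ (Ioo_subset_Icc_self hx)))
    rw [e1] at e2
    have e3 : k + ∫ t in (0 : ℝ)..x, ε * μ * φ t - ε * φ t ^ 3 = deriv φ x := by
      rw [← e2, hk]; ring
    rw [e3]
    exact hd1 x hx
  · have h1 := intervalIntegral.continuousOn_primitive_interval (μ := volume)
      (hc.integrableOn_Icc.mono_set (uIcc_of_le zero_le_one).le)
    exact (h1.const_add k).intervalIntegrable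

/-- By the equation `φ''` is a polynomial in `φ` without constant term. It vanishes at the ends, and
`φ'''` is continuous on `[0,1]`, so the weighted sine coefficients are square summable. -/
theorem exists_coeff (h : IsGroundState ε μ φ) :
    ∃ a₀ : Coeff, ∀ x ∈ Icc (0 : ℝ) 1, J0 a₀ x = (φ x : ℂ) := by
  obtain ⟨φ', h0, h1⟩ := h.exists_isPrimitive
  have z := zero_le_one (α := ℝ)
  have h2 := (h0.const_mul z (ε * μ)).sub z
    (((h0.mul z (h0.mul z h0))).const_mul z ε)
  have hφc := h.continuousOn
  have hφ'c := h1.continuousOn z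
  set f₃ : ℝ → ℝ := fun x => ε * μ * φ' x - ε * (φ' x * (φ x * φ x) +
    φ x * (φ' x * φ x + φ x * φ' x)) with hf₃
  have hc : ContinuousOn f₃ (Icc 0 1) := by rw [hf₃]; fun_prop
  have hm : MemLp (fun x => (f₃ x : ℂ)) 2 ((volume : Measure ℝ).restrict (Ioo 0 1)) :=
    ContinuousOn.memLp_Ioo (Complex.continuous_ofReal.comp_continuousOn hc)
  have h2' : IsPrimitive 0 1 (fun x => ε * μ * φ x - ε * φ x ^ 3) f₃ :=
    h2.congr_left fun x _ => by ring
  have h3 := h2'.ofReal.congr_ae (L2.intervalIntegrable z hm.toLp)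
    (hm.coeFn_toLp.mono fun x hx => hx.symm)
  refine ⟨ofThird hm.toLp, fun x hx => ?_⟩
  have hl : (φ 0 : ℂ) = 0 := by rw [h.left]; simp
  have hr : (φ 1 : ℂ) = 0 := by rw [h.right]; simp
  have e : ∀ n, coef (fun x => (φ x : ℂ)) n = ofThird hm.toLp n := fun n => by
    rw [coef_eq_ofThird h0.ofReal h1.ofReal h3 hl hr (by simp [h.left])]
    simp [h.right]
  have k1 := hasSum_of_coef (f := fun x => (φ x : ℂ)) (C := ‖ofThird hm.toLp‖)
    (Complex.continuous_ofReal.comp_continuousOn hφc) hl hr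
    (fun n => by rw [e]; exact lp.norm_apply_le_norm two_ne_zero _ n) hx
  simp only [e] at k1
  exact (hasSum_J0 _ x).unique k1

end IsGroundState

theorem MemHDot10.exists_control {T : ℝ} {u : ℝ → ℝ} (hT : 0 < T) (h : MemHDot10 T u) (ε : ℝ) :
    ∃ c : Control T, c.ε = ε ∧ ∀ t ∈ Icc 0 T, c.u t = u t := by
  obtain ⟨U, hU⟩ := h.mem
  obtain ⟨f, hf, hf0, hfT, hfe⟩ := SobolevZero.exists_repr hT U
  have he : EqOn f u (Icc 0 T) := eq_on_Icc_of_ae hT (hf.continuousOn hT.le) h.continuousOn (by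
    filter_upwards [hfe, hU] with x h1 h2
    rw [← h1, h2])
  have hx : ∀ t ∈ Icc 0 T, IccExtend hT.le ((Icc 0 T).domRestrict u) t = u t := fun t ht => by
    rw [IccExtend_of_mem _ _ ht, domRestrict_apply]
  -- The control is extended by constants so that it is continuous on the whole line; its values
  -- outside `[0,T]` play no role.
  refine ⟨⟨IccExtend hT.le ((Icc 0 T).domRestrict u), wderiv U 1, ε, hT,
    h.continuousOn.domRestrict.Icc_extend', Lp.memLp (wderiv U 1),
    hf.congr_left fun t ht => (hx t ht).trans (he ht).symm, ?_, ?_⟩, rfl, hx⟩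
  · rw [hx 0 ⟨le_rfl, hT.le⟩, ← he ⟨le_rfl, hT.le⟩, hf0]
  · rw [hx T ⟨hT.le, le_rfl⟩, ← he ⟨hT.le, le_rfl⟩, hfT]

theorem IsClassicalSolution.congr_control {ε T : ℝ} {u v φ : ℝ → ℝ}
    {ψ : ℝ → SobolevZero ℂ 0 1 3} (h : IsClassicalSolution ε T v φ ψ)
    (huv : ∀ t ∈ Icc 0 T, v t = u t) : IsClassicalSolution ε T u φ ψ :=
  { h with
    equation := fun t ht => by
      have := h.equation t ht
      rwa [huv t (Ioo_subset_Icc_self ht)] at this }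

theorem proposition3 (ε : ℝ) (hε : ε = 1 ∨ ε = -1) (μ : ℝ) (hμ : -ε * Real.pi ^ 2 < μ)
    (φ : ℝ → ℝ) (hφ : IsGroundState ε μ φ) (T : ℝ) (hT : 0 < T)
    (u : ℝ → ℝ) (hu : MemHDot10 T u) :
    ∃ ψ : ℝ → SobolevZero ℂ 0 1 3,
      IsClassicalSolution ε T u φ ψ ∧
      (∀ ψ' : ℝ → SobolevZero ℂ 0 1 3,
        IsClassicalSolution ε T u φ ψ' → ∀ t ∈ Set.Icc 0 T, ψ' t = ψ t) ∧
      MemH3Paren (ψ T) ∧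
      ∀ t ∈ Set.Icc 0 T,
        ‖wderiv (ψ t) 0‖ =
          Real.sqrt (∫ x in Set.Ioo (0 : ℝ) 1, φ x ^ 2) *
            Real.exp (1 / 2 * ∫ s in (0 : ℝ)..t, u s) := by
  obtain ⟨a₀, ha₀⟩ := hφ.exists_coeff
  obtain ⟨c, rfl, hc⟩ := hu.exists_control hT ε
  obtain ⟨a, ha, hm⟩ := c.exists_mild_cubic a₀
  have hs := (hm.isClassicalSolution c ha ha₀).congr_control hc
  refine ⟨c.psi a, hs, fun ψ' h' => hs.unique hT hu.continuousOn h', c.memH3Paren_psi,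
    fun t ht => ?_⟩
  rw [hm.norm_psi c ha ha₀ ht, intervalIntegral.integral_congr (g := u) fun s hs => hc s ?_]
  rw [uIcc_of_le ht.1] at hs
  exact ⟨hs.1, hs.2.trans ht.2⟩
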